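/- **Corollary (FPRAS for counting bases of a matroid).** There are a randomized algorithm $\mathcal A$ and a polynomial $p$ in four variables such that the following holds for every matroid $M=([n],\mathcal I)$ on $n$ elements, of rank $r$, and all real numbers $0<\epsilon<1$ and $0<\delta<1$. Let $Z$ be the number of bases of $M$. Given $n$, $\epsilon$, $\delta$ and access to an independence oracle for $M$ (which answers, for a set $S\subseteq[n]$, whether $S\in\mathcal I$), the algorithm $\mathcal A$ halts, whatever the outcomes of its coin tosses, in time at most $p\bigl(n,r,1/\epsilon,\log(1/\delta)\bigr)$, and it outputs a rational number $\tilde Z$ such that $$\Pr\bigl[(1-\epsilon)Z\le\tilde Z\le(1+\epsilon)Z\bigr]\ \ge\ 1-\delta .$$ Here an algorithm is a single program, independent of $n$, $M$, $\epsilon$ and $\delta$, for a random-access machine that stores natural numbers, tosses fair coins, and may query the oracle about a subset of $[n]$ whose indicator vector it has stored. Time is measured by the logarithmic cost criterion: evaluating an arithmetic operation or a memory access costs its operands' evaluation costs plus one plus the binary length of its result, a query costs $n+1$, and every step costs at least $1$. The numbers $\epsilon$ and $\delta$ are given by their binary expansions, any digit of which can be read like a memory cell. -/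

import Mathlib

/-! A randomized random-access machine with an independence oracle, programmed in a structured
imperative language and timed by the logarithmic cost criterion.

The store has scalar variables and arrays, all holding natural numbers; a program mentions only
finitely many of them. Evaluating an expression costs, for each of its nodes, one plus the binary
length of the value computed there (addresses of array cells included), so arithmetic on long
numbers is charged for. Every step of a program costs at least one unit of time. -/

namespace OracleRAM

/-- Contents of the memory. -/
structure Store where
  /-- scalar variables -/
  var : ℕ → ℕ
  /-- `arr a i` is the cell of index `i` in the array named `a` -/
  arr : ℕ → ℕ → ℕ

/-- Arithmetic expressions; `sub` is truncated subtraction, `div` is integer division. -/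
inductive Expr where
  | const (c : ℕ)
  | var (x : ℕ)
  | get (a : ℕ) (i : Expr)
  | add (e₁ e₂ : Expr)
  | sub (e₁ e₂ : Expr)
  | mul (e₁ e₂ : Expr)
  | div (e₁ e₂ : Expr)

/-- The value of an expression. -/
def Expr.eval (s : Store) : Expr → ℕ
  | const c => c
  | var x => s.var x
  | get a i => s.arr a (i.eval s)
  | add e₁ e₂ => e₁.eval s + e₂.eval s
  | sub e₁ e₂ => e₁.eval s - e₂.eval s
  | mul e₁ e₂ => e₁.eval s * e₂.eval s
  | div e₁ e₂ => e₁.eval s / e₂.eval s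

/-- The logarithmic cost of evaluating an expression: the sum, over all its subexpressions,
of one plus the number of binary digits of the value. -/
def Expr.cost (s : Store) : Expr → ℕ
  | const c => 1 + c.size
  | var x => 1 + (s.var x).size
  | get a i => i.cost s + (1 + (s.arr a (i.eval s)).size)
  | add e₁ e₂ => e₁.cost s + e₂.cost s + (1 + (e₁.eval s + e₂.eval s).size)
  | sub e₁ e₂ => e₁.cost s + e₂.cost s + (1 + (e₁.eval s - e₂.eval s).size)
  | mul e₁ e₂ => e₁.cost s + e₂.cost s + (1 + (e₁.eval s * e₂.eval s).size)
  | div e₁ e₂ => e₁.cost s + e₂.cost s + (1 + (e₁.eval s / e₂.eval s).size)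

/-- Programs. A guard is true when its value is nonzero. -/
inductive Cmd where
  | skip
  /-- `x := e` -/
  | assign (x : ℕ) (e : Expr)
  /-- `a[i] := e` -/
  | write (a : ℕ) (i e : Expr)
  /-- set `x` to `0` or `1` by tossing a fair coin -/
  | flip (x : ℕ)
  /-- set `x` to `1` or `0` according to whether the set whose indicator vector
  is in the array `a` is accepted by the oracle -/
  | query (x a : ℕ)
  | seq (c₁ c₂ : Cmd)
  | ite (e : Expr) (c₁ c₂ : Cmd)
  | loop (e : Expr) (c : Cmd)

/-- `x := v` on stores. -/
def Store.setVar (s : Store) (x v : ℕ) : Store :=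
  { s with var := Function.update s.var x v }

/-- `a[i] := v` on stores. -/
def Store.setArr (s : Store) (a i v : ℕ) : Store :=
  { s with arr := Function.update s.arr a (Function.update (s.arr a) i v) }

/-- A configuration: the commands still to be executed (first one first), the memory, and the
time spent so far. -/
structure Config where
  todo : List Cmd
  store : Store
  time : ℕ

/-- The answer to a query about the subset of `Fin n` stored in array `a`. -/
noncomputable def answer {n : ℕ} (oracle : Set (Fin n) → Prop) (s : Store) (a : ℕ) : ℕ :=
  open Classical in if oracle {i : Fin n | s.arr a i ≠ 0} then 1 else 0

/-- One step of the machine, as a distribution on the next configuration. A configuration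
with nothing left to execute has halted and stays as it is. -/
noncomputable def step {n : ℕ} (oracle : Set (Fin n) → Prop) : Config → PMF Config
  | ⟨[], s, t⟩ => PMF.pure ⟨[], s, t⟩
  | ⟨.skip :: k, s, t⟩ => PMF.pure ⟨k, s, t + 1⟩
  | ⟨.assign x e :: k, s, t⟩ => PMF.pure ⟨k, s.setVar x (e.eval s), t + (1 + e.cost s)⟩
  | ⟨.write a i e :: k, s, t⟩ =>
      PMF.pure ⟨k, s.setArr a (i.eval s) (e.eval s), t + (1 + i.cost s + e.cost s)⟩
  | ⟨.flip x :: k, s, t⟩ =>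
      (PMF.uniformOfFintype Bool).map fun b => ⟨k, s.setVar x b.toNat, t + 1⟩
  | ⟨.query x a :: k, s, t⟩ => PMF.pure ⟨k, s.setVar x (answer oracle s a), t + (1 + n)⟩
  | ⟨.seq c₁ c₂ :: k, s, t⟩ => PMF.pure ⟨c₁ :: c₂ :: k, s, t + 1⟩
  | ⟨.ite e c₁ c₂ :: k, s, t⟩ =>
      PMF.pure ⟨(if e.eval s ≠ 0 then c₁ else c₂) :: k, s, t + (1 + e.cost s)⟩
  | ⟨.loop e c :: k, s, t⟩ =>
      PMF.pure ⟨if e.eval s ≠ 0 then c :: .loop e c :: k else k, s, t + (1 + e.cost s)⟩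

/-- The distribution of the configuration after a given number of steps. -/
noncomputable def run {n : ℕ} (oracle : Set (Fin n) → Prop) : ℕ → Config → PMF Config
  | 0, c => PMF.pure c
  | m + 1, c => (step oracle c).bind (run oracle m)

/-- The digit of weight `2 ^ (-(i + 1))` in the binary expansion of `x ∈ (0, 1)`. -/
noncomputable def binDigit (x : ℝ) (i : ℕ) : ℕ := ⌊x * 2 ^ (i + 1)⌋₊ % 2

/-- The initial configuration of the program `c`: variable `0` holds the number `n` of elements,
arrays `0` and `1` hold the binary expansions of the error parameters `ε` and `δ` (so that a real
number can be given to the machine, which reads as many digits as it likes), and the rest of the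
memory is zero. -/
noncomputable def init (c : Cmd) (n : ℕ) (ε δ : ℝ) : Config where
  todo := [c]
  store :=
    { var := fun x => if x = 0 then n else 0
      arr := fun a => if a = 0 then binDigit ε else if a = 1 then binDigit δ else fun _ => 0 }
  time := 0

/-- The machine has halted. -/
def Config.Halted (c : Config) : Prop := c.todo = []

/-- The output, a nonnegative rational number whose numerator and denominator are in the
variables `0` and `1`. -/
noncomputable def Config.output (c : Config) : ℝ := (c.store.var 0 : ℝ) / (c.store.var 1 : ℝ)

/-- The program `c`, on the input `n`, `ε`, `δ` and with the given oracle, halts in time at most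
`T` whatever the outcomes of the coin tosses. Each step takes at least one unit of time,
so `T` steps suffice. -/
def HaltsInTime (c : Cmd) {n : ℕ} (oracle : Set (Fin n) → Prop) (ε δ : ℝ) (T : ℕ) : Prop :=
  ∀ d ∈ (run oracle T (init c n ε δ)).support, d.Halted ∧ d.time ≤ T

/-- The probability that the program `c`, on the input `n`, `ε`, `δ` and with the given oracle,
has halted after `T` steps with an output in `A`. -/
noncomputable def outputProb (c : Cmd) {n : ℕ} (oracle : Set (Fin n) → Prop) (ε δ : ℝ) (T : ℕ)
    (A : Set ℝ) : ℝ :=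
  ((run oracle T (init c n ε δ)).toOuterMeasure {d | d.Halted ∧ d.output ∈ A}).toReal

end OracleRAM

/-!
# Approximate counting of the bases of a matroid

Fix a base `B`. For its elements `i` in increasing order let `K` be the set of the preceding
elements of `B`, and let `p i` be the fraction of the bases containing `K` that also contain `i`
(`memProb`). The product of the `p i` telescopes to the inverse of the number of bases
(`prod_memProb`), and every `p i` is at least `1 / n` (`one_div_le_memProb`). So it suffices to
estimate every `p i` by sampling bases that contain `K` almost uniformly.

The sampler is a walk on the bases containing `K`. Its moves are the involutions `exchange M K x y`,
which transpose `x` and `y` in a base whenever this yields a base containing `K`; the walk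
scans through all pairs `(x, y)` periodically and tosses a fair coin for each, to decide whether
the move is made. A move with its coin acts on functions as an orthogonal projection (`coinAvg`),
so that a scan is a product of projections. Such a product decreases the norm of a function of
mean zero by an inverse polynomial factor (`sum_sq_scanAvg_le`) as soon as the base exchange graph
satisfies a Poincaré inequality (`variance_le_exchangeForm`). That the sequence of moves is fixed
keeps the program simple: the only random choices are fair coins, and a walk of length `ℓ` uses
exactly `ℓ` of them.

The Poincaré inequality rests on the spectra of the links of the complex of independent sets. The
weighted graph `linkAdj M S` counts, for pairs `x`, `y` outside `S`, the bases that contain `S`,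
`x` and `y`. If `S` has corank two it is a complete multipartite graph, because being parallel is
an equivalence relation, and hence it has at most one positive eigenvalue (`linkAdj_corank_two`).
This property trickles down to sets of larger corank (`linkAdj_one_positive_eigenvalue`): the
forms of the links of `S + z` add up to a multiple of the form of the link of `S`, which shows
that every eigenvalue `c` of the walk on the link of `S` satisfies `c ≤ c ^ 2`, and the link is
connected (`quadForm_le_of_le_sq`). By duality, conditioning on one random element of the base
divides the variance by at least the corank, and an induction on the corank gives the Poincaré inequality.

A Chernoff bound over disjoint blocks of coins (`flipAvg_count_tail`), a union bound over the
elements of `B` and the comparison of the product of the estimates with the product of the `p i`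
show that the estimate is good with the required probability (`estimate_success`).

The program first reads the position of the leading binary digits of `ε` and `δ`, which determine
these numbers up to a factor of two, and computes a greedy base; then it tosses all the coins it
will need and stores them in an array; the rest is deterministic. The deterministic parts are
handled by a calculus for time-bounded total correctness (`OracleRAM.Runs`), and the tossing loop
by a coupling of the memory with the coins (`OracleRAM.run_flipCmd`).
-/

open Finset

/-! ### Matrices with one positive eigenvalue -/

/-- If a symmetric nonnegative matrix `A` with row sums `D` defines a connected graph and satisfies
`A ≤ A D⁻¹ A` as a quadratic form, then it has at most one positive eigenvalue relative to `D`.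
Indeed every eigenvalue `c` of the random walk `D⁻¹ A` satisfies `c ≤ c ^ 2` and `c ≤ 1`, so it is
nonpositive or equal to `1`, and by connectedness only constants have eigenvalue `1`. -/
theorem quadForm_le_of_le_sq {ι : Type*} [Fintype ι] [DecidableEq ι] (A : ι → ι → ℝ) (D : ι → ℝ)
    (hsymm : ∀ x y, A x y = A y x) (hnn : ∀ x y, 0 ≤ A x y) (hD : ∀ x, ∑ y, A x y = D x)
    (hconn : ∀ x y, 0 < D x → 0 < D y → 0 < A x y ∨ ∃ z, 0 < A x z ∧ 0 < A z y)
    (htr : ∀ g : ι → ℝ, ∑ x, ∑ y, A x y * g x * g y ≤ ∑ x, (∑ y, A x y * g y) ^ 2 / D x)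
    (g : ι → ℝ) :
    (∑ x, D x) * ∑ x, ∑ y, A x y * g x * g y ≤ (∑ x, D x * g x) ^ 2 := by
  have hD0 : ∀ x, 0 ≤ D x := fun x => hD x ▸ sum_nonneg fun y _ => hnn x y
  have hA0 : ∀ x, D x = 0 → ∀ y, A x y = 0 := by
    intro x hx y
    have h := (sum_eq_zero_iff_of_nonneg (fun y _ => hnn x y)).1 ((hD x).trans hx)
    exact h y (mem_univ y)
  -- the symmetric matrix `D ^ (-1/2) A D ^ (-1/2)`, with zero rows where `D` vanishes
  set N : Matrix ι ι ℝ := Matrix.of fun x y => A x y / (√(D x) * √(D y)) with hN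
  have hNh : N.IsHermitian := by
    ext x y
    simp [hN, hsymm y x, mul_comm]
  have hsq : ∀ x, √(D x) ^ 2 = D x := fun x => Real.sq_sqrt (hD0 x)
  have hform : ∀ v : ι → ℝ, ∑ x, ∑ y, A x y * (v x / √(D x)) * (v y / √(D y))
      = ∑ x, v x * (N.mulVec v) x := by
    intro v
    refine sum_congr rfl fun x _ => ?_
    rw [Matrix.mulVec, dotProduct, mul_sum]
    refine sum_congr rfl fun y _ => ?_
    simp only [hN, Matrix.of_apply, div_eq_mul_inv, mul_inv]
    ring
  have hform2 : ∀ v : ι → ℝ, ∑ x, (∑ y, A x y * (v y / √(D y))) ^ 2 / D x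
      = ∑ x, (N.mulVec v) x ^ 2 := by
    intro v
    refine sum_congr rfl fun x _ => ?_
    have : (N.mulVec v) x = (∑ y, A x y * (v y / √(D y))) / √(D x) := by
      rw [Matrix.mulVec, dotProduct, sum_div]
      refine sum_congr rfl fun y _ => ?_
      simp only [hN, Matrix.of_apply, div_eq_mul_inv, mul_inv]
      ring
    rw [this, div_pow, hsq]
  -- the Dirichlet form: it shows that the eigenvalues are at most `1`, and that an eigenvector for
  -- the eigenvalue `1` is constant along edges
  have hlap : ∀ g : ι → ℝ, ∑ x, ∑ y, A x y * (g x - g y) ^ 2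
      = 2 * ∑ x, D x * g x ^ 2 - 2 * ∑ x, ∑ y, A x y * g x * g y := by
    intro g
    have h1 : ∑ x, ∑ y, A x y * g x ^ 2 = ∑ x, D x * g x ^ 2 :=
      sum_congr rfl fun x _ => by rw [← sum_mul, hD]
    have h2 : ∑ x, ∑ y, A x y * g y ^ 2 = ∑ x, D x * g x ^ 2 := by
      rw [sum_comm]
      refine sum_congr rfl fun x _ => ?_
      rw [← hD, sum_mul]
      exact sum_congr rfl fun y _ => by rw [hsymm]
    calc _ = ∑ x, ∑ y, A x y * g x ^ 2 + ∑ x, ∑ y, A x y * g y ^ 2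
          - 2 * ∑ x, ∑ y, A x y * g x * g y := by
          simp only [mul_sum, ← sum_add_distrib, ← sum_sub_distrib]
          exact sum_congr rfl fun x _ => sum_congr rfl fun y _ => by ring
      _ = _ := by rw [h1, h2]; ring
  set u := hNh.eigenvectorBasis with hu
  set ev := hNh.eigenvalues with hev
  have heig : ∀ i x, (N.mulVec (u i).ofLp) x = ev i * u i x := by
    intro i x
    rw [hNh.mulVec_eigenvectorBasis]
    rfl
  have hunit : ∀ i, ∑ x, u i x ^ 2 = 1 := by
    intro i
    have := u.orthonormal.1 i
    rw [EuclideanSpace.norm_eq, Real.sqrt_eq_one] at this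
    simpa using this
  have horth : ∀ i j, i ≠ j → ∑ x, u i x * u j x = 0 := by
    intro i j hij
    have := u.orthonormal.2 hij
    simpa [PiLp.inner_apply, mul_comm] using this
  have hq : ∀ i, ∑ x, u i x * (N.mulVec (u i).ofLp) x = ev i := by
    intro i
    calc _ = ev i * ∑ x, u i x ^ 2 := by
          rw [mul_sum]; exact sum_congr rfl fun x _ => by rw [heig]; ring
      _ = _ := by rw [hunit, mul_one]
  have hle_sq : ∀ i, ev i ≤ ev i ^ 2 := by
    intro i
    have h := htr fun x => u i x / √(D x)
    rw [hform, hform2, hq] at h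
    refine h.trans (le_of_eq ?_)
    calc _ = ev i ^ 2 * ∑ x, u i x ^ 2 := by
          rw [mul_sum]; exact sum_congr rfl fun x _ => by rw [heig]; ring
      _ = _ := by rw [hunit, mul_one]
  have hDg : ∀ i x, D x * (u i x / √(D x)) ^ 2 ≤ u i x ^ 2 := by
    intro i x
    rcases (hD0 x).eq_or_lt with h | h
    · rw [← h]; simpa using sq_nonneg _
    · rw [div_pow, hsq, mul_div_cancel₀ _ h.ne']
  -- an eigenvector with a positive eigenvalue is a multiple of `√D`, and the eigenvalue is `1`
  have hpos : ∀ i, 0 < ev i → ev i = 1 ∧ ∃ c : ℝ, ∀ x, u i x = c * √(D x) := by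
    intro i hi
    have h1 : 1 ≤ ev i := by nlinarith [hle_sq i]
    have hlapi := hlap fun x => u i x / √(D x)
    rw [hform, hq] at hlapi
    have hnnl : 0 ≤ ∑ x, ∑ y, A x y * (u i x / √(D x) - u i y / √(D y)) ^ 2 :=
      sum_nonneg fun x _ => sum_nonneg fun y _ => mul_nonneg (hnn x y) (sq_nonneg _)
    have hle : ∑ x, D x * (u i x / √(D x)) ^ 2 ≤ 1 := by
      rw [← hunit i]; exact sum_le_sum fun x _ => hDg i x
    have hone : ∑ x, D x * (u i x / √(D x)) ^ 2 = 1 := by linarith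
    have hzero : ∑ x, ∑ y, A x y * (u i x / √(D x) - u i y / √(D y)) ^ 2 = 0 := by linarith
    have hadj : ∀ x y, 0 < A x y → u i x / √(D x) = u i y / √(D y) := by
      intro x y hxy
      have h2 := (sum_eq_zero_iff_of_nonneg (fun x _ => sum_nonneg fun y _ =>
        mul_nonneg (hnn x y) (sq_nonneg _))).1 hzero x (mem_univ x)
      have h3 := (sum_eq_zero_iff_of_nonneg (fun y _ =>
        mul_nonneg (hnn x y) (sq_nonneg _))).1 h2 y (mem_univ y)
      rcases mul_eq_zero.1 h3 with h | h
      · exact absurd h hxy.ne'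
      · exact sub_eq_zero.1 (pow_eq_zero_iff two_ne_zero |>.1 h)
    have hoff : ∀ x, D x = 0 → u i x = 0 := by
      intro x hx
      have h2 : ∑ x, (u i x ^ 2 - D x * (u i x / √(D x)) ^ 2) = 0 := by
        rw [sum_sub_distrib, hunit, hone, sub_self]
      have h3 := (sum_eq_zero_iff_of_nonneg fun x _ => sub_nonneg.2 (hDg i x)).1 h2 x (mem_univ x)
      rw [hx, zero_mul, sub_zero] at h3
      exact pow_eq_zero_iff two_ne_zero |>.1 h3
    refine ⟨by linarith, ?_⟩
    by_cases hex : ∃ x₀, 0 < D x₀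
    · obtain ⟨x₀, hx₀⟩ := hex
      refine ⟨u i x₀ / √(D x₀), fun x => ?_⟩
      rcases (hD0 x).eq_or_lt with h | h
      · rw [hoff x h.symm, ← h]; simp
      · have : u i x / √(D x) = u i x₀ / √(D x₀) := by
          rcases hconn x x₀ h hx₀ with h' | ⟨z, hz, hz'⟩
          · exact hadj _ _ h'
          · exact (hadj _ _ hz).trans (hadj _ _ hz')
        rw [← this, div_mul_cancel₀]
        exact (Real.sqrt_pos.2 h).ne'
    · refine ⟨0, fun x => ?_⟩
      rw [hoff x (le_antisymm (not_lt.1 fun h => hex ⟨x, h⟩) (hD0 x)), zero_mul]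
  -- expand the form of `v = √D g` in the eigenbasis
  set v : EuclideanSpace ℝ ι := WithLp.toLp 2 fun x => √(D x) * g x with hv
  have hAform : ∑ x, ∑ y, A x y * g x * g y = ∑ x, v x * (N.mulVec v.ofLp) x := by
    rw [← hform]
    refine sum_congr rfl fun x _ => sum_congr rfl fun y _ => ?_
    rcases (hD0 x).eq_or_lt with h | h
    · rw [hA0 x h.symm]; simp
    rcases (hD0 y).eq_or_lt with h' | h'
    · rw [hsymm, hA0 y h'.symm]; simp
    have := (Real.sqrt_pos.2 h).ne'
    have := (Real.sqrt_pos.2 h').ne'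
    simp only [hv]
    field_simp
  have hspec : ∑ x, v x * (N.mulVec v.ofLp) x = ∑ i, ev i * (∑ x, u i x * v x) ^ 2 := by
    have h := u.sum_inner_mul_inner v (WithLp.toLp 2 (N.mulVec v.ofLp))
    have h1 : inner ℝ v (WithLp.toLp 2 (N.mulVec v.ofLp)) = ∑ x, v x * (N.mulVec v.ofLp) x := by
      simp [PiLp.inner_apply, mul_comm]
    rw [← h1, ← h]
    refine sum_congr rfl fun i _ => ?_
    have h2 : inner ℝ v (u i) = ∑ x, u i x * v x := by simp [PiLp.inner_apply]
    have h3 : inner ℝ (u i) (WithLp.toLp 2 (N.mulVec v.ofLp)) = ev i * ∑ x, u i x * v x := by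
      have : ∑ x, u i x * (N.mulVec v.ofLp) x = ∑ x, (N.mulVec (u i).ofLp) x * v x := by
        simp only [Matrix.mulVec, dotProduct, mul_sum, sum_mul]
        rw [sum_comm]
        refine sum_congr rfl fun x _ => sum_congr rfl fun y _ => ?_
        have : N y x = N x y := by simp [hN, hsymm y x, mul_comm]
        rw [this]; ring
      calc _ = ∑ x, u i x * (N.mulVec v.ofLp) x := by simp [PiLp.inner_apply, mul_comm]
        _ = _ := by
          rw [this, mul_sum]; exact sum_congr rfl fun x _ => by rw [heig]; ring
    rw [h2, h3]; ring
  rw [hAform, hspec]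
  have hsum0 : 0 ≤ ∑ x, D x := sum_nonneg fun x _ => hD0 x
  by_cases hP : ∃ i, 0 < ev i
  · obtain ⟨i, hi⟩ := hP
    obtain ⟨h1, c, hc⟩ := hpos i hi
    have hcD : c ^ 2 * ∑ x, D x = 1 := by
      rw [← hunit i, mul_sum]
      exact sum_congr rfl fun x _ => by rw [hc, mul_pow, hsq]
    have hothers : ∀ j, j ≠ i → ev j ≤ 0 := by
      intro j hj
      by_contra hjp
      obtain ⟨-, c', hc'⟩ := hpos j (not_le.1 hjp)
      have h0 := horth j i hj
      have h0' : c' * c * ∑ x, D x = 0 := by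
        rw [← h0, mul_sum]
        exact sum_congr rfl fun x _ => by
          rw [hc, hc']; linear_combination (-(c' * c)) * hsq x
      have hcD' : c' ^ 2 * ∑ x, D x = 1 := by
        rw [← hunit j, mul_sum]
        exact sum_congr rfl fun x _ => by rw [hc', mul_pow, hsq]
      have : (c' * c * ∑ x, D x) ^ 2 = 1 := by
        calc _ = (c ^ 2 * ∑ x, D x) * (c' ^ 2 * ∑ x, D x) := by ring
          _ = 1 := by rw [hcD, hcD', one_mul]
      rw [h0'] at this
      norm_num at this
    have hle : ∑ j, ev j * (∑ x, u j x * v x) ^ 2 ≤ (∑ x, u i x * v x) ^ 2 := by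
      rw [← add_sum_erase univ _ (mem_univ i), h1, one_mul]
      have : ∑ j ∈ univ.erase i, ev j * (∑ x, u j x * v x) ^ 2 ≤ 0 :=
        sum_nonpos fun j hj => mul_nonpos_of_nonpos_of_nonneg (hothers j (ne_of_mem_erase hj))
          (sq_nonneg _)
      linarith
    have hci : ∑ x, u i x * v x = c * ∑ x, D x * g x := by
      rw [mul_sum]
      exact sum_congr rfl fun x _ => by
        rw [hc]; simp only [hv]; linear_combination (c * g x) * hsq x
    calc _ ≤ (∑ x, D x) * (∑ x, u i x * v x) ^ 2 := mul_le_mul_of_nonneg_left hle hsum0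
      _ = (c ^ 2 * ∑ x, D x) * (∑ x, D x * g x) ^ 2 := by rw [hci]; ring
      _ = _ := by rw [hcD, one_mul]
  · have : ∑ j, ev j * (∑ x, u j x * v x) ^ 2 ≤ 0 :=
      sum_nonpos fun j _ => mul_nonpos_of_nonpos_of_nonneg (not_lt.1 fun h => hP ⟨j, h⟩)
        (sq_nonneg _)
    exact (mul_nonpos_of_nonneg_of_nonpos hsum0 this).trans (sq_nonneg _)

/-! ### Bases containing a given set, and links in the independence complex -/

section Bases

variable {α : Type*} [Fintype α] [DecidableEq α]

/-- The bases of `M` that contain `S`, as finite sets. -/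
noncomputable def basesOver (M : Matroid α) (S : Finset α) : Finset (Finset α) :=
  open Classical in univ.filter fun B => M.IsBase (B : Set α) ∧ S ⊆ B

/-- The number of bases of `M` that contain `S`, as a real number. -/
noncomputable def numBases (M : Matroid α) (S : Finset α) : ℝ := #(basesOver M S)

variable {M : Matroid α} {r : ℕ}

theorem mem_basesOver {S B : Finset α} : B ∈ basesOver M S ↔ M.IsBase (B : Set α) ∧ S ⊆ B := by
  simp [basesOver]

theorem mem_basesOver_insert {S B : Finset α} {x : α} :
    B ∈ basesOver M (insert x S) ↔ B ∈ basesOver M S ∧ x ∈ B := by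
  simp only [mem_basesOver, insert_subset_iff]; tauto

theorem card_of_isBase {α : Type*} {M : Matroid α} {r : ℕ} (hr : M.eRank = (r : ℕ∞))
    {B : Finset α} (hB : M.IsBase (B : Set α)) : #B = r := by
  have h := hB.encard_eq_eRank
  rw [hr, Set.encard_coe_eq_coe_finsetCard] at h
  exact_mod_cast h

theorem card_of_mem_basesOver (hr : M.eRank = (r : ℕ∞)) {S B : Finset α}
    (hB : B ∈ basesOver M S) : #B = r := card_of_isBase hr (mem_basesOver.1 hB).1

theorem isBase_of_indep_of_card {α : Type*} [Fintype α] {M : Matroid α} {r : ℕ}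
    (hr : M.eRank = (r : ℕ∞)) {B : Finset α} (hB : M.Indep (B : Set α)) (hc : #B = r) :
    M.IsBase (B : Set α) := by
  obtain ⟨B', hB', hsub⟩ := hB.exists_isBase_superset
  lift B' to Finset α using Set.toFinite B'
  rwa [eq_of_subset_of_card_le (coe_subset.1 hsub) (by rw [card_of_isBase hr hB', hc])]

theorem exists_mem_basesOver {S : Finset α} (hS : M.Indep (S : Set α)) :
    ∃ B, B ∈ basesOver M S := by
  obtain ⟨B', hB', hsub⟩ := hS.exists_isBase_superset
  lift B' to Finset α using Set.toFinite B'
  exact ⟨B', mem_basesOver.2 ⟨hB', coe_subset.1 hsub⟩⟩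

theorem indep_of_mem_basesOver {S B : Finset α} (hB : B ∈ basesOver M S) :
    M.Indep (S : Set α) :=
  (mem_basesOver.1 hB).1.indep.subset (coe_subset.2 (mem_basesOver.1 hB).2)

theorem numBases_nonneg (S : Finset α) : 0 ≤ numBases M S := Nat.cast_nonneg _

theorem numBases_pos_iff {S : Finset α} : 0 < numBases M S ↔ M.Indep (S : Set α) := by
  rw [numBases, Nat.cast_pos, card_pos]
  exact ⟨fun ⟨B, hB⟩ => indep_of_mem_basesOver hB, fun h => exists_mem_basesOver h⟩

theorem numBases_eq_zero_of_subset {S T : Finset α} (h : S ⊆ T) (hS : numBases M S = 0) :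
    numBases M T = 0 := by
  by_contra hT
  have := numBases_pos_iff.1 ((numBases_nonneg T).lt_of_ne' hT)
  exact (numBases_pos_iff.2 (this.subset (coe_subset.2 h))).ne' hS

/-- If `S` has the size of a base, then only `S` itself can be a base containing `S`. -/
theorem basesOver_eq_singleton (hr : M.eRank = (r : ℕ∞)) {S : Finset α}
    (hS : M.Indep (S : Set α)) (hc : #S = r) : basesOver M S = {S} := by
  ext B
  rw [mem_singleton]
  constructor
  · intro hB
    exact (eq_of_subset_of_card_le (mem_basesOver.1 hB).2
      (by rw [hc, card_of_mem_basesOver hr hB])).symm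
  · rintro rfl
    exact mem_basesOver.2 ⟨isBase_of_indep_of_card hr hS hc, Subset.rfl⟩

theorem sum_basesOver_insert (S : Finset α) (F : α → Finset α → ℝ) :
    ∑ x ∈ Sᶜ, ∑ B ∈ basesOver M (insert x S), F x B
      = ∑ B ∈ basesOver M S, ∑ x ∈ B \ S, F x B := by
  refine sum_comm' fun x B => ?_
  rw [mem_basesOver_insert, mem_compl, mem_sdiff]; tauto

theorem card_sdiff_of_mem_basesOver (hr : M.eRank = (r : ℕ∞)) {S B : Finset α}
    (hB : B ∈ basesOver M S) : (#(B \ S) : ℝ) = r - #S := by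
  rw [card_sdiff_of_subset (mem_basesOver.1 hB).2,
    Nat.cast_sub (card_le_card (mem_basesOver.1 hB).2), card_of_mem_basesOver hr hB]

/-- Every base that contains `S` has `r - #S` further elements. -/
theorem sum_numBases_insert (hr : M.eRank = (r : ℕ∞)) (S : Finset α) :
    ∑ x ∈ Sᶜ, numBases M (insert x S) = (r - #S) * numBases M S := by
  have h := sum_basesOver_insert (M := M) S fun _ _ => 1
  simp only [sum_const, nsmul_eq_mul, mul_one] at h
  simp only [numBases]
  rw [h, sum_congr rfl fun B hB => card_sdiff_of_mem_basesOver hr hB, sum_const, nsmul_eq_mul,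
    mul_comm]

/-- The number of bases that contain `S`, `x` and `y`, for distinct `x`, `y` outside `S`: the
weighted adjacency matrix of the link of `S` in the complex of independent sets. -/
noncomputable def linkAdj (M : Matroid α) (S : Finset α) (x y : α) : ℝ :=
  if x ∈ S ∨ y ∈ S ∨ x = y then 0 else numBases M (insert x (insert y S))

/-- The number of bases that contain `S` and `x`, for `x` outside `S`. -/
noncomputable def linkWeight (M : Matroid α) (S : Finset α) (x : α) : ℝ :=
  if x ∈ S then 0 else numBases M (insert x S)

theorem linkAdj_symm (S : Finset α) (x y : α) : linkAdj M S x y = linkAdj M S y x := by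
  simp only [linkAdj, insert_comm x y S]
  congr 1
  simp only [eq_comm (a := x), or_left_comm]

theorem linkAdj_nonneg (S : Finset α) (x y : α) : 0 ≤ linkAdj M S x y := by
  unfold linkAdj; split_ifs <;> simp [numBases_nonneg]

theorem linkWeight_nonneg (S : Finset α) (x : α) : 0 ≤ linkWeight M S x := by
  unfold linkWeight; split_ifs <;> simp [numBases_nonneg]

theorem linkAdj_eq_linkWeight {S : Finset α} {x : α} (hx : x ∉ S) (y : α) :
    linkAdj M S x y = linkWeight M (insert x S) y := by
  simp only [linkAdj, linkWeight, mem_insert, insert_comm x y S, hx, false_or]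
  congr 1
  simp only [eq_comm (a := x), or_comm]

theorem sum_linkWeight (hr : M.eRank = (r : ℕ∞)) (S : Finset α) :
    ∑ x, linkWeight M S x = (r - #S) * numBases M S := by
  rw [← sum_numBases_insert hr, ← sum_compl_add_sum S]
  rw [sum_eq_zero (s := S) fun x hx => by simp [linkWeight, hx], add_zero]
  exact sum_congr rfl fun x hx => by simp [linkWeight, mem_compl.1 hx]

theorem sum_linkAdj (hr : M.eRank = (r : ℕ∞)) (S : Finset α) (x : α) :
    ∑ y, linkAdj M S x y = (r - #S - 1) * linkWeight M S x := by
  by_cases hx : x ∈ S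
  · simp [linkAdj, linkWeight, hx]
  · rw [sum_congr rfl fun y _ => linkAdj_eq_linkWeight hx y, sum_linkWeight hr,
      card_insert_of_notMem hx, linkWeight, if_neg hx]
    push_cast; ring

/-- The links of the sets `S + z` add up to a multiple of the link of `S`. -/
theorem sum_linkAdj_insert (hr : M.eRank = (r : ℕ∞)) (S : Finset α) (x y : α) :
    ∑ z ∈ Sᶜ, linkAdj M (insert z S) x y = (r - #S - 2) * linkAdj M S x y := by
  by_cases h : x ∈ S ∨ y ∈ S ∨ x = y
  · rw [linkAdj, if_pos h, mul_zero]
    refine sum_eq_zero fun z _ => ?_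
    rw [linkAdj, if_pos]
    simp only [mem_insert]; tauto
  · obtain ⟨hx, hy, hxy⟩ : x ∉ S ∧ y ∉ S ∧ x ≠ y := by tauto
    have hxi : x ∉ insert y S := by simp [hx, hxy]
    rw [linkAdj, if_neg h]
    have hc : (r : ℝ) - #S - 2 = r - #(insert x (insert y S)) := by
      rw [card_insert_of_notMem hxi, card_insert_of_notMem hy]; push_cast; ring
    rw [hc, ← sum_numBases_insert hr]
    symm
    refine sum_subset_zero_on_sdiff (by intro z; simp) ?_ ?_
    · intro z hz
      rw [linkAdj, if_pos]
      simp only [mem_sdiff, mem_compl, mem_insert] at hz ⊢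
      tauto
    · intro z hz
      simp only [mem_compl, mem_insert, not_or] at hz
      rw [linkAdj, if_neg]
      · congr 1; ext w; simp only [mem_insert]; tauto
      · simp only [mem_insert]
        rintro ((h | h) | (h | h) | h) <;> tauto

theorem linkAdj_pos_iff {S : Finset α} {x y : α} :
    0 < linkAdj M S x y ↔ x ∉ S ∧ y ∉ S ∧ x ≠ y ∧ M.Indep ↑(insert x (insert y S)) := by
  unfold linkAdj
  split_ifs with h
  · simp only [lt_self_iff_false, false_iff]; tauto
  · rw [numBases_pos_iff]; tauto

theorem linkWeight_pos_iff {S : Finset α} {x : α} :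
    0 < linkWeight M S x ↔ x ∉ S ∧ M.Indep ↑(insert x S) := by
  unfold linkWeight
  split_ifs with h
  · simp [h]
  · rw [numBases_pos_iff]; tauto

/-- Independence augmentation for two elements: if `S + x + z` and `S + y` are independent, then
`S + y + x` or `S + y + z` is. -/
theorem indep_insert_or {α : Type*} [DecidableEq α] {M : Matroid α} {S : Finset α} {x y z : α}
    (hx : x ∉ S) (hy : y ∉ S) (hz : z ∉ S) (hxz : x ≠ z)
    (h : M.Indep ↑(insert x (insert z S))) (h' : M.Indep ↑(insert y S)) :
    (x ≠ y ∧ M.Indep ↑(insert x (insert y S))) ∨ (z ≠ y ∧ M.Indep ↑(insert z (insert y S))) := by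
  have hlt : (↑(insert y S) : Set α).encard < (↑(insert x (insert z S)) : Set α).encard := by
    have hxi : x ∉ insert z S := by simp [hx, hxz]
    rw [Set.encard_coe_eq_coe_finsetCard, Set.encard_coe_eq_coe_finsetCard,
      card_insert_of_notMem hxi, card_insert_of_notMem hy, card_insert_of_notMem hz]
    exact_mod_cast Nat.lt_succ_self _
  obtain ⟨e, he, hi⟩ := h'.augment h hlt
  simp only [coe_insert, Set.mem_sdiff, Set.mem_insert_iff, mem_coe, not_or] at he
  rcases he with ⟨rfl | rfl | he, h2, h3⟩
  · left; exact ⟨h2, by simpa using hi⟩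
  · right; exact ⟨h2, by simpa using hi⟩
  · exact absurd he h3

/-- The graph of the link of a set of corank at least two has diameter at most two. -/
theorem link_connected (hr : M.eRank = (r : ℕ∞)) {S : Finset α} (hk : #S + 2 ≤ r) {x y : α}
    (hx : 0 < linkWeight M S x) (hy : 0 < linkWeight M S y) :
    0 < linkAdj M S x y ∨ ∃ z, 0 < linkAdj M S x z ∧ 0 < linkAdj M S z y := by
  rw [linkWeight_pos_iff] at hx hy
  by_cases hxy : 0 < linkAdj M S x y
  · exact Or.inl hxy
  right
  obtain ⟨B, hB⟩ := exists_mem_basesOver hx.2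
  have hcard : #(insert x S) < #B := by
    rw [card_insert_of_notMem hx.1, card_of_mem_basesOver hr hB]; omega
  obtain ⟨z, hzB, hz⟩ := exists_mem_notMem_of_card_lt_card hcard
  simp only [mem_insert, not_or] at hz
  have hxz : M.Indep ↑(insert x (insert z S)) := by
    rw [insert_comm]
    exact indep_of_mem_basesOver (mem_basesOver_insert.2 ⟨hB, hzB⟩)
  refine ⟨z, linkAdj_pos_iff.2 ⟨hx.1, hz.2, Ne.symm hz.1, hxz⟩, linkAdj_pos_iff.2 ?_⟩
  rcases indep_insert_or hx.1 hy.1 hz.2 (Ne.symm hz.1) hxz hy.2 with h | h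
  · exact absurd (linkAdj_pos_iff.2 ⟨hx.1, hy.1, h⟩) hxy
  · exact ⟨hz.2, hy.1, h⟩

/-- The matrix of an equivalence relation is positive semidefinite: its quadratic form is the sum,
over the classes, of the squares of the sums over a class. -/
theorem sum_sum_equivalence_nonneg {ι : Type*} [DecidableEq ι] (L : Finset ι) (R : ι → ι → Prop)
    [DecidableRel R] (hrefl : ∀ x ∈ L, R x x) (hsymm : ∀ x ∈ L, ∀ y ∈ L, R x y → R y x)
    (htrans : ∀ x ∈ L, ∀ y ∈ L, ∀ z ∈ L, R x y → R y z → R x z) (h : ι → ℝ) :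
    0 ≤ ∑ x ∈ L, ∑ y ∈ L, if R x y then h x * h y else 0 := by
  set cls : ι → Finset ι := fun x => L.filter (R x) with hcls
  have hiff : ∀ x ∈ L, ∀ y ∈ L, (R x y ↔ cls x = cls y) := by
    intro x hx y hy
    constructor
    · intro hxy
      ext z
      simp only [hcls, mem_filter, and_congr_right_iff]
      exact fun hz => ⟨fun h => htrans y hy x hx z hz (hsymm x hx y hy hxy) h,
        fun h => htrans x hx y hy z hz hxy h⟩
    · intro he
      have : y ∈ cls y := mem_filter.2 ⟨hy, hrefl y hy⟩
      rw [← he] at this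
      exact (mem_filter.1 this).2
  have : ∑ x ∈ L, ∑ y ∈ L, (if R x y then h x * h y else 0)
      = ∑ c ∈ L.image cls, (∑ x ∈ L, if cls x = c then h x else 0) ^ 2 := by
    simp only [sq, sum_mul_sum]
    rw [sum_comm]
    simp only [sum_comm (s := L.image cls)]
    refine sum_congr rfl fun x hx => sum_congr rfl fun y hy => ?_
    rw [sum_eq_single_of_mem (cls y) (mem_image_of_mem _ hy)]
    · simp only [if_true]
      have := hiff y hy x hx
      by_cases hR : R y x
      · rw [if_pos hR, if_pos (this.1 hR).symm, mul_comm]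
      · rw [if_neg hR, if_neg fun e => hR (this.2 e.symm), zero_mul]
    · intro c _ hc
      simp [hc.symm]
  rw [this]
  exact sum_nonneg fun _ _ => sq_nonneg _

end Bases

/-! ### Links have at most one positive eigenvalue -/

section Bases
variable {α : Type*} [Fintype α] [DecidableEq α] {M : Matroid α} {r : ℕ}

/-- The pairs of elements in the link of a set `S` of corank two form a complete multipartite
graph, whose parts are the classes of parallel elements. -/
theorem linkAdj_corank_two (hr : M.eRank = (r : ℕ∞)) {S : Finset α} (hS : #S + 2 = r)
    (g : α → ℝ) :
    2 * numBases M S * ∑ x, ∑ y, linkAdj M S x y * g x * g y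
      ≤ (∑ x, linkWeight M S x * g x) ^ 2 := by
  classical
  have hr' : (r : ℝ) - #S = 2 := by rw [← hS]; push_cast; ring
  set L : Finset α := univ.filter fun x => 0 < linkWeight M S x with hL
  have hLm : ∀ x, x ∈ L ↔ x ∉ S ∧ M.Indep ↑(insert x S) := fun x => by
    rw [hL, mem_filter, linkWeight_pos_iff]; simp
  set R : α → α → Prop := fun x y => ¬ 0 < linkAdj M S x y with hR
  have hval : ∀ x y, linkAdj M S x y = 0 ∨ linkAdj M S x y = 1 := by
    intro x y
    rcases (linkAdj_nonneg (M := M) S x y).eq_or_lt with h | h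
    · exact Or.inl h.symm
    right
    have h' := linkAdj_pos_iff.1 h
    have hxi : x ∉ insert y S := by simp [h'.1, h'.2.2.1]
    rw [linkAdj, if_neg (by tauto), numBases, basesOver_eq_singleton hr h'.2.2.2
      (by rw [card_insert_of_notMem hxi, card_insert_of_notMem h'.2.1]; omega)]
    simp
  have hin : ∀ x y, 0 < linkAdj M S x y → x ∈ L ∧ y ∈ L := by
    intro x y h
    have h' := linkAdj_pos_iff.1 h
    refine ⟨(hLm x).2 ⟨h'.1, h'.2.2.2.subset ?_⟩, (hLm y).2 ⟨h'.2.1, h'.2.2.2.subset ?_⟩⟩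
    · exact coe_subset.2 (insert_subset_insert _ (subset_insert _ _))
    · exact coe_subset.2 (subset_insert _ _)
  -- the form of the complete graph with loops minus that of the relation of being parallel
  have hform : ∀ h : α → ℝ, ∑ x, ∑ y, linkAdj M S x y * h x * h y
      = (∑ x ∈ L, h x) ^ 2 - ∑ x ∈ L, ∑ y ∈ L, if R x y then h x * h y else 0 := by
    intro h
    have hA : ∀ x y, linkAdj M S x y * h x * h y
        = if x ∈ L then (if y ∈ L then h x * h y - (if R x y then h x * h y else 0) else 0)
          else 0 := by
      intro x y
      by_cases hp : 0 < linkAdj M S x y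
      · rw [if_pos (hin x y hp).1, if_pos (hin x y hp).2, if_neg (not_not.2 hp),
          (hval x y).resolve_left hp.ne']
        ring
      · have h0 : linkAdj M S x y = 0 := le_antisymm (not_lt.1 hp) (linkAdj_nonneg _ _ _)
        simp [hR, h0]
    simp only [hA]
    rw [sq, sum_mul_sum, ← sum_sub_distrib,
      ← sum_subset (subset_univ L) fun x _ hx => by simp [hx]]
    refine sum_congr rfl fun x hx => ?_
    simp only [hx, if_true]
    rw [← sum_filter, filter_mem_eq_inter, univ_inter, sum_sub_distrib]
  -- for the centered function `g - t` the form of the complete graph vanishes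
  set t : ℝ := (∑ x ∈ L, g x) / #L with ht
  set Q : ℝ := ∑ x, ∑ y, linkAdj M S x y * (g x - t) * (g y - t) with hQ
  have hQ0 : Q ≤ 0 := by
    have hzero : ∑ x ∈ L, (g x - t) = 0 := by
      rw [sum_sub_distrib, sum_const, nsmul_eq_mul, ht]
      rcases L.eq_empty_or_nonempty with h | h
      · simp [h]
      · rw [mul_div_cancel₀, sub_self]
        exact_mod_cast h.card_pos.ne'
    rw [hQ, hform (fun x => g x - t), hzero]
    have := sum_sum_equivalence_nonneg L R
      (fun x _ => by simp [hR, linkAdj_pos_iff])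
      (fun x _ y _ h => by simpa only [hR, linkAdj_symm] using h)
      (fun x hx y hy z hz hxy hyz hxz => by
        rw [hLm] at hx hy hz
        have h := linkAdj_pos_iff.1 hxz
        rcases indep_insert_or hx.1 hy.1 hz.1 h.2.2.1 h.2.2.2 hy.2 with h | h
        · exact hxy (linkAdj_pos_iff.2 ⟨hx.1, hy.1, h⟩)
        · exact hyz ((linkAdj_symm (M := M) S z y) ▸ linkAdj_pos_iff.2 ⟨hz.1, hy.1, h⟩))
      (fun x => g x - t)
    linarith
  have hw : ∀ x, ∑ y, linkAdj M S x y = linkWeight M S x := fun x => by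
    rw [sum_linkAdj hr, hr']; ring
  have hW : ∑ x, linkWeight M S x = 2 * numBases M S := by rw [sum_linkWeight hr, hr']
  have h1 : ∑ x, ∑ y, linkAdj M S x y * g x = ∑ x, linkWeight M S x * g x :=
    sum_congr rfl fun x _ => by rw [← sum_mul, hw]
  have h2 : ∑ x, ∑ y, linkAdj M S x y * g y = ∑ x, linkWeight M S x * g x := by
    rw [sum_comm]
    exact sum_congr rfl fun x _ => by
      rw [← sum_mul, ← hw]; congr 1; exact sum_congr rfl fun y _ => linkAdj_symm _ _ _
  have h3 : ∑ x, ∑ y, linkAdj M S x y = 2 * numBases M S := by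
    rw [← hW]; exact sum_congr rfl fun x _ => hw x
  have hexp : Q = ∑ x, ∑ y, linkAdj M S x y * g x * g y
      - 2 * t * ∑ x, linkWeight M S x * g x + t ^ 2 * (2 * numBases M S) := by
    have : Q = ∑ x, ∑ y, linkAdj M S x y * g x * g y - t * ∑ x, ∑ y, linkAdj M S x y * g x
        - t * ∑ x, ∑ y, linkAdj M S x y * g y + t ^ 2 * ∑ x, ∑ y, linkAdj M S x y := by
      simp only [hQ, mul_sum, ← sum_add_distrib, ← sum_sub_distrib]
      exact sum_congr rfl fun x _ => sum_congr rfl fun y _ => by ring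
    rw [this, h1, h2, h3]; ring
  have hb := numBases_nonneg (M := M) S
  nlinarith [mul_nonneg hb (neg_nonneg.2 hQ0),
    sq_nonneg (∑ x, linkWeight M S x * g x - t * (2 * numBases M S))]

/-- The link of every set `S` of corank `k ≥ 2` is a weighted graph with at most one positive
eigenvalue. In corank two the graph is complete multipartite; in higher corank the property
trickles down from the links of `S + z`. -/
theorem linkAdj_one_positive_eigenvalue (hr : M.eRank = (r : ℕ∞)) {k : ℕ} (hk : 2 ≤ k) :
    ∀ S : Finset α, #S + k = r → ∀ g : α → ℝ,
      k * numBases M S * ∑ x, ∑ y, linkAdj M S x y * g x * g y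
        ≤ (k - 1) * (∑ x, linkWeight M S x * g x) ^ 2 := by
  induction k, hk using Nat.le_induction with
  | base =>
    intro S hS g
    have := linkAdj_corank_two hr hS g
    push_cast; linarith
  | succ k hk ih =>
    intro S hS g
    have hk2 : (2 : ℝ) ≤ k := by exact_mod_cast hk
    have hk0 : (0 : ℝ) < k := by linarith
    have hr' : (r : ℝ) - #S = k + 1 := by rw [← hS]; push_cast; ring
    have h := quadForm_le_of_le_sq (linkAdj M S) (fun x => k * linkWeight M S x)
      (linkAdj_symm S) (linkAdj_nonneg S) (fun x => by rw [sum_linkAdj hr, hr']; ring)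
      (fun x y hx hy => link_connected hr (by omega) (pos_of_mul_pos_right hx hk0.le)
        (pos_of_mul_pos_right hy hk0.le))
      (fun g => by
        have hz : ∀ z ∈ Sᶜ, ∑ x, ∑ y, linkAdj M (insert z S) x y * g x * g y
            ≤ (k - 1) * ((∑ y, linkAdj M S z y * g y) ^ 2 / (k * linkWeight M S z)) := by
          intro z hz
          have hzS := mem_compl.1 hz
          have hi := ih (insert z S) (by rw [card_insert_of_notMem hzS]; omega) g
          simp only [← linkAdj_eq_linkWeight hzS] at hi
          have hw : linkWeight M S z = numBases M (insert z S) := by rw [linkWeight, if_neg hzS]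
          rcases (numBases_nonneg (M := M) (insert z S)).eq_or_lt with h0 | h0
          · rw [hw, ← h0, mul_zero, div_zero, mul_zero]
            refine (sum_eq_zero fun x _ => sum_eq_zero fun y _ => ?_).le
            have : linkAdj M (insert z S) x y = 0 := by
              unfold linkAdj
              split_ifs
              · rfl
              · exact numBases_eq_zero_of_subset
                  ((subset_insert _ _).trans (subset_insert _ _)) h0.symm
            rw [this]; ring
          · rw [hw, ← mul_div_assoc, le_div_iff₀ (by positivity)]
            linarith
        have hs := sum_le_sum hz
        have hl : ∑ z ∈ Sᶜ, ∑ x, ∑ y, linkAdj M (insert z S) x y * g x * g y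
            = (k - 1) * ∑ x, ∑ y, linkAdj M S x y * g x * g y := by
          rw [sum_comm, mul_sum]
          refine sum_congr rfl fun x _ => ?_
          rw [sum_comm, mul_sum]
          refine sum_congr rfl fun y _ => ?_
          rw [← sum_mul, ← sum_mul, sum_linkAdj_insert hr, hr']; ring
        rw [hl, ← mul_sum] at hs
        refine (le_of_mul_le_mul_left hs (by linarith)).trans ?_
        exact sum_le_univ_sum_of_nonneg fun z => div_nonneg (sq_nonneg _)
          (mul_nonneg hk0.le (linkWeight_nonneg _ _))) g
    rw [← mul_sum, sum_linkWeight hr, hr'] at h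
    have h' : (∑ x, k * linkWeight M S x * g x) = k * ∑ x, linkWeight M S x * g x := by
      rw [mul_sum]; exact sum_congr rfl fun x _ => by ring
    rw [h'] at h
    push_cast
    have h2 : (k : ℝ) * ((k + 1) * numBases M S * ∑ x, ∑ y, linkAdj M S x y * g x * g y)
        ≤ k * (k * (∑ x, linkWeight M S x * g x) ^ 2) := by linarith
    have := le_of_mul_le_mul_left h2 hk0
    linarith

end Bases

/-! ### The Poincaré inequality for the base exchange graph -/

section Bases
variable {α : Type*} [Fintype α] [DecidableEq α] {M : Matroid α} {r : ℕ}

/-- The second moment of the sum of `g` over the elements outside `S` of a base containing `S`; the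
off-diagonal part is the form of the link. -/
theorem sum_basesOver_quadForm (S : Finset α) (g : α → ℝ) :
    ∑ B ∈ basesOver M S, (∑ x ∈ B \ S, g x) ^ 2
      = ∑ x ∈ Sᶜ, numBases M (insert x S) * g x ^ 2 + ∑ x, ∑ y, linkAdj M S x y * g x * g y := by
  have h1 : ∀ B ∈ basesOver M S, (∑ x ∈ B \ S, g x) ^ 2
      = ∑ x ∈ B \ S, ∑ y, if y ∈ B ∧ y ∉ S then g x * g y else 0 := by
    intro B _
    rw [sq, sum_mul_sum]
    refine sum_congr rfl fun x _ => ?_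
    rw [← sum_filter]
    refine sum_congr ?_ fun _ _ => rfl
    ext y; simp
  rw [sum_congr rfl h1, ← sum_basesOver_insert S, ← sum_add_sum_compl S fun x => ∑ y, _,
    sum_eq_zero (s := S) fun x hx => by simp [linkAdj, hx], zero_add, ← sum_add_distrib]
  refine sum_congr rfl fun x hx => ?_
  have hxS := mem_compl.1 hx
  rw [sum_comm, ← add_sum_erase univ _ (mem_univ x)]
  congr 1
  · rw [sum_congr rfl (g := fun _ => g x ^ 2), sum_const, nsmul_eq_mul]
    · rfl
    · intro B hB
      rw [if_pos ⟨(mem_basesOver_insert.1 hB).2, hxS⟩, sq]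
  · rw [← add_sum_erase (a := x) univ (fun y => linkAdj M S x y * g x * g y) (mem_univ x),
      linkAdj, if_pos (by simp), zero_mul, zero_mul, zero_add]
    refine sum_congr rfl fun y hy => ?_
    have hyx := ne_of_mem_erase hy
    by_cases hyS : y ∈ S
    · simp [linkAdj, hyS]
    · rw [linkAdj, if_neg (by tauto), ← sum_filter, sum_const, nsmul_eq_mul, numBases, mul_assoc]
      congr 3
      ext B
      simp only [mem_filter, mem_basesOver_insert]
      tauto

/-- Conditioning on one random element of the base divides the variance of a function by at least
the corank of `S`; this is dual to the bound on the second eigenvalue of the link. -/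
theorem sum_sq_condExp_le (hr : M.eRank = (r : ℕ∞)) {S : Finset α} (hS : #S + 2 ≤ r)
    (f : Finset α → ℝ) (hf : ∑ B ∈ basesOver M S, f B = 0) :
    ∑ x ∈ Sᶜ, (∑ B ∈ basesOver M (insert x S), f B) ^ 2 / numBases M (insert x S)
      ≤ ∑ B ∈ basesOver M S, f B ^ 2 := by
  set F : α → ℝ := fun x => ∑ B ∈ basesOver M (insert x S), f B with hF
  set g : α → ℝ := fun x => F x / numBases M (insert x S) with hg
  have hFg : ∀ x, F x = numBases M (insert x S) * g x := by
    intro x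
    rcases (numBases_nonneg (M := M) (insert x S)).eq_or_lt with h | h
    · have : basesOver M (insert x S) = ∅ := by
        rw [numBases] at h
        exact card_eq_zero.1 (by exact_mod_cast h.symm)
      simp [hF, this, ← h]
    · rw [hg, mul_div_cancel₀ _ h.ne']
  set T := ∑ x ∈ Sᶜ, F x ^ 2 / numBases M (insert x S) with hT
  have hT1 : T = ∑ x ∈ Sᶜ, F x * g x :=
    sum_congr rfl fun x _ => by rw [hg, sq, mul_div_assoc]
  have hT2 : T = ∑ B ∈ basesOver M S, f B * ∑ x ∈ B \ S, g x := by
    rw [hT1]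
    simp only [hF, sum_mul, mul_sum]
    rw [sum_basesOver_insert S fun x B => f B * g x]
  have hsq : ∑ B ∈ basesOver M S, (∑ x ∈ B \ S, g x) ^ 2 ≤ T := by
    rw [sum_basesOver_quadForm]
    have h1 : ∑ x ∈ Sᶜ, numBases M (insert x S) * g x ^ 2 = T := by
      rw [hT1]; exact sum_congr rfl fun x _ => by rw [hFg]; ring
    have h2 : ∑ x, linkWeight M S x * g x = 0 := by
      rw [← sum_compl_add_sum S, sum_eq_zero (s := S) fun x hx => by simp [linkWeight, hx],
        add_zero]
      have : ∑ x ∈ Sᶜ, linkWeight M S x * g x = ∑ x ∈ Sᶜ, F x :=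
        sum_congr rfl fun x hx => by rw [hFg, linkWeight, if_neg (mem_compl.1 hx)]
      rw [this]
      simp only [hF]
      rw [sum_basesOver_insert S fun x B => f B]
      simp only [sum_const, nsmul_eq_mul]
      rw [sum_congr rfl fun B hB => by rw [card_sdiff_of_mem_basesOver hr hB], ← mul_sum, hf,
        mul_zero]
    rw [h1]
    rcases (numBases_nonneg (M := M) S).eq_or_lt with h0 | h0
    · have : ∀ x y, linkAdj M S x y = 0 := by
        intro x y
        unfold linkAdj
        split_ifs
        · rfl
        · exact numBases_eq_zero_of_subset ((subset_insert _ _).trans (subset_insert _ _)) h0.symm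
      simp [this]
    · have hk : 2 ≤ r - #S := by omega
      have h := linkAdj_one_positive_eigenvalue hr hk S (by omega) g
      rw [h2] at h
      have hk0 : (0 : ℝ) < ((r - #S : ℕ) : ℝ) := by exact_mod_cast (by omega : 0 < r - #S)
      have := nonpos_of_mul_nonpos_right (by simpa using h) (mul_pos hk0 h0)
      linarith
  have hcs := sum_mul_sq_le_sq_mul_sq (basesOver M S) f fun B => ∑ x ∈ B \ S, g x
  rw [← hT2] at hcs
  have hT0 : 0 ≤ T := sum_nonneg fun x _ => div_nonneg (sq_nonneg _) (numBases_nonneg _)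
  have hf0 : 0 ≤ ∑ B ∈ basesOver M S, f B ^ 2 := sum_nonneg fun _ _ => sq_nonneg _
  by_contra hlt
  have : T ^ 2 ≤ (∑ B ∈ basesOver M S, f B ^ 2) * T :=
    hcs.trans (mul_le_mul_of_nonneg_left hsq hf0)
  nlinarith

/-- The Dirichlet form of the base exchange graph on the bases containing `S`; two bases are
adjacent when they differ by exchanging one element. -/
noncomputable def exchangeForm (M : Matroid α) (S : Finset α) (f : Finset α → ℝ) : ℝ :=
  ∑ B ∈ basesOver M S, ∑ B' ∈ basesOver M S, if #(B \ B') = 1 then (f B - f B') ^ 2 else 0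

/-- Two adjacent bases that contain `S` have `r - #S - 1` common elements outside `S`. -/
theorem sum_exchangeForm_insert (hr : M.eRank = (r : ℕ∞)) (S : Finset α) (f : Finset α → ℝ) :
    ∑ x ∈ Sᶜ, exchangeForm M (insert x S) f = (r - #S - 1) * exchangeForm M S f := by
  simp only [exchangeForm]
  rw [sum_basesOver_insert S fun x B => ∑ B' ∈ basesOver M (insert x S),
    if #(B \ B') = 1 then (f B - f B') ^ 2 else 0, mul_sum]
  refine sum_congr rfl fun B hB => ?_
  rw [sum_comm' (t' := basesOver M S) (s' := fun B' => (B \ S) ∩ B'), mul_sum]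
  · refine sum_congr rfl fun B' hB' => ?_
    rw [sum_const, nsmul_eq_mul]
    split_ifs with h
    · congr 1
      have hsub : B \ B' ⊆ B \ S := sdiff_subset_sdiff Subset.rfl (mem_basesOver.1 hB').2
      have : (B \ S) ∩ B' = (B \ S) \ (B \ B') := by ext x; simp; tauto
      rw [this, card_sdiff_of_subset hsub, Nat.cast_sub (card_le_card hsub),
        card_sdiff_of_mem_basesOver hr hB, h, Nat.cast_one]
    · simp
  · intro x B'
    rw [mem_basesOver_insert, mem_inter]
    tauto

theorem exchangeForm_sub_const (S : Finset α) (f : Finset α → ℝ) (c : ℝ) :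
    exchangeForm M S (fun B => f B - c) = exchangeForm M S f := by
  simp [exchangeForm]

/-- Shifting a function by a constant does not change its variance. -/
theorem sum_sq_sub_mean (S : Finset α) (f : Finset α → ℝ) (c : ℝ) :
    ∑ B ∈ basesOver M S, (f B - c) ^ 2 - (∑ B ∈ basesOver M S, (f B - c)) ^ 2 / numBases M S
      = ∑ B ∈ basesOver M S, f B ^ 2 - (∑ B ∈ basesOver M S, f B) ^ 2 / numBases M S := by
  have h1 : ∑ B ∈ basesOver M S, (f B - c) ^ 2 = ∑ B ∈ basesOver M S, f B ^ 2
      - 2 * c * ∑ B ∈ basesOver M S, f B + numBases M S * c ^ 2 := by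
    have : numBases M S * c ^ 2 = ∑ B ∈ basesOver M S, c ^ 2 := by
      rw [sum_const, nsmul_eq_mul, numBases]
    rw [this, mul_sum, ← sum_sub_distrib, ← sum_add_distrib]
    exact sum_congr rfl fun B _ => by ring
  have h2 : ∑ B ∈ basesOver M S, (f B - c) = ∑ B ∈ basesOver M S, f B - numBases M S * c := by
    rw [sum_sub_distrib, sum_const, nsmul_eq_mul, numBases]
  rw [h1, h2]
  rcases (numBases_nonneg (M := M) S).eq_or_lt with h0 | h0
  · have : basesOver M S = ∅ := by
      rw [numBases] at h0
      exact card_eq_zero.1 (by exact_mod_cast h0.symm)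
    simp [this, ← h0]
  · field_simp; ring

/-- Poincaré inequality for the base exchange graph on the bases containing `S`: the variance is
controlled by the Dirichlet form, with a constant that does not depend on the matroid. -/
theorem variance_le_exchangeForm (hr : M.eRank = (r : ℕ∞)) {k : ℕ} (hk : 1 ≤ k) :
    ∀ S : Finset α, #S + k = r → ∀ f : Finset α → ℝ,
      ∑ B ∈ basesOver M S, f B ^ 2 - (∑ B ∈ basesOver M S, f B) ^ 2 / numBases M S
        ≤ 1 / 2 * exchangeForm M S f := by
  induction k, hk using Nat.le_induction with
  | base =>
    intro S hS f
    -- in corank one any two bases are adjacent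
    have hadj : ∀ B ∈ basesOver M S, ∀ B' ∈ basesOver M S,
        (if #(B \ B') = 1 then (f B - f B') ^ 2 else 0) = (f B - f B') ^ 2 := by
      intro B hB B' hB'
      split_ifs with h
      · rfl
      · have h1 : #(B \ S) = 1 := by
          rw [card_sdiff_of_subset (mem_basesOver.1 hB).2, card_of_mem_basesOver hr hB]; omega
        have h2 : #(B \ B') ≤ #(B \ S) :=
          card_le_card (sdiff_subset_sdiff Subset.rfl (mem_basesOver.1 hB').2)
        have h3 : #(B \ B') = 0 := by omega
        have h4 : B = B' := eq_of_subset_of_card_le (sdiff_eq_empty_iff_subset.1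
          (card_eq_zero.1 h3)) (by rw [card_of_mem_basesOver hr hB, card_of_mem_basesOver hr hB'])
        rw [h4]; simp
    have hE : exchangeForm M S f = 2 * (numBases M S * ∑ B ∈ basesOver M S, f B ^ 2
        - (∑ B ∈ basesOver M S, f B) ^ 2) := by
      rw [exchangeForm, sum_congr rfl fun B hB => sum_congr rfl (hadj B hB)]
      have : ∀ B ∈ basesOver M S, ∑ B' ∈ basesOver M S, (f B - f B') ^ 2
          = numBases M S * f B ^ 2 - 2 * f B * ∑ B' ∈ basesOver M S, f B'
            + ∑ B' ∈ basesOver M S, f B' ^ 2 := by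
        intro B _
        rw [numBases, ← nsmul_eq_mul, ← sum_const, mul_sum, ← sum_sub_distrib, ← sum_add_distrib]
        exact sum_congr rfl fun B' _ => by ring
      rw [sum_congr rfl this, sum_add_distrib, sum_sub_distrib, ← mul_sum, ← sum_mul, ← mul_sum,
        sum_const, nsmul_eq_mul, numBases]
      ring
    rcases (basesOver M S).eq_empty_or_nonempty with h0 | h0
    · simp [h0, exchangeForm]
    · have h1 : (1 : ℝ) ≤ numBases M S := by
        rw [numBases]; exact_mod_cast h0.card_pos
      have h2 : 0 ≤ exchangeForm M S f := sum_nonneg fun _ _ => sum_nonneg fun _ _ => by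
        split_ifs <;> positivity
      have h3 : ∑ B ∈ basesOver M S, f B ^ 2 - (∑ B ∈ basesOver M S, f B) ^ 2 / numBases M S
          = 1 / 2 * exchangeForm M S f / numBases M S := by
        rw [hE]; field_simp
      rw [h3]
      exact div_le_self (by positivity) h1
  | succ k hk ih =>
    intro S hS f
    set m := (∑ B ∈ basesOver M S, f B) / numBases M S with hm
    rw [← sum_sq_sub_mean S f m, ← exchangeForm_sub_const S f m]
    set h : Finset α → ℝ := fun B => f B - m with hh
    have hh0 : ∑ B ∈ basesOver M S, h B = 0 := by
      rw [hh, sum_sub_distrib, sum_const, nsmul_eq_mul, hm]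
      rcases (basesOver M S).eq_empty_or_nonempty with h0 | h0
      · simp [h0]
      · rw [numBases, mul_div_cancel₀, sub_self]
        exact_mod_cast h0.card_pos.ne'
    have hr' : (r : ℝ) - #S = k + 1 := by rw [← hS]; push_cast; ring
    have hs := sum_le_sum fun x (hx : x ∈ Sᶜ) =>
      ih (insert x S) (by rw [card_insert_of_notMem (mem_compl.1 hx)]; omega) h
    rw [sum_sub_distrib, ← mul_sum, sum_exchangeForm_insert hr, hr',
      sum_basesOver_insert S fun x B => h B ^ 2] at hs
    have hsum : ∑ B ∈ basesOver M S, ∑ x ∈ B \ S, h B ^ 2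
        = (k + 1) * ∑ B ∈ basesOver M S, h B ^ 2 := by
      rw [mul_sum]
      refine sum_congr rfl fun B hB => ?_
      rw [sum_const, nsmul_eq_mul, card_sdiff_of_mem_basesOver hr hB, hr']
    rw [hsum] at hs
    have hkey := sum_sq_condExp_le hr (S := S) (by omega) h hh0
    rw [show ∑ B ∈ basesOver M S, (f B - m) = 0 from hh0]
    have hk0 : (0 : ℝ) < k := by exact_mod_cast hk
    have : k * ∑ B ∈ basesOver M S, h B ^ 2 ≤ k * (1 / 2 * exchangeForm M S h) := by linarith
    have := le_of_mul_le_mul_left this hk0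
    simpa using this

end Bases

/-! ### Scans of coin-controlled exchanges -/

section Involutions
variable {β : Type*}

/-- The average of a function over the outcomes of a fair coin that decides whether `σ` is
applied. For an involution `σ` this is an orthogonal projection. -/
noncomputable def coinAvg (σ : β → β) (g : β → ℝ) (b : β) : ℝ := (g b + g (σ b)) / 2

/-- `σ` restricts to an involution of the finite set `F`. -/
def IsInvolutionOn (F : Finset β) (σ : β → β) : Prop := ∀ b ∈ F, σ b ∈ F ∧ σ (σ b) = b

variable {F : Finset β} {σ : β → β}

theorem IsInvolutionOn.sum_comp (h : IsInvolutionOn F σ) (g : β → ℝ) :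
    ∑ b ∈ F, g (σ b) = ∑ b ∈ F, g b :=
  sum_nbij' σ σ (fun b hb => (h b hb).1) (fun b hb => (h b hb).1) (fun b hb => (h b hb).2)
    (fun b hb => (h b hb).2) fun _ _ => rfl

theorem IsInvolutionOn.sum_coinAvg (h : IsInvolutionOn F σ) (g : β → ℝ) :
    ∑ b ∈ F, coinAvg σ g b = ∑ b ∈ F, g b := by
  simp only [coinAvg]
  rw [← sum_div, sum_add_distrib, h.sum_comp g]; ring

theorem IsInvolutionOn.sum_sq_sub_coinAvg (h : IsInvolutionOn F σ) (g : β → ℝ) :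
    ∑ b ∈ F, (g b - coinAvg σ g b) ^ 2 = ∑ b ∈ F, g b ^ 2 - ∑ b ∈ F, coinAvg σ g b ^ 2 := by
  have h1 := h.sum_comp fun b => g b ^ 2
  have h2 : ∑ b ∈ F, ((g b - coinAvg σ g b) ^ 2 - g b ^ 2 + coinAvg σ g b ^ 2)
      = ∑ b ∈ F, (g (σ b) ^ 2 - g b ^ 2) / 2 :=
    sum_congr rfl fun b _ => by simp only [coinAvg]; ring
  rw [← sum_div, sum_sub_distrib, h1, sub_self, zero_div, sum_add_distrib, sum_sub_distrib] at h2
  linarith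

/-- The projection of `g` is at least as close to `g` as any other projected function. -/
theorem IsInvolutionOn.sum_sq_sub_coinAvg_le (h : IsInvolutionOn F σ) (g k : β → ℝ) :
    ∑ b ∈ F, (g b - coinAvg σ g b) ^ 2 ≤ ∑ b ∈ F, (g b - coinAvg σ k b) ^ 2 := by
  have h1 := h.sum_sq_sub_coinAvg fun b => g b - coinAvg σ k b
  have h2 : ∑ b ∈ F, (g b - coinAvg σ g b) ^ 2 = ∑ b ∈ F, (g b - coinAvg σ k b -
      coinAvg σ (fun b => g b - coinAvg σ k b) b) ^ 2 := by
    refine sum_congr rfl fun b hb => ?_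
    simp only [coinAvg, (h b hb).2]
    ring
  rw [h2, h1]
  have := sum_nonneg fun b (_ : b ∈ F) => sq_nonneg (coinAvg σ (fun b => g b - coinAvg σ k b) b)
  linarith

/-- The composition of the projections `coinAvg σ` for `σ` in the list, the last one acting
first. -/
noncomputable def scanAvg (l : List (β → β)) (g : β → ℝ) : β → ℝ := l.foldr coinAvg g

theorem sum_scanAvg {l : List (β → β)} (h : ∀ σ ∈ l, IsInvolutionOn F σ) (g : β → ℝ) :
    ∑ b ∈ F, scanAvg l g b = ∑ b ∈ F, g b := by
  induction l with
  | nil => rfl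
  | cons σ l ih =>
    rw [← ih fun σ hσ => h σ (List.mem_cons_of_mem _ hσ)]
    exact (h σ List.mem_cons_self).sum_coinAvg _

theorem sum_sq_scanAvg_le_self {l : List (β → β)} (h : ∀ σ ∈ l, IsInvolutionOn F σ)
    (g : β → ℝ) : ∑ b ∈ F, scanAvg l g b ^ 2 ≤ ∑ b ∈ F, g b ^ 2 := by
  induction l with
  | nil => exact le_rfl
  | cons σ l ih =>
    refine le_trans ?_ (ih fun σ hσ => h σ (List.mem_cons_of_mem _ hσ))
    have h1 := (h σ List.mem_cons_self).sum_sq_sub_coinAvg (scanAvg l g)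
    have h2 := sum_nonneg fun b (_ : b ∈ F) => sq_nonneg (scanAvg l g b - coinAvg σ (scanAvg l g) b)
    exact sub_nonneg.1 (h1 ▸ h2)

/-- The Cauchy–Schwarz step by which the displacements caused by the projections of a list
accumulate. -/
theorem sum_sq_add_le {p X Y : ℝ} (hp : 0 ≤ p) (hX : 0 ≤ X) (u v : β → ℝ)
    (hu : ∑ b ∈ F, u b ^ 2 ≤ p * X) (hv : ∑ b ∈ F, v b ^ 2 = Y) :
    ∑ b ∈ F, (u b + v b) ^ 2 ≤ (p + 1) * (X + Y) := by
  rcases hp.eq_or_lt with rfl | hp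
  · have h0 : ∀ b ∈ F, u b = 0 := by
      intro b hb
      have h1 : ∑ b ∈ F, u b ^ 2 = 0 :=
        le_antisymm (by simpa using hu) (sum_nonneg fun _ _ => sq_nonneg _)
      exact pow_eq_zero_iff two_ne_zero |>.1
        ((sum_eq_zero_iff_of_nonneg fun _ _ => sq_nonneg _).1 h1 b hb)
    rw [sum_congr rfl fun b hb => by rw [h0 b hb, zero_add], hv]; linarith
  · have h1 : ∀ b ∈ F, (u b + v b) ^ 2 ≤ (1 + 1 / p) * u b ^ 2 + (1 + p) * v b ^ 2 := by
      intro b _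
      have : (1 + 1 / p) * u b ^ 2 + (1 + p) * v b ^ 2 - (u b + v b) ^ 2
          = (u b - p * v b) ^ 2 / p := by field_simp; ring
      have : 0 ≤ (u b - p * v b) ^ 2 / p := by positivity
      linarith
    have h2 := sum_le_sum h1
    rw [sum_add_distrib, ← mul_sum, ← mul_sum, hv] at h2
    have h3 : (1 + 1 / p) * ∑ b ∈ F, u b ^ 2 ≤ (1 + 1 / p) * (p * X) :=
      mul_le_mul_of_nonneg_left hu (by positivity)
    have h4 : (1 + 1 / p) * (p * X) = (p + 1) * X := by field_simp
    linarith

/-- If a scan through a list of projections hardly decreases the norm of `g`, then `g` is almost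
fixed by the scan and by each of the projections. -/
theorem scanAvg_norm_decrease {l : List (β → β)} (h : ∀ σ ∈ l, IsInvolutionOn F σ) (g : β → ℝ) :
    ∑ b ∈ F, (g b - scanAvg l g b) ^ 2
        ≤ l.length * (∑ b ∈ F, g b ^ 2 - ∑ b ∈ F, scanAvg l g b ^ 2) ∧
      ∀ σ ∈ l, ∑ b ∈ F, (g b - coinAvg σ g b) ^ 2
        ≤ l.length * (∑ b ∈ F, g b ^ 2 - ∑ b ∈ F, scanAvg l g b ^ 2) := by
  induction l with
  | nil => simp [scanAvg]
  | cons σ l ih =>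
    obtain ⟨ih1, ih2⟩ := ih fun σ hσ => h σ (List.mem_cons_of_mem _ hσ)
    have hσ := h σ List.mem_cons_self
    set k := scanAvg l g with hk
    have hcons : scanAvg (σ :: l) g = coinAvg σ k := rfl
    rw [hcons]
    have hX := hσ.sum_sq_sub_coinAvg k
    have hY : 0 ≤ ∑ b ∈ F, k b ^ 2 - ∑ b ∈ F, coinAvg σ k b ^ 2 :=
      hX ▸ sum_nonneg fun _ _ => sq_nonneg _
    have hXnn : 0 ≤ ∑ b ∈ F, g b ^ 2 - ∑ b ∈ F, k b ^ 2 :=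
      sub_nonneg.2 (sum_sq_scanAvg_le_self (fun σ hσ => h σ (List.mem_cons_of_mem _ hσ)) g)
    have h1 : ∑ b ∈ F, (g b - coinAvg σ k b) ^ 2 ≤ ((σ :: l).length : ℝ) *
        (∑ b ∈ F, g b ^ 2 - ∑ b ∈ F, coinAvg σ k b ^ 2) := by
      have := sum_sq_add_le (Nat.cast_nonneg l.length) hXnn (fun b => g b - k b)
        (fun b => k b - coinAvg σ k b) ih1 hX
      simp only [sub_add_sub_cancel] at this
      rw [List.length_cons, Nat.cast_succ]
      exact this
    refine ⟨h1, fun ρ hρ => ?_⟩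
    rcases List.mem_cons.1 hρ with rfl | hρ
    · exact (hσ.sum_sq_sub_coinAvg_le g k).trans h1
    · refine (ih2 ρ hρ).trans ?_
      rw [List.length_cons, Nat.cast_succ]
      have hl : (0 : ℝ) ≤ l.length := Nat.cast_nonneg _
      nlinarith [mul_nonneg hl hY]

end Involutions

section Exchange
variable {α : Type*} [DecidableEq α]

/-- The image of `B` under the transposition of `x` and `y`. -/
def swapSet (x y : α) (B : Finset α) : Finset α := B.map (Equiv.swap x y).toEmbedding

theorem mem_swapSet {x y z : α} {B : Finset α} : z ∈ swapSet x y B ↔ Equiv.swap x y z ∈ B := by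
  rw [swapSet, mem_map_equiv, Equiv.symm_swap]

theorem swapSet_swapSet (x y : α) (B : Finset α) : swapSet x y (swapSet x y B) = B := by
  ext z; simp [mem_swapSet]

theorem card_swapSet (x y : α) (B : Finset α) : #(swapSet x y B) = #B := card_map _

/-- One move of the walk on the bases that contain `K`: exchange the roles of `x` and `y`, unless
one of them is in `K` or the result is not independent. -/
noncomputable def exchange (M : Matroid α) (K : Finset α) (x y : α) (B : Finset α) : Finset α :=
  open Classical in
  if x ∈ K ∨ y ∈ K then B else if M.Indep (swapSet x y B : Set α) then swapSet x y B else B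

variable [Fintype α] {M : Matroid α} {r : ℕ}

theorem isInvolutionOn_exchange (hr : M.eRank = (r : ℕ∞)) (K : Finset α) (x y : α) :
    IsInvolutionOn (basesOver M K) (exchange M K x y) := by
  intro B hB
  by_cases hK : x ∈ K ∨ y ∈ K
  · simp [exchange, hK, hB]
  have hex : ∀ C, exchange M K x y C
      = open Classical in if M.Indep (swapSet x y C : Set α) then swapSet x y C else C :=
    fun C => if_neg hK
  by_cases hi : M.Indep (swapSet x y B : Set α)
  · rw [hex B, if_pos hi]
    constructor
    · refine mem_basesOver.2 ⟨isBase_of_indep_of_card hr hi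
        (by rw [card_swapSet, card_of_mem_basesOver hr hB]), fun z hz => ?_⟩
      rw [mem_swapSet, Equiv.swap_apply_of_ne_of_ne (by rintro rfl; tauto) (by rintro rfl; tauto)]
      exact (mem_basesOver.1 hB).2 hz
    · rw [hex, swapSet_swapSet, if_pos (mem_basesOver.1 hB).1.indep]
  · simp [hex, hi, hB]

/-- Adjacent bases are connected by a move of the walk. -/
theorem exists_exchange_eq (hr : M.eRank = (r : ℕ∞)) {K B B' : Finset α}
    (hB : B ∈ basesOver M K) (hB' : B' ∈ basesOver M K) (h : #(B \ B') = 1) :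
    ∃ p : α × α, exchange M K p.1 p.2 B = B' := by
  have h' : #(B' \ B) = 1 := by
    have h1 := card_sdiff_add_card_inter B B'
    have h2 := card_sdiff_add_card_inter B' B
    rw [inter_comm] at h2
    rw [card_of_mem_basesOver hr hB] at h1
    rw [card_of_mem_basesOver hr hB'] at h2
    omega
  obtain ⟨x, hx⟩ := card_eq_one.1 h
  obtain ⟨y, hy⟩ := card_eq_one.1 h'
  have hx' : ∀ z, (z ∈ B ∧ z ∉ B') ↔ z = x := fun z => by rw [← mem_sdiff, hx, mem_singleton]
  have hy' : ∀ z, (z ∈ B' ∧ z ∉ B) ↔ z = y := fun z => by rw [← mem_sdiff, hy, mem_singleton]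
  have hxm := (hx' x).2 rfl
  have hym := (hy' y).2 rfl
  have hs : swapSet x y B = B' := by
    ext z
    rw [mem_swapSet]
    by_cases hzx : z = x
    · rw [hzx, Equiv.swap_apply_left]; tauto
    by_cases hzy : z = y
    · rw [hzy, Equiv.swap_apply_right]; tauto
    rw [Equiv.swap_apply_of_ne_of_ne hzx hzy]
    have := hx' z
    have := hy' z
    tauto
  refine ⟨(x, y), ?_⟩
  have hxK : x ∉ K := fun h => hxm.2 ((mem_basesOver.1 hB').2 h)
  have hyK : y ∉ K := fun h => hym.2 ((mem_basesOver.1 hB).2 h)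
  rw [exchange, if_neg (by tauto), if_pos, hs]
  rw [hs]
  exact (mem_basesOver.1 hB').1.indep

/-- Distinct neighbours of a base in the exchange graph are reached by distinct moves. -/
theorem exchangeForm_le_sum_exchange (hr : M.eRank = (r : ℕ∞)) (K : Finset α)
    (g : Finset α → ℝ) :
    exchangeForm M K g
      ≤ 4 * ∑ p : α × α, ∑ B ∈ basesOver M K, (g B - coinAvg (exchange M K p.1 p.2) g B) ^ 2 := by
  classical
  have h4 : 4 * ∑ p : α × α, ∑ B ∈ basesOver M K,
      (g B - coinAvg (exchange M K p.1 p.2) g B) ^ 2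
      = ∑ B ∈ basesOver M K, ∑ p : α × α, (g B - g (exchange M K p.1 p.2 B)) ^ 2 := by
    rw [mul_sum, sum_comm]
    refine sum_congr rfl fun p _ => ?_
    rw [mul_sum]
    exact sum_congr rfl fun B _ => by simp only [coinAvg]; ring
  rw [h4, exchangeForm]
  refine sum_le_sum fun B hB => ?_
  rw [← sum_filter]
  rcases ((basesOver M K).filter fun B' => #(B \ B') = 1).eq_empty_or_nonempty with he | hne
  · rw [he, sum_empty]
    exact sum_nonneg fun _ _ => sq_nonneg _
  have hmem : ∀ B' ∈ (basesOver M K).filter (fun B' => #(B \ B') = 1),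
      ∃ p : α × α, exchange M K p.1 p.2 B = B' := fun B' hB' =>
    exists_exchange_eq hr hB (mem_filter.1 hB').1 (mem_filter.1 hB').2
  have : Nonempty (α × α) := hne.elim fun B' hB' => (hmem B' hB').nonempty
  choose! p hp using hmem
  calc _ = ∑ B' ∈ (basesOver M K).filter (fun B' => #(B \ B') = 1),
          (g B - g (exchange M K (p B').1 (p B').2 B)) ^ 2 :=
        sum_congr rfl fun B' hB' => by rw [hp B' hB']
    _ = ∑ q ∈ ((basesOver M K).filter (fun B' => #(B \ B') = 1)).image p,
          (g B - g (exchange M K q.1 q.2 B)) ^ 2 := by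
        rw [sum_image]
        intro B₁ h₁ B₂ h₂ h
        rw [← hp B₁ h₁, h, hp B₂ h₂]
    _ ≤ _ := sum_le_univ_sum_of_nonneg fun _ => sq_nonneg _

/-- A scan through a list of moves that contains an exchange for every pair of elements contracts
the norm of a function with mean zero. -/
theorem sum_sq_scanAvg_le (hr : M.eRank = (r : ℕ∞)) {K : Finset α} (hK : #K + 1 ≤ r)
    {l : List (Finset α → Finset α)} (hl : ∀ σ ∈ l, ∃ x y, σ = exchange M K x y)
    (hall : ∀ x y, exchange M K x y ∈ l) (g : Finset α → ℝ) (hg : ∑ B ∈ basesOver M K, g B = 0) :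
    ∑ B ∈ basesOver M K, scanAvg l g B ^ 2
      ≤ (1 - 1 / (2 * (Fintype.card α ^ 2 * l.length))) * ∑ B ∈ basesOver M K, g B ^ 2 := by
  have hinv : ∀ σ ∈ l, IsInvolutionOn (basesOver M K) σ := by
    intro σ hσ
    obtain ⟨x, y, rfl⟩ := hl σ hσ
    exact isInvolutionOn_exchange hr K x y
  have h1 := (scanAvg_norm_decrease hinv g).2
  have h2 := variance_le_exchangeForm hr (k := r - #K) (by omega) K (by omega) g
  rw [hg] at h2
  have h3 := exchangeForm_le_sum_exchange hr K g
  have h4 := sum_le_sum fun (p : α × α) (_ : p ∈ univ) => h1 _ (hall p.1 p.2)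
  rw [sum_const, nsmul_eq_mul, card_univ, Fintype.card_prod, Nat.cast_mul, ← sq,
    ← mul_assoc] at h4
  set c : ℝ := (Fintype.card α : ℝ) ^ 2 * l.length with hc
  have h5 : ∑ B ∈ basesOver M K, g B ^ 2 ≤ 2 * (c *
      (∑ B ∈ basesOver M K, g B ^ 2 - ∑ B ∈ basesOver M K, scanAvg l g B ^ 2)) := by
    have : (0 : ℝ) ^ 2 / numBases M K = 0 := by simp
    linarith
  rcases (by positivity : 0 ≤ c).eq_or_lt with h0 | h0
  · rw [← h0]; simpa using sum_sq_scanAvg_le_self hinv g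
  · have : 1 / (2 * c) * ∑ B ∈ basesOver M K, g B ^ 2
        ≤ ∑ B ∈ basesOver M K, g B ^ 2 - ∑ B ∈ basesOver M K, scanAvg l g B ^ 2 := by
      rw [div_mul_eq_mul_div, one_mul, div_le_iff₀ (by positivity)]; linarith
    linarith

end Exchange

/-! ### Bias of the sampled membership probabilities -/

section ScanAvg
variable {β : Type*}

theorem scanAvg_append (l₁ l₂ : List (β → β)) (g : β → ℝ) :
    scanAvg (l₁ ++ l₂) g = scanAvg l₁ (scanAvg l₂ g) := List.foldr_append ..

theorem scanAvg_mono (l : List (β → β)) {g k : β → ℝ} (h : ∀ b, g b ≤ k b) (b : β) :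
    scanAvg l g b ≤ scanAvg l k b := by
  induction l generalizing b with
  | nil => exact h b
  | cons σ l ih =>
    change (scanAvg l g b + scanAvg l g (σ b)) / 2 ≤ (scanAvg l k b + scanAvg l k (σ b)) / 2
    linarith [ih b, ih (σ b)]

theorem scanAvg_affine (l : List (β → β)) (g : β → ℝ) (a c : ℝ) (b : β) :
    scanAvg l (fun b => a * g b + c) b = a * scanAvg l g b + c := by
  induction l generalizing b with
  | nil => rfl
  | cons σ l ih =>
    change (scanAvg l _ b + scanAvg l _ (σ b)) / 2
      = a * ((scanAvg l g b + scanAvg l g (σ b)) / 2) + c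
    rw [ih b, ih (σ b)]; ring

end ScanAvg

section Sampling
variable {n : ℕ} {M : Matroid (Fin n)} {r : ℕ}

/-- The `q`-th move of the walk: the pairs of elements are scanned periodically in lexicographic
order. -/
noncomputable def scanMove (hn : 0 < n) (M : Matroid (Fin n)) (K : Finset (Fin n)) (q : ℕ) :
    Finset (Fin n) → Finset (Fin n) :=
  exchange M K ⟨q / n % n, Nat.mod_lt _ hn⟩ ⟨q % n, Nat.mod_lt _ hn⟩

/-- The list of the first `ℓ` moves of the walk. -/
noncomputable def scanMoves (hn : 0 < n) (M : Matroid (Fin n)) (K : Finset (Fin n)) (ℓ : ℕ) :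
    List (Finset (Fin n) → Finset (Fin n)) := (List.range ℓ).map (scanMove hn M K)

theorem scanMoves_add (hn : 0 < n) (K : Finset (Fin n)) (ℓ : ℕ) :
    scanMoves hn M K (n * n + ℓ) = scanMoves hn M K (n * n) ++ scanMoves hn M K ℓ := by
  rw [scanMoves, List.range_add, List.map_append, List.map_map]
  congr 1
  refine List.map_congr_left fun q _ => ?_
  have h1 : (n * n + q) / n = n + q / n := by
    rw [Nat.mul_add_div hn]
  simp [scanMove, h1, Nat.add_mod]

/-- `n * n` consecutive moves form a scan through all pairs of elements. -/
theorem scanAvg_scanMoves_norm_le (hn : 0 < n) (hr : M.eRank = (r : ℕ∞)) {K : Finset (Fin n)}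
    (hK : #K + 1 ≤ r) (t : ℕ) (g : Finset (Fin n) → ℝ) (hg : ∑ B ∈ basesOver M K, g B = 0) :
    ∑ B ∈ basesOver M K, scanAvg (scanMoves hn M K (t * (n * n))) g B ^ 2
      ≤ (1 - 1 / (2 * (n : ℝ) ^ 4)) ^ t * ∑ B ∈ basesOver M K, g B ^ 2 := by
  have hmem : ∀ ℓ, ∀ σ ∈ scanMoves hn M K ℓ, ∃ x y, σ = exchange M K x y := by
    intro ℓ σ hσ
    obtain ⟨q, -, rfl⟩ := List.mem_map.1 hσ
    exact ⟨_, _, rfl⟩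
  have hn1 : (1 : ℝ) ≤ n := by exact_mod_cast hn
  have hc : (0 : ℝ) ≤ 1 - 1 / (2 * (n : ℝ) ^ 4) := by
    rw [sub_nonneg, div_le_one (by positivity)]
    have : (1 : ℝ) ≤ (n : ℝ) ^ 4 := one_le_pow₀ hn1
    linarith
  induction t with
  | zero => simp [scanMoves, scanAvg]
  | succ t ih =>
    rw [show (t + 1) * (n * n) = n * n + t * (n * n) by ring, scanMoves_add, scanAvg_append]
    have h := sum_sq_scanAvg_le hr hK (hmem (n * n)) (fun x y => ?_)
      (scanAvg (scanMoves hn M K (t * (n * n))) g) ?_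
    · refine h.trans ?_
      have hl : (2 * ((Fintype.card (Fin n) : ℝ) ^ 2 * (scanMoves hn M K (n * n)).length))
          = 2 * (n : ℝ) ^ 4 := by
        simp [scanMoves]; ring
      rw [hl, pow_succ' _ t, mul_assoc]
      exact mul_le_mul_of_nonneg_left ih hc
    · refine List.mem_map.2 ⟨x * n + y, List.mem_range.2 ?_, ?_⟩
      · calc (x : ℕ) * n + y < x * n + n := by have := y.2; omega
          _ = (x + 1) * n := by ring
          _ ≤ n * n := Nat.mul_le_mul_right _ x.2
      · have h1 : ((x : ℕ) * n + y) / n = x := by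
          rw [mul_comm, Nat.mul_add_div hn, Nat.div_eq_of_lt y.2, add_zero]
        have h2 : ((x : ℕ) * n + y) % n = y := by
          rw [mul_comm, Nat.mul_add_mod, Nat.mod_eq_of_lt y.2]
        simp [scanMove, h1, h2, Nat.mod_eq_of_lt x.2]
    · rw [sum_scanAvg _ g, hg]
      intro σ hσ
      obtain ⟨x, y, rfl⟩ := hmem _ σ hσ
      exact isInvolutionOn_exchange hr K x y

/-- The probability that a uniformly random base containing `K` contains `i`. -/
noncomputable def memProb (M : Matroid (Fin n)) (K : Finset (Fin n)) (i : Fin n) : ℝ :=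
  numBases M (insert i K) / numBases M K

/-- The probability that the walk on the bases containing `K`, started at `B`, is at a base
containing `i` after `ℓ` moves. -/
noncomputable def walkProb (hn : 0 < n) (M : Matroid (Fin n)) (K : Finset (Fin n)) (ℓ : ℕ)
    (B : Finset (Fin n)) (i : Fin n) : ℝ :=
  scanAvg (scanMoves hn M K ℓ) (fun B => if i ∈ B then 1 else 0) B

/-- The value of a function at one base is bounded by its norm, which costs the factor `2 ^ n`. -/
theorem walkProb_bias (hn : 0 < n) (hr : M.eRank = (r : ℕ∞)) {K : Finset (Fin n)}
    (hK : #K + 1 ≤ r) (t : ℕ) {B : Finset (Fin n)} (hB : B ∈ basesOver M K) (i : Fin n) :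
    (walkProb hn M K (t * (n * n)) B i - memProb M K i) ^ 2
      ≤ (1 - 1 / (2 * (n : ℝ) ^ 4)) ^ t * 2 ^ n := by
  set g : Finset (Fin n) → ℝ := fun B => if i ∈ B then 1 else 0 with hg
  set m := memProb M K i with hm
  have hpos : 0 < numBases M K := numBases_pos_iff.2 (indep_of_mem_basesOver hB)
  have hsum : ∑ B ∈ basesOver M K, g B = numBases M (insert i K) := by
    rw [hg, ← sum_filter, sum_const, nsmul_eq_mul, mul_one, numBases]
    congr 2
    ext C
    rw [mem_filter, mem_basesOver_insert]
  have hmsum : numBases M K * m = numBases M (insert i K) := by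
    rw [hm, memProb, mul_div_cancel₀ _ hpos.ne']
  have hg0 : ∑ B ∈ basesOver M K, (1 * g B + -m) = 0 := by
    simp only [one_mul]
    rw [sum_add_distrib, sum_const, nsmul_eq_mul, hsum, ← hmsum, numBases]; ring
  have h := scanAvg_scanMoves_norm_le hn hr hK t _ hg0
  have h1 : ∑ B ∈ basesOver M K, (1 * g B + -m) ^ 2 ≤ 2 ^ n := by
    have hm0 : 0 ≤ m := div_nonneg (numBases_nonneg _) (numBases_nonneg _)
    have hm1 : m ≤ 1 := by
      refine div_le_one_of_le₀ ?_ (numBases_nonneg _)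
      exact Nat.cast_le.2 (card_le_card fun C hC => (mem_basesOver_insert.1 hC).1)
    calc _ ≤ ∑ B ∈ basesOver M K, (1 : ℝ) := sum_le_sum fun C _ => by
            simp only [hg]; split_ifs <;> nlinarith
      _ = #(basesOver M K) := by simp
      _ ≤ (Fintype.card (Finset (Fin n)) : ℝ) := by exact_mod_cast card_le_univ _
      _ = 2 ^ n := by simp
  have haff : scanAvg (scanMoves hn M K (t * (n * n))) (fun B => 1 * g B + -m) B
      = walkProb hn M K (t * (n * n)) B i - m := by
    rw [scanAvg_affine, one_mul]; rfl
  have h2 : (walkProb hn M K (t * (n * n)) B i - m) ^ 2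
      ≤ ∑ B ∈ basesOver M K,
        scanAvg (scanMoves hn M K (t * (n * n))) (fun B => 1 * g B + -m) B ^ 2 := by
    rw [← haff]
    exact single_le_sum (f := fun B => scanAvg (scanMoves hn M K (t * (n * n)))
      (fun B => 1 * g B + -m) B ^ 2) (fun _ _ => sq_nonneg _) hB
  have hc : (0 : ℝ) ≤ 1 - 1 / (2 * (n : ℝ) ^ 4) := by
    have hn1 : (1 : ℝ) ≤ n := by exact_mod_cast hn
    rw [sub_nonneg, div_le_one (by positivity)]
    have : (1 : ℝ) ≤ (n : ℝ) ^ 4 := one_le_pow₀ hn1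
    linarith
  exact (h2.trans h).trans (mul_le_mul_of_nonneg_left h1 (pow_nonneg hc t))

/-- After `2 n ^ 4 (n + a)` scans the error of the sampling probability is below `2 ^ (-a / 2)`. -/
theorem walkProb_bias_le (hn : 0 < n) (hr : M.eRank = (r : ℕ∞)) {K : Finset (Fin n)}
    (hK : #K + 1 ≤ r) (a : ℕ) {B : Finset (Fin n)} (hB : B ∈ basesOver M K) (i : Fin n) :
    (walkProb hn M K (2 * n ^ 4 * (n + a) * (n * n)) B i - memProb M K i) ^ 2 ≤ (1 / 2) ^ a := by
  refine (walkProb_bias hn hr hK _ hB i).trans ?_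
  have hn0 : (0 : ℝ) < n := by exact_mod_cast hn
  have hn1 : (1 : ℝ) ≤ n := by exact_mod_cast hn
  have hc : (0 : ℝ) ≤ 1 - 1 / (2 * (n : ℝ) ^ 4) := by
    rw [sub_nonneg, div_le_one (by positivity)]
    have : (1 : ℝ) ≤ (n : ℝ) ^ 4 := one_le_pow₀ hn1
    linarith
  -- `2 * n ^ 4` scans halve the squared norm
  have h1 : (1 - 1 / (2 * (n : ℝ) ^ 4)) ^ (2 * n ^ 4) ≤ 1 / 2 := by
    have h2 : 1 - 1 / (2 * (n : ℝ) ^ 4) ≤ Real.exp (-(1 / (2 * (n : ℝ) ^ 4))) :=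
      Real.one_sub_le_exp_neg _
    refine (pow_le_pow_left₀ hc h2 _).trans ?_
    rw [← Real.exp_nat_mul]
    have h3 : ((2 * n ^ 4 : ℕ) : ℝ) * -(1 / (2 * (n : ℝ) ^ 4)) = -1 := by
      push_cast; field_simp
    rw [h3, Real.exp_neg, one_div]
    exact inv_anti₀ two_pos (by linarith [Real.add_one_le_exp (1 : ℝ)])
  rw [pow_mul, pow_add]
  have h4 : ((1 - 1 / (2 * (n : ℝ) ^ 4)) ^ (2 * n ^ 4)) ^ n ≤ (1 / 2) ^ n :=
    pow_le_pow_left₀ (pow_nonneg hc _) h1 _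
  have h5 : ((1 - 1 / (2 * (n : ℝ) ^ 4)) ^ (2 * n ^ 4)) ^ a ≤ (1 / 2) ^ a :=
    pow_le_pow_left₀ (pow_nonneg hc _) h1 _
  calc _ ≤ (1 / 2 : ℝ) ^ n * (1 / 2) ^ a * 2 ^ n := by gcongr
    _ = (1 / 2) ^ a := by
      have : (1 / 2 : ℝ) ^ n * 2 ^ n = 1 := by rw [← mul_pow]; norm_num
      linear_combination ((1 / 2 : ℝ) ^ a) * this

/-- Every element of the link is contained in a fraction at least `1 / n` of the bases. -/
theorem one_div_le_memProb (hr : M.eRank = (r : ℕ∞)) {K : Finset (Fin n)} {i : Fin n}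
    (hi : M.Indep ↑(insert i K)) : 1 / n ≤ memProb M K i := by
  have hK : M.Indep (K : Set (Fin n)) := hi.subset (coe_subset.2 (subset_insert _ _))
  have hpos := numBases_pos_iff.2 hK
  have hn : (0 : ℝ) < n := by exact_mod_cast i.pos
  rw [memProb, div_le_div_iff₀ hn hpos, one_mul]
  -- a base `B` is determined by a base containing `i` and the element exchanged for `i`
  have hex : ∀ B ∈ basesOver M K, ∃ p : Finset (Fin n) × Fin n,
      p.1 ∈ basesOver M (insert i K) ∧ swapSet i p.2 p.1 = B := by
    intro B hB
    by_cases hiB : i ∈ B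
    · exact ⟨(B, i), mem_basesOver_insert.2 ⟨hB, hiB⟩, by ext z; simp [mem_swapSet]⟩
    obtain ⟨B', hB', hsub, hsub'⟩ := hi.exists_isBase_subset_union_isBase (mem_basesOver.1 hB).1
    lift B' to Finset (Fin n) using Set.toFinite B'
    rw [← coe_union, coe_subset] at hsub'
    have hsub := coe_subset.1 hsub
    have hB'' : B' ∈ basesOver M (insert i K) := mem_basesOver.2 ⟨hB', hsub⟩
    have hiB' : i ∈ B' := hsub (mem_insert_self _ _)
    have hcard : #(B' \ B) = 1 := by
      have : B' \ B = {i} := by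
        ext z
        rw [mem_sdiff, mem_singleton]
        constructor
        · rintro ⟨h1, h2⟩
          have := hsub' h1
          rw [mem_union, mem_insert] at this
          rcases this with (h | h) | h
          · exact h
          · exact absurd ((mem_basesOver.1 hB).2 h) h2
          · exact absurd h h2
        · rintro rfl; exact ⟨hiB', hiB⟩
      rw [this, card_singleton]
    have hcard' : #(B \ B') = 1 := by
      have h1 := card_sdiff_add_card_inter B B'
      have h2 := card_sdiff_add_card_inter B' B
      rw [inter_comm] at h2
      rw [card_of_mem_basesOver hr hB] at h1
      rw [card_of_mem_basesOver hr hB''] at h2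
      omega
    obtain ⟨x, hx⟩ := card_eq_one.1 hcard'
    have hx' : ∀ z, (z ∈ B ∧ z ∉ B') ↔ z = x := fun z => by rw [← mem_sdiff, hx, mem_singleton]
    have hxm := (hx' x).2 rfl
    refine ⟨(B', x), hB'', ?_⟩
    ext z
    rw [mem_swapSet]
    by_cases hzx : z = x
    · rw [hzx, Equiv.swap_apply_right]; tauto
    by_cases hzi : z = i
    · rw [hzi, Equiv.swap_apply_left]; tauto
    rw [Equiv.swap_apply_of_ne_of_ne hzi hzx]
    have h1 := hx' z
    constructor
    · intro hz
      have := hsub' hz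
      rw [mem_union, mem_insert] at this
      rcases this with (h | h) | h
      · exact absurd h hzi
      · exact (mem_basesOver.1 hB).2 h
      · exact h
    · tauto
  have : Nonempty (Finset (Fin n) × Fin n) := ⟨(∅, i)⟩
  choose! p hp using hex
  have hle : #(basesOver M K) ≤ #(basesOver M (insert i K) ×ˢ (univ : Finset (Fin n))) := by
    refine card_le_card_of_injOn p (fun B hB => ?_) fun B hB B' hB' h => ?_
    · exact mem_product.2 ⟨(hp B hB).1, mem_univ _⟩
    · rw [← (hp B hB).2, h, (hp B' hB').2]
  rw [card_product, card_univ, Fintype.card_fin] at hle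
  unfold numBases
  exact_mod_cast hle

end Sampling

/-! ### Averages over coin tosses, and a Chernoff bound -/

section Coins

/-- The average of `F` over the outcomes of `N` fair coin tosses, which are stored in the cells
`0, …, N - 1` of an array of zeros. -/
noncomputable def flipAvg : ℕ → ((ℕ → ℕ) → ℝ) → ℝ
  | 0, F => F fun _ => 0
  | N + 1, F => flipAvg N fun ω => (F (Function.update ω N 0) + F (Function.update ω N 1)) / 2

theorem flipAvg_mono (N : ℕ) {F G : (ℕ → ℕ) → ℝ} (h : ∀ ω, F ω ≤ G ω) :
    flipAvg N F ≤ flipAvg N G := by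
  induction N generalizing F G with
  | zero => exact h _
  | succ N ih =>
    exact ih fun ω => by linarith [h (Function.update ω N 0), h (Function.update ω N 1)]

theorem flipAvg_const (N : ℕ) (c : ℝ) : flipAvg N (fun _ => c) = c := by
  induction N with
  | zero => rfl
  | succ N ih => simpa [flipAvg] using ih

theorem flipAvg_add (N : ℕ) (F G : (ℕ → ℕ) → ℝ) :
    flipAvg N (fun ω => F ω + G ω) = flipAvg N F + flipAvg N G := by
  induction N generalizing F G with
  | zero => rfl
  | succ N ih =>
    simp only [flipAvg]
    rw [← ih]; congr 1; ext ω; ring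

theorem flipAvg_const_mul (N : ℕ) (c : ℝ) (F : (ℕ → ℕ) → ℝ) :
    flipAvg N (fun ω => c * F ω) = c * flipAvg N F := by
  induction N generalizing F with
  | zero => rfl
  | succ N ih =>
    simp only [flipAvg]
    rw [← ih]; congr 1; ext ω; ring

theorem flipAvg_sum {ι : Type*} (N : ℕ) (s : Finset ι) (F : ι → (ℕ → ℕ) → ℝ) :
    flipAvg N (fun ω => ∑ i ∈ s, F i ω) = ∑ i ∈ s, flipAvg N (F i) := by
  classical
  induction s using Finset.induction_on with
  | empty => simp [flipAvg_const]
  | insert i s hi ih =>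
    simp only [sum_insert hi]
    rw [flipAvg_add, ih]

/-- `F` depends only on the first `a` coins. -/
def DependsBelow {γ : Type*} (a : ℕ) (F : (ℕ → ℕ) → γ) : Prop :=
  ∀ ω ω' : ℕ → ℕ, (∀ k < a, ω k = ω' k) → F ω = F ω'

theorem DependsBelow.update {γ : Type*} {a N : ℕ} {F : (ℕ → ℕ) → γ} (h : DependsBelow a F)
    (hN : a ≤ N) (ω : ℕ → ℕ) (v : ℕ) : F (Function.update ω N v) = F ω :=
  h _ _ fun k hk => Function.update_of_ne (by omega) _ _

theorem DependsBelow.flipAvg_eq {a N : ℕ} {F : (ℕ → ℕ) → ℝ} (h : DependsBelow a F) (hN : a ≤ N) :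
    flipAvg N F = flipAvg a F := by
  induction N, hN using Nat.le_induction with
  | base => rfl
  | succ N hN ih =>
    rw [← ih]
    simp only [flipAvg, h.update hN]
    congr 1; ext ω; ring

variable {β : Type*}

/-- The state after `q` moves, starting from `b`, when the coins `off, off + 1, …` decide which of
the moves `op 0, op 1, …` are made. -/
def walkState (op : ℕ → β → β) (ω : ℕ → ℕ) (off : ℕ) (b : β) : ℕ → β
  | 0 => b
  | q + 1 => if ω (off + q) ≠ 0 then op q (walkState op ω off b q) else walkState op ω off b q

theorem dependsBelow_walkState (op : ℕ → β → β) (off : ℕ) (b : β) (q : ℕ) :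
    DependsBelow (off + q) fun ω => walkState op ω off b q := by
  intro ω ω' h
  induction q with
  | zero => rfl
  | succ q ih =>
    have h1 := ih fun k hk => h k (by omega)
    simp only at h1
    simp only [walkState, h1, h (off + q) (by omega)]

/-- A walk that is driven by fresh coins is independent of the earlier coins, and `scanAvg` computes
its expectations. -/
theorem flipAvg_mul_walkState (op : ℕ → β → β) (a : ℕ) (b : β) {G : (ℕ → ℕ) → ℝ}
    (hG : DependsBelow a G) (q : ℕ) (g : β → ℝ) :
    flipAvg (a + q) (fun ω => G ω * g (walkState op ω a b q))
      = flipAvg a G * scanAvg ((List.range q).map op) g b := by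
  induction q generalizing g with
  | zero =>
    simp only [walkState, scanAvg, List.range_zero, List.map_nil, List.foldr_nil, add_zero]
    rw [mul_comm, ← flipAvg_const_mul]
    congr 1; ext ω; ring
  | succ q ih =>
    rw [List.range_succ, List.map_append, scanAvg_append, ← ih, ← add_assoc]
    simp only [flipAvg]
    congr 1
    ext ω
    have h1 := fun v => hG.update (N := a + q) (by omega) ω v
    have h2 := fun v => (dependsBelow_walkState op a b q).update le_rfl ω v
    simp only [walkState, h1, h2, Function.update_self, scanAvg, List.map_cons, List.map_nil,
      List.foldr_cons, List.foldr_nil, coinAvg]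
    simp
    ring

/-- Chernoff bound for the number of successes among `s` walks that use consecutive disjoint
blocks of coins. -/
theorem flipAvg_count_tail (op : ℕ → β → β) (ℓ a s : ℕ) (b : β) (X : β → ℝ)
    (hX0 : ∀ b, 0 ≤ X b) (hX1 : ∀ b, X b ≤ 1) {θ : ℝ} (hθ0 : 0 ≤ θ) (hθ : θ ≤ 1)
    {N : ℕ} (hN : a + s * ℓ ≤ N) :
    flipAvg N (fun ω => open Classical in
      if s * θ ≤ |∑ j ∈ range s, X (walkState op ω (a + j * ℓ) b ℓ)
        - s * scanAvg ((List.range ℓ).map op) X b| then 1 else 0)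
      ≤ 2 * Real.exp (-(s * θ ^ 2 / 4)) := by
  classical
  set p := scanAvg ((List.range ℓ).map op) X b with hp
  set Y : (ℕ → ℕ) → ℕ → ℝ := fun ω s => ∑ j ∈ range s, X (walkState op ω (a + j * ℓ) b ℓ) with hY
  have hYdep : ∀ s, DependsBelow (a + s * ℓ) fun ω => Y ω s := by
    intro s ω ω' h
    refine sum_congr rfl fun j hj => ?_
    congr 1
    refine dependsBelow_walkState op _ b ℓ ω ω' fun k hk => h k ?_
    have : (j + 1) * ℓ ≤ s * ℓ := Nat.mul_le_mul_right _ (mem_range.1 hj)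
    rw [add_mul] at this
    omega
  have hp0 : 0 ≤ p := by
    have := scanAvg_mono ((List.range ℓ).map op) (g := fun b => 0 * X b + 0) (k := X)
      (fun b => by simpa using hX0 b) b
    rw [scanAvg_affine] at this; simpa using this
  have hp1 : p ≤ 1 := by
    have := scanAvg_mono ((List.range ℓ).map op) (k := fun b => 0 * X b + 1) (g := X)
      (fun b => by simpa using hX1 b) b
    rw [scanAvg_affine] at this; simpa using this
  -- the moment generating function is multiplicative over the blocks
  have hmgf : ∀ t : ℝ, |t| ≤ 1 → ∀ s, flipAvg (a + s * ℓ) (fun ω => Real.exp (t * (Y ω s - s * p)))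
      ≤ Real.exp (s * t ^ 2) := by
    intro t ht s
    induction s with
    | zero => simp [hY, flipAvg_const]
    | succ s ih =>
      have h1 : ∀ ω, Real.exp (t * (Y ω (s + 1) - (s + 1 : ℕ) * p))
          = Real.exp (t * (Y ω s - s * p))
            * Real.exp (t * (X (walkState op ω (a + s * ℓ) b ℓ) - p)) := by
        intro ω
        rw [← Real.exp_add]
        congr 1
        simp only [hY, sum_range_succ]; push_cast; ring
      have hdep : DependsBelow (a + s * ℓ) fun ω => Real.exp (t * (Y ω s - s * p)) := by
        intro ω ω' h
        have := hYdep s ω ω' h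
        simp only at this
        simp only [this]
      have h2 : scanAvg ((List.range ℓ).map op) (fun b => Real.exp (t * (X b - p))) b
          ≤ Real.exp (t ^ 2) := by
        have h3 : ∀ b, Real.exp (t * (X b - p)) ≤ t * X b + (1 - t * p + t ^ 2) := by
          intro b
          have hXp : |X b - p| ≤ 1 := abs_le.2 ⟨by linarith [hX0 b], by linarith [hX1 b]⟩
          have hle : |t * (X b - p)| ≤ 1 := by
            rw [abs_mul]; exact mul_le_one₀ ht (abs_nonneg _) hXp
          have h4 := (abs_le.1 (Real.abs_exp_sub_one_sub_id_le hle)).2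
          have h5 : (t * (X b - p)) ^ 2 ≤ t ^ 2 := by
            rw [mul_pow]
            exact mul_le_of_le_one_right (sq_nonneg _) ((sq_le_one_iff_abs_le_one _).2 hXp)
          linarith
        have h4 := scanAvg_mono ((List.range ℓ).map op) h3 b
        rw [scanAvg_affine, ← hp] at h4
        linarith [Real.add_one_le_exp (t ^ 2)]
      have h0 : a + (s + 1) * ℓ = a + s * ℓ + ℓ := by ring
      simp only [h1, h0]
      rw [flipAvg_mul_walkState op (a + s * ℓ) b hdep ℓ fun b => Real.exp (t * (X b - p))]
      have h5 : Real.exp ((s + 1 : ℕ) * t ^ 2) = Real.exp (s * t ^ 2) * Real.exp (t ^ 2) := by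
        rw [← Real.exp_add]; congr 1; push_cast; ring
      rw [h5]
      refine mul_le_mul ih h2 ?_ (Real.exp_pos _).le
      have h6 := scanAvg_mono ((List.range ℓ).map op) (g := fun b => 0 * X b + 0)
        (k := fun b => Real.exp (t * (X b - p)))
        (fun b => by simpa using (Real.exp_pos _).le) b
      rw [scanAvg_affine] at h6; simpa using h6
  set t : ℝ := θ / 2 with ht
  have ht1 : |t| ≤ 1 := abs_le.2 ⟨by linarith, by linarith⟩
  -- Markov's inequality for the exponential moments with parameters `t` and `-t`
  have hmark : ∀ ω, (if s * θ ≤ |Y ω s - s * p| then (1 : ℝ) else 0)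
      ≤ Real.exp (-(s * (t * θ))) * Real.exp (t * (Y ω s - s * p))
        + Real.exp (-(s * (t * θ))) * Real.exp (-t * (Y ω s - s * p)) := by
    intro ω
    rw [← Real.exp_add, ← Real.exp_add]
    have ht0 : 0 ≤ t := by positivity
    split_ifs with h
    · rcases le_abs.1 h with h' | h'
      · have : 1 ≤ Real.exp (-(s * (t * θ)) + t * (Y ω s - s * p)) :=
          Real.one_le_exp (by nlinarith [mul_le_mul_of_nonneg_left h' ht0])
        linarith [Real.exp_pos (-(s * (t * θ)) + -t * (Y ω s - s * p))]
      · have : 1 ≤ Real.exp (-(s * (t * θ)) + -t * (Y ω s - s * p)) :=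
          Real.one_le_exp (by nlinarith [mul_le_mul_of_nonneg_left h' ht0])
        linarith [Real.exp_pos (-(s * (t * θ)) + t * (Y ω s - s * p))]
    · positivity
  have hdep : DependsBelow (a + s * ℓ) fun ω =>
      if s * θ ≤ |Y ω s - s * p| then (1 : ℝ) else 0 := by
    intro ω ω' h
    have := hYdep s ω ω' h
    simp only at this
    simp only [this]
  rw [hdep.flipAvg_eq hN]
  refine (flipAvg_mono _ hmark).trans ?_
  rw [flipAvg_add, flipAvg_const_mul, flipAvg_const_mul]
  have h1 := hmgf t ht1 s
  have h2 := hmgf (-t) (by rwa [abs_neg]) s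
  rw [neg_sq] at h2
  have h3 : Real.exp (-(s * (t * θ))) * Real.exp (s * t ^ 2) = Real.exp (-(s * θ ^ 2 / 4)) := by
    rw [← Real.exp_add]; congr 1; rw [ht]; ring
  have h4 := (Real.exp_pos (-(s * (t * θ)))).le
  nlinarith [mul_le_mul_of_nonneg_left h1 h4, mul_le_mul_of_nonneg_left h2 h4]

end Coins

/-! ### The estimate and its accuracy -/

section Estimate
variable {n : ℕ} {M : Matroid (Fin n)} {r : ℕ}

theorem ncard_isBase (M : Matroid (Fin n)) :
    ({B : Set (Fin n) | M.IsBase B}.ncard : ℝ) = numBases M ∅ := by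
  rw [numBases, Nat.cast_inj, ← Set.ncard_coe_finset,
    ← Set.ncard_image_of_injective _ (coe_injective (α := Fin n))]
  congr 1
  ext B
  simp only [Set.mem_ofPred_eq, Set.mem_image, mem_coe, mem_basesOver, empty_subset, and_true]
  constructor
  · intro hB
    lift B to Finset (Fin n) using Set.toFinite B
    exact ⟨B, hB, rfl⟩
  · rintro ⟨B', hB', rfl⟩; exact hB'

/-- The elements of the base `B` that precede the element number `m`. -/
def initialPart (B : Finset (Fin n)) (m : ℕ) : Finset (Fin n) := B.filter fun b => (b : ℕ) < m

theorem initialPart_succ_of_mem {B : Finset (Fin n)} {i : Fin n} (hi : i ∈ B) :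
    initialPart B (i + 1) = insert i (initialPart B i) := by
  ext b
  simp only [initialPart, mem_filter, mem_insert, Nat.lt_succ_iff_lt_or_eq, Fin.val_inj]
  constructor
  · tauto
  · rintro (rfl | h) <;> tauto

theorem initialPart_succ_of_notMem {B : Finset (Fin n)} {i : Fin n} (hi : i ∉ B) :
    initialPart B (i + 1) = initialPart B i := by
  ext b
  simp only [initialPart, mem_filter, Nat.lt_succ_iff_lt_or_eq, Fin.val_inj]
  constructor
  · rintro ⟨h, h' | rfl⟩ <;> tauto
  · tauto

theorem notMem_initialPart (B : Finset (Fin n)) (i : Fin n) : i ∉ initialPart B i := by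
  simp [initialPart]

theorem initialPart_subset (B : Finset (Fin n)) (m : ℕ) : initialPart B m ⊆ B := filter_subset _ _

theorem initialPart_zero (B : Finset (Fin n)) : initialPart B 0 = ∅ := by simp [initialPart]

theorem initialPart_card (B : Finset (Fin n)) : initialPart B n = B := by simp [initialPart]

theorem mem_basesOver_initialPart {B : Finset (Fin n)} (hB : M.IsBase (B : Set (Fin n))) (m : ℕ) :
    B ∈ basesOver M (initialPart B m) := mem_basesOver.2 ⟨hB, initialPart_subset _ _⟩

/-- The number of bases is the inverse of the product of the probabilities that the elements of a
base `B` are in a random base which contains the preceding elements of `B`. -/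
theorem prod_memProb (hr : M.eRank = (r : ℕ∞)) {B : Finset (Fin n)}
    (hB : M.IsBase (B : Set (Fin n))) :
    numBases M ∅ * ∏ i ∈ B, memProb M (initialPart B i) i = 1 := by
  have hne : ∀ m, numBases M (initialPart B m) ≠ 0 := fun m =>
    (numBases_pos_iff.2 (indep_of_mem_basesOver (mem_basesOver_initialPart hB m))).ne'
  have key : ∀ m ≤ n, numBases M ∅ * ∏ i ∈ initialPart B m, memProb M (initialPart B i) i
      = numBases M (initialPart B m) := by
    intro m hm
    induction m with
    | zero => simp [initialPart_zero]
    | succ m ih =>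
      have ih := ih (by omega)
      set i : Fin n := ⟨m, hm⟩ with hi
      by_cases him : i ∈ B
      · have h1 := initialPart_succ_of_mem him
        rw [show m + 1 = (i : ℕ) + 1 from rfl, h1, prod_insert (notMem_initialPart B i)]
        rw [show m = (i : ℕ) from rfl] at ih
        rw [mul_left_comm, ih, memProb, div_mul_cancel₀ _ (hne _)]
      · rw [show m + 1 = (i : ℕ) + 1 from rfl, initialPart_succ_of_notMem him]
        exact ih
  have := key n le_rfl
  rw [initialPart_card] at this
  rw [this, numBases, basesOver_eq_singleton hr hB.indep (card_of_isBase hr hB)]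
  simp

/-- The number of walks, among `s` walks of length `ℓ` on the bases containing the elements of `B`
before `i`, that end at a base containing `i`. The `j`-th walk for the element `i` uses the coins
from `(i * s + j) * ℓ` on. -/
noncomputable def sampleCount (M : Matroid (Fin n)) (B : Finset (Fin n)) (s ℓ : ℕ) (ω : ℕ → ℕ)
    (i : Fin n) : ℕ :=
  ∑ j ∈ range s, if i ∈ walkState (scanMove i.pos M (initialPart B i)) ω ((i * s + j) * ℓ) B ℓ
    then 1 else 0

/-- The estimate for the number of bases. -/
noncomputable def estimate (M : Matroid (Fin n)) (B : Finset (Fin n)) (s ℓ : ℕ) (ω : ℕ → ℕ) : ℝ :=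
  ((∏ _i ∈ B, s : ℕ) : ℝ) / ((∏ i ∈ B, sampleCount M B s ℓ ω i : ℕ) : ℝ)

/-- The number of samples for each element; the accuracy is `1 / E` and the failure probability
is `2 ^ (-(d + 1))`. -/
def numSamples (n E d : ℕ) : ℕ := 64 * n ^ 4 * E ^ 2 * (n + d + 2)

/-- The number of moves of each walk, chosen so large that the sampling probabilities have error at
most `1 / (4 * n ^ 2 * E)`. -/
def numMoves (n E : ℕ) : ℕ := 2 * n ^ 4 * (n + (4 + 4 * n + 2 * E)) * (n * n)

theorem walkProb_numMoves (hn : 0 < n) {E : ℕ} (hE : 0 < E) (hr : M.eRank = (r : ℕ∞))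
    {K : Finset (Fin n)} (hK : #K + 1 ≤ r) {B : Finset (Fin n)} (hB : B ∈ basesOver M K)
    (i : Fin n) :
    |walkProb hn M K (numMoves n E) B i - memProb M K i| ≤ 1 / (4 * n ^ 2 * E) := by
  have hn0 : (0 : ℝ) < n := by exact_mod_cast hn
  have hE0 : (0 : ℝ) < E := by exact_mod_cast hE
  refine abs_le_of_sq_le_sq ?_ (by positivity)
  refine (walkProb_bias_le hn hr hK _ hB i).trans ?_
  have h1 : (n : ℝ) ≤ 2 ^ n := by exact_mod_cast Nat.lt_two_pow_self.le
  have h2 : (E : ℝ) ≤ 2 ^ E := by exact_mod_cast Nat.lt_two_pow_self.le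
  have h3 : (4 * (n : ℝ) ^ 2 * E) ^ 2 ≤ 2 ^ (4 + 4 * n + 2 * E) := by
    calc (4 * (n : ℝ) ^ 2 * E) ^ 2 = 2 ^ 4 * (n ^ 4 * E ^ 2) := by ring
      _ ≤ 2 ^ 4 * ((2 ^ n) ^ 4 * (2 ^ E) ^ 2) := by gcongr
      _ = 2 ^ (4 + 4 * n + 2 * E) := by ring
  rw [one_div_pow, one_div_pow]
  exact one_div_le_one_div_of_le (by positivity) h3

/-- If every sampling frequency `c i / s` is close to the membership probability, then its relative
error is at most `ρ = 1 / (2 * n * E)`, and the product of at most `n` of them has relative error at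
most about `ε / 2`. -/
theorem estimate_mem_Icc (hr : M.eRank = (r : ℕ∞)) {B : Finset (Fin n)}
    (hB : M.IsBase (B : Set (Fin n))) {E s : ℕ} {ε : ℝ} (hε0 : 0 < ε) (hε1 : ε < 1)
    (hE : 1 / ε ≤ E) (c : Fin n → ℕ) (hs : 0 < n → 0 < s)
    (hc : ∀ i ∈ B, |(c i : ℝ) - s * memProb M (initialPart B i) i| ≤ s * (1 / (2 * n ^ 2 * E))) :
    ((∏ _i ∈ B, s : ℕ) : ℝ) / ((∏ i ∈ B, c i : ℕ) : ℝ)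
      ∈ Set.Icc ((1 - ε) * numBases M ∅) ((1 + ε) * numBases M ∅) := by
  have hE0 : (0 : ℝ) < E := (by positivity : 0 < 1 / ε).trans_le hE
  set p : Fin n → ℝ := fun i => memProb M (initialPart B i) i with hp
  set ρ : ℝ := 1 / (2 * n * E) with hρ
  have hρ0 : 0 ≤ ρ := by positivity
  have hpn : ∀ i ∈ B, 1 / n ≤ p i := fun i hi => one_div_le_memProb hr <|
    hB.indep.subset (coe_subset.2 (insert_subset hi (initialPart_subset _ _)))
  have hq : ∀ i ∈ B, (1 - ρ) * p i ≤ c i / s ∧ (c i : ℝ) / s ≤ (1 + ρ) * p i := by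
    intro i hi
    have hs0 : (0 : ℝ) < s := by exact_mod_cast hs i.pos
    have hn0 : (0 : ℝ) < n := by exact_mod_cast i.pos
    have h1 : 1 / (2 * (n : ℝ) ^ 2 * E) ≤ ρ * p i := by
      calc 1 / (2 * (n : ℝ) ^ 2 * E) = ρ * (1 / n) := by rw [hρ]; field_simp
        _ ≤ _ := mul_le_mul_of_nonneg_left (hpn i hi) hρ0
    have h2 := abs_le.1 (hc i hi)
    have h3 := mul_le_mul_of_nonneg_left h1 hs0.le
    constructor
    · rw [le_div_iff₀ hs0]; linarith [h2.1]
    · rw [div_le_iff₀ hs0]; linarith [h2.2]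
  have hρ2 : n * ρ ≤ ε / 2 := by
    rcases Nat.eq_zero_or_pos n with rfl | hn
    · simp; positivity
    have hn0 : (0 : ℝ) < n := by exact_mod_cast hn
    have h1 : n * ρ = 1 / E / 2 := by rw [hρ]; field_simp
    rw [h1]
    have : 1 / (E : ℝ) ≤ ε := by
      rw [div_le_comm₀ hE0 hε0]; exact hE
    linarith
  have hcard : (#B : ℝ) * ρ ≤ ε / 2 := by
    refine le_trans (mul_le_mul_of_nonneg_right ?_ hρ0) hρ2
    have := card_le_univ B
    rw [Fintype.card_fin] at this
    exact_mod_cast this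
  set Z := numBases M ∅ with hZ
  have hZ0 : 0 < Z := numBases_pos_iff.2 (hB.indep.subset (by simp))
  have hprod : Z * ∏ i ∈ B, p i = 1 := prod_memProb hr hB
  have hρ1 : ∀ i ∈ B, 0 ≤ 1 - ρ := by
    intro i _
    have hn1 : (1 : ℝ) ≤ n := by exact_mod_cast i.pos
    nlinarith
  have hp0 : ∀ i ∈ B, 0 ≤ p i := fun i hi => le_trans (by positivity) (hpn i hi)
  set w := Z * ∏ i ∈ B, (c i : ℝ) / s with hw
  have hlow : 1 - ε / 2 ≤ w := by
    have h1 : (1 - ρ) ^ #B * ∏ i ∈ B, p i ≤ ∏ i ∈ B, (c i : ℝ) / s := by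
      rw [← prod_const, ← prod_mul_distrib]
      exact prod_le_prod (fun i hi => mul_nonneg (hρ1 i hi) (hp0 i hi)) fun i hi => (hq i hi).1
    have h2 : (1 - ρ) ^ #B ≤ w := by
      calc (1 - ρ) ^ #B = Z * ((1 - ρ) ^ #B * ∏ i ∈ B, p i) := by
            rw [mul_left_comm, hprod, mul_one]
        _ ≤ w := mul_le_mul_of_nonneg_left h1 hZ0.le
    rcases B.eq_empty_or_nonempty with he | ⟨i, hi⟩
    · rw [he] at h2; simp at h2; linarith
    · have h3 := one_add_mul_le_pow (a := -ρ) (by linarith [hρ1 i hi]) #B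
      rw [← sub_eq_add_neg] at h3
      linarith
  have hup : w ≤ Real.exp (ε / 2) := by
    have h1 : ∏ i ∈ B, (c i : ℝ) / s ≤ (1 + ρ) ^ #B * ∏ i ∈ B, p i := by
      rw [← prod_const, ← prod_mul_distrib]
      exact prod_le_prod (fun i _ => by positivity) fun i hi => (hq i hi).2
    calc w ≤ Z * ((1 + ρ) ^ #B * ∏ i ∈ B, p i) := mul_le_mul_of_nonneg_left h1 hZ0.le
      _ = (1 + ρ) ^ #B := by rw [mul_left_comm, hprod, mul_one]
      _ ≤ Real.exp ρ ^ #B := pow_le_pow_left₀ (by positivity)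
          (by linarith [Real.add_one_le_exp ρ]) _
      _ = Real.exp (#B * ρ) := by rw [Real.exp_nat_mul]
      _ ≤ _ := Real.exp_le_exp.2 hcard
  have hw0 : 0 < w := by linarith
  have hout : ((∏ _i ∈ B, s : ℕ) : ℝ) / ((∏ i ∈ B, c i : ℕ) : ℝ) = Z / w := by
    rw [hw, div_mul_eq_div_div, div_self hZ0.ne', prod_div_distrib, one_div_div]
    push_cast; rfl
  rw [hout, Set.mem_Icc, le_div_iff₀ hw0, div_le_iff₀ hw0]
  constructor
  · have h1 : (1 - ε) * w ≤ 1 := by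
      have h2 : 1 - ε ≤ Real.exp (-(ε / 2)) := by linarith [Real.add_one_le_exp (-(ε / 2))]
      calc (1 - ε) * w ≤ Real.exp (-(ε / 2)) * Real.exp (ε / 2) :=
            mul_le_mul h2 hup hw0.le (Real.exp_pos _).le
        _ = 1 := by rw [← Real.exp_add]; simp
    nlinarith
  · have h1 : 1 ≤ (1 + ε) * w := by nlinarith
    nlinarith

/-- With probability at least `1 - 2 ^ (-(d + 1))` the estimate has relative error at most `ε`. -/
theorem estimate_success (hr : M.eRank = (r : ℕ∞)) {B : Finset (Fin n)}
    (hB : M.IsBase (B : Set (Fin n))) {E d : ℕ} {ε : ℝ} (hε0 : 0 < ε) (hε1 : ε < 1)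
    (hE : 1 / ε ≤ E) :
    1 - (1 / 2) ^ (d + 1) ≤ flipAvg (n * numSamples n E d * numMoves n E) (fun ω =>
      open Classical in if estimate M B (numSamples n E d) (numMoves n E) ω
        ∈ Set.Icc ((1 - ε) * numBases M ∅) ((1 + ε) * numBases M ∅) then 1 else 0) := by
  classical
  have hE0 : (0 : ℝ) < E := (by positivity : 0 < 1 / ε).trans_le hE
  have hE0' : 0 < E := by exact_mod_cast hE0
  set s := numSamples n E d with hs
  set ℓ := numMoves n E with hℓ
  set N := n * s * ℓ with hN
  set p' : Fin n → ℝ := fun i => walkProb i.pos M (initialPart B i) ℓ B i with hp'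
  -- the indicator of a large deviation of the number of successes for `i` from its expectation
  set bad : Fin n → (ℕ → ℕ) → ℝ := fun i ω =>
    if s * (1 / (4 * n ^ 2 * E)) ≤ |(sampleCount M B s ℓ ω i : ℝ) - s * p' i| then 1 else 0
    with hbad
  have hbad0 : ∀ i ω, 0 ≤ bad i ω := fun i ω => by simp only [hbad]; split_ifs <;> norm_num
  -- union bound, pointwise: without a large deviation the estimate is accurate
  have hpt : ∀ ω, 1 + (-1) * ∑ i ∈ B, bad i ω ≤ if estimate M B s ℓ ω
      ∈ Set.Icc ((1 - ε) * numBases M ∅) ((1 + ε) * numBases M ∅) then (1 : ℝ) else 0 := by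
    intro ω
    have hsum0 : 0 ≤ ∑ i ∈ B, bad i ω := sum_nonneg fun i _ => hbad0 i ω
    split_ifs with h
    · linarith
    · have : ∃ i ∈ B, bad i ω = 1 := by
        by_contra hno
        push Not at hno
        apply h
        refine estimate_mem_Icc hr hB hε0 hε1 hE (sampleCount M B s ℓ ω) (fun hn => ?_) ?_
        · rw [hs, numSamples]; positivity
        · intro i hi
          have h1 := hno i hi
          simp only [hbad] at h1
          split_ifs at h1 with h2
          · exact absurd rfl h1
          have hK : #(initialPart B i) + 1 ≤ r := by
            rw [← card_insert_of_notMem (notMem_initialPart B i), ← card_of_isBase hr hB]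
            exact card_le_card (insert_subset hi (initialPart_subset _ _))
          have h3 := walkProb_numMoves i.pos hE0' hr hK (mem_basesOver_initialPart hB i) i
          have h4 : (sampleCount M B s ℓ ω i : ℝ) - s * memProb M (initialPart B i) i
              = ((sampleCount M B s ℓ ω i : ℝ) - s * p' i)
                + s * (p' i - memProb M (initialPart B i) i) := by ring
          rw [h4]
          refine (abs_add_le _ _).trans ?_
          rw [abs_mul, Nat.abs_cast]
          have h5 := mul_le_mul_of_nonneg_left h3 (Nat.cast_nonneg (α := ℝ) s)
          have h6 : (s : ℝ) * (1 / (2 * n ^ 2 * E))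
              = s * (1 / (4 * n ^ 2 * E)) + s * (1 / (4 * n ^ 2 * E)) := by
            have hn0 : (0 : ℝ) < n := by exact_mod_cast i.pos
            field_simp; ring
          rw [h6]
          exact add_le_add (not_le.1 h2).le h5
      obtain ⟨i, hi, h1⟩ := this
      have := single_le_sum (f := fun i => bad i ω) (fun i _ => hbad0 i ω) hi
      linarith
  refine le_trans ?_ (flipAvg_mono N hpt)
  rw [flipAvg_add, flipAvg_const, flipAvg_const_mul, flipAvg_sum]
  have hone : ∀ i ∈ B, flipAvg N (bad i) ≤ 2 * (1 / 2) ^ (n + d + 2) := by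
    intro i _
    have hn0 : (0 : ℝ) < n := by exact_mod_cast i.pos
    have hn1 : (1 : ℝ) ≤ n := by exact_mod_cast i.pos
    have hE1 : (1 : ℝ) ≤ E := by exact_mod_cast hE0'
    have hθ1 : 1 / (4 * (n : ℝ) ^ 2 * E) ≤ 1 := by
      rw [div_le_one (by positivity)]
      nlinarith [mul_le_mul (one_le_pow₀ hn1 (n := 2)) hE1 zero_le_one (by positivity)]
    have h := flipAvg_count_tail (scanMove i.pos M (initialPart B i)) ℓ (i * s * ℓ) s B
      (fun C => if i ∈ C then 1 else 0) (fun C => by positivity)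
      (fun C => by split_ifs <;> norm_num) (θ := 1 / (4 * n ^ 2 * E)) (by positivity) hθ1 (N := N)
      (by
        calc (i : ℕ) * s * ℓ + s * ℓ = (i + 1) * (s * ℓ) := by ring
          _ ≤ n * (s * ℓ) := Nat.mul_le_mul_right _ i.2
          _ = N := by rw [hN]; ring)
    have hcount : ∀ ω, (sampleCount M B s ℓ ω i : ℝ) = ∑ j ∈ range s,
        if i ∈ walkState (scanMove i.pos M (initialPart B i)) ω (i * s * ℓ + j * ℓ) B ℓ
          then 1 else 0 := by
      intro ω
      simp only [sampleCount, Nat.cast_sum, Nat.cast_ite, Nat.cast_one, Nat.cast_zero, add_mul]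
    refine le_trans (le_of_eq ?_) (h.trans ?_)
    · congr 1
      ext ω
      simp only [hbad, hcount]
      rfl
    · have h1 : (s : ℝ) * (1 / (4 * n ^ 2 * E)) ^ 2 / 4 = ((n + d + 2 : ℕ) : ℝ) := by
        rw [hs, numSamples]; push_cast; field_simp; ring
      rw [h1]
      have h2 : Real.exp (-((n + d + 2 : ℕ) : ℝ)) ≤ (1 / 2) ^ (n + d + 2) := by
        rw [show -((n + d + 2 : ℕ) : ℝ) = ((n + d + 2 : ℕ) : ℝ) * (-1) by ring, Real.exp_nat_mul]
        refine pow_le_pow_left₀ (Real.exp_pos _).le ?_ _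
        rw [Real.exp_neg, one_div]
        exact inv_anti₀ two_pos (by linarith [Real.add_one_le_exp (1 : ℝ)])
      linarith
  have hsum := sum_le_sum hone
  rw [sum_const, nsmul_eq_mul] at hsum
  have hB' : (#B : ℝ) ≤ 2 ^ n := by
    have h1 := card_le_univ B
    rw [Fintype.card_fin] at h1
    have h2 : #B ≤ 2 ^ n := h1.trans Nat.lt_two_pow_self.le
    exact_mod_cast h2
  have hfin : (#B : ℝ) * (2 * (1 / 2) ^ (n + d + 2)) ≤ (1 / 2) ^ (d + 1) := by
    calc (#B : ℝ) * (2 * (1 / 2) ^ (n + d + 2)) ≤ 2 ^ n * (2 * (1 / 2) ^ (n + d + 2)) := by gcongr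
      _ = (1 / 2) ^ (d + 1) := by
        have : (1 / 2 : ℝ) ^ n * 2 ^ n = 1 := by rw [← mul_pow]; norm_num
        rw [show n + d + 2 = n + (d + 1) + 1 by ring, pow_succ, pow_add]
        linear_combination ((1 / 2 : ℝ) ^ (d + 1)) * this
  linarith

end Estimate

/-! ### Reasoning about programs that toss no coins -/

namespace OracleRAM

section Semantics
variable {n : ℕ} {oracle : Set (Fin n) → Prop}

theorem run_add (a b : ℕ) (c : Config) :
    run oracle (a + b) c = (run oracle a c).bind (run oracle b) := by
  induction a generalizing c with
  | zero => simp [run]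
  | succ a ih =>
    rw [Nat.succ_add]
    simp only [run, PMF.bind_bind]
    congr 1
    ext1 c'
    exact ih c'

theorem run_halted (m : ℕ) (s : Store) (t : ℕ) :
    run oracle m ⟨[], s, t⟩ = PMF.pure ⟨[], s, t⟩ := by
  induction m with
  | zero => rfl
  | succ m ih => simp [run, step, ih]

/-- The number of subexpressions. -/
def Expr.nodes : Expr → ℕ
  | const _ => 1
  | var _ => 1
  | get _ i => i.nodes + 1
  | add e₁ e₂ => e₁.nodes + e₂.nodes + 1
  | sub e₁ e₂ => e₁.nodes + e₂.nodes + 1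
  | mul e₁ e₂ => e₁.nodes + e₂.nodes + 1
  | div e₁ e₂ => e₁.nodes + e₂.nodes + 1

/-- The largest constant in an expression. -/
def Expr.maxConst : Expr → ℕ
  | const c => c
  | var _ => 0
  | get _ i => i.maxConst
  | add e₁ e₂ => max e₁.maxConst e₂.maxConst
  | sub e₁ e₂ => max e₁.maxConst e₂.maxConst
  | mul e₁ e₂ => max e₁.maxConst e₂.maxConst
  | div e₁ e₂ => max e₁.maxConst e₂.maxConst

/-- All numbers in the memory are at most `u`. -/
def Store.Bounded (u : ℕ) (s : Store) : Prop := (∀ x, s.var x ≤ u) ∧ ∀ a i, s.arr a i ≤ u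

/-- Expressions with few nodes and small constants; their evaluation takes time at most
`timeUnit u` on a store bounded by `u`. -/
def Expr.Simple (e : Expr) : Prop := e.nodes ≤ 40 ∧ e.maxConst ≤ 64

instance (e : Expr) : Decidable e.Simple := inferInstanceAs (Decidable (_ ∧ _))

/-- A bound for the time of an elementary step on a store bounded by `u`: such a step evaluates at
most two simple expressions, and each evaluation costs at most `2000 * u.size`. -/
def timeUnit (u : ℕ) : ℕ := 4096 * u.size

theorem Expr.one_le_nodes (e : Expr) : 1 ≤ e.nodes := by cases e <;> simp [nodes]

theorem Expr.eval_le {u : ℕ} (hu : 64 ≤ u) {s : Store} (hs : s.Bounded u) (e : Expr)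
    (he : e.maxConst ≤ 64) : e.eval s ≤ u ^ e.nodes := by
  have hu0 : 0 < u := by omega
  have hmono : ∀ {a b : ℕ}, a ≤ b → u ^ a ≤ u ^ b := fun h => Nat.pow_le_pow_right hu0 h
  induction e with
  | const c => simpa [eval, nodes] using (show c ≤ 64 from he).trans hu
  | var x => simpa [eval, nodes] using hs.1 x
  | get a i ih =>
    refine (hs.2 a _).trans ?_
    exact (pow_one u).symm.le.trans (hmono (by simp only [nodes]; omega))
  | add e₁ e₂ ih₁ ih₂ =>
    have h₁ := (ih₁ (le_trans (le_max_left _ _) he)).trans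
      (hmono (show e₁.nodes ≤ e₁.nodes + e₂.nodes by omega))
    have h₂ := (ih₂ (le_trans (le_max_right _ _) he)).trans
      (hmono (show e₂.nodes ≤ e₁.nodes + e₂.nodes by omega))
    simp only [eval, nodes, pow_succ]
    nlinarith
  | sub e₁ e₂ ih₁ ih₂ =>
    exact (Nat.sub_le _ _).trans ((ih₁ (le_trans (le_max_left _ _) he)).trans
      (hmono (by simp only [nodes]; omega)))
  | mul e₁ e₂ ih₁ ih₂ =>
    refine (Nat.mul_le_mul (ih₁ (le_trans (le_max_left _ _) he))
      (ih₂ (le_trans (le_max_right _ _) he))).trans ?_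
    rw [← pow_add]
    exact hmono (by simp only [nodes]; omega)
  | div e₁ e₂ ih₁ ih₂ =>
    exact (Nat.div_le_self _ _).trans ((ih₁ (le_trans (le_max_left _ _) he)).trans
      (hmono (by simp only [nodes]; omega)))

theorem size_le_of_le_pow {u v k : ℕ} (hk : 1 ≤ k) (h : v ≤ u ^ k) : v.size ≤ k * u.size := by
  rw [Nat.size_le]
  refine h.trans_lt ?_
  rw [mul_comm, pow_mul]
  exact Nat.pow_lt_pow_left (Nat.lt_size_self u) (by omega)

theorem Expr.cost_le {u : ℕ} (hu : 64 ≤ u) {s : Store} (hs : s.Bounded u) (e : Expr)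
    (he : e.maxConst ≤ 64) : e.cost s ≤ e.nodes * (1 + e.nodes * u.size) := by
  have hsize : ∀ e : Expr, e.maxConst ≤ 64 → (e.eval s).size ≤ e.nodes * u.size := fun e he =>
    size_le_of_le_pow e.one_le_nodes (e.eval_le hu hs he)
  induction e with
  | const c => have := hsize _ he; simp only [cost, nodes, eval] at *; omega
  | var x => have := hsize _ he; simp only [cost, nodes, eval] at *; omega
  | get a i ih =>
    have h := hsize _ he
    have h₁ := ih he
    simp only [cost, nodes, eval] at *
    nlinarith [Nat.zero_le (i.nodes * u.size)]
  | add e₁ e₂ ih₁ ih₂ =>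
    have h := hsize _ he
    have h₁ := ih₁ (le_trans (le_max_left _ _) he)
    have h₂ := ih₂ (le_trans (le_max_right _ _) he)
    simp only [cost, nodes, eval] at *
    nlinarith [Nat.zero_le (e₁.nodes * e₂.nodes * u.size), Nat.zero_le (e₁.nodes * u.size),
      Nat.zero_le (e₂.nodes * u.size)]
  | sub e₁ e₂ ih₁ ih₂ =>
    have h := hsize _ he
    have h₁ := ih₁ (le_trans (le_max_left _ _) he)
    have h₂ := ih₂ (le_trans (le_max_right _ _) he)
    simp only [cost, nodes, eval] at *
    nlinarith [Nat.zero_le (e₁.nodes * e₂.nodes * u.size), Nat.zero_le (e₁.nodes * u.size),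
      Nat.zero_le (e₂.nodes * u.size)]
  | mul e₁ e₂ ih₁ ih₂ =>
    have h := hsize _ he
    have h₁ := ih₁ (le_trans (le_max_left _ _) he)
    have h₂ := ih₂ (le_trans (le_max_right _ _) he)
    simp only [cost, nodes, eval] at *
    nlinarith [Nat.zero_le (e₁.nodes * e₂.nodes * u.size), Nat.zero_le (e₁.nodes * u.size),
      Nat.zero_le (e₂.nodes * u.size)]
  | div e₁ e₂ ih₁ ih₂ =>
    have h := hsize _ he
    have h₁ := ih₁ (le_trans (le_max_left _ _) he)
    have h₂ := ih₂ (le_trans (le_max_right _ _) he)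
    simp only [cost, nodes, eval] at *
    nlinarith [Nat.zero_le (e₁.nodes * e₂.nodes * u.size), Nat.zero_le (e₁.nodes * u.size),
      Nat.zero_le (e₂.nodes * u.size)]

theorem one_le_size {u : ℕ} (hu : 64 ≤ u) : 1 ≤ u.size := Nat.size_pos.2 (by omega)

theorem Expr.Simple.cost_le {u : ℕ} (hu : 64 ≤ u) {s : Store} (hs : s.Bounded u) {e : Expr}
    (he : e.Simple) : e.cost s ≤ 2000 * u.size := by
  have h1 := one_le_size hu
  calc e.cost s ≤ e.nodes * (1 + e.nodes * u.size) := e.cost_le hu hs he.2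
    _ ≤ 40 * (1 + 40 * u.size) := by gcongr <;> exact he.1
    _ ≤ _ := by omega

/-- `c` started at the store `s` (bounded by `u`) reaches, without tossing coins and within `T`
units of time, a store (bounded by `u`) with the property `Q`. The number of steps is bounded by
the time. -/
def Runs (oracle : Set (Fin n) → Prop) (u : ℕ) (c : Cmd) (s : Store) (T : ℕ) (Q : Store → Prop) :
    Prop :=
  s.Bounded u → ∃ s' m t, m ≤ t ∧ t ≤ T * timeUnit u ∧
    (∀ k t₀, run oracle m ⟨c :: k, s, t₀⟩ = PMF.pure ⟨k, s', t₀ + t⟩) ∧ s'.Bounded u ∧ Q s'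

variable {u : ℕ} {s : Store} {Q : Store → Prop} {T T₁ T₂ : ℕ}

theorem Runs.mono {c : Cmd} (h : Runs oracle u c s T₁ Q) (hT : T₁ ≤ T) : Runs oracle u c s T Q :=
  fun hs => by
    obtain ⟨s', m, t, h1, h2, h3⟩ := h hs
    exact ⟨s', m, t, h1, h2.trans (Nat.mul_le_mul_right _ hT), h3⟩

theorem Runs.imp {Q' : Store → Prop} {c : Cmd} (h : Runs oracle u c s T Q)
    (hQ : ∀ s', Q s' → Q' s') : Runs oracle u c s T Q' :=
  fun hs => by
    obtain ⟨s', m, t, h1, h2, h3, h4, h5⟩ := h hs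
    exact ⟨s', m, t, h1, h2, h3, h4, hQ _ h5⟩

theorem one_le_timeUnit (hu : 64 ≤ u) : 1 ≤ timeUnit u := by
  have := one_le_size hu
  unfold timeUnit; omega

theorem Runs.skip (hu : 64 ≤ u) (hQ : Q s) : Runs oracle u .skip s 1 Q := fun hs =>
  ⟨s, 1, 1, le_rfl, by rw [one_mul]; exact one_le_timeUnit hu, fun k t₀ => by simp [run, step],
    hs, hQ⟩

theorem Store.Bounded.setVar (hs : s.Bounded u) {x v : ℕ} (hv : v ≤ u) :
    (s.setVar x v).Bounded u := by
  refine ⟨fun y => ?_, hs.2⟩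
  simp only [Store.setVar, Function.update_apply]
  split_ifs
  exacts [hv, hs.1 y]

theorem Store.Bounded.setArr (hs : s.Bounded u) {a i v : ℕ} (hv : v ≤ u) :
    (s.setArr a i v).Bounded u := by
  refine ⟨hs.1, fun b j => ?_⟩
  simp only [Store.setArr, Function.update_apply]
  split_ifs
  · rw [Function.update_apply]
    split_ifs
    exacts [hv, hs.2 a j]
  · exact hs.2 b j

theorem Runs.assign (hu : 64 ≤ u) {x : ℕ} {e : Expr} (he : e.Simple)
    (hle : s.Bounded u → e.eval s ≤ u) (hQ : Q (s.setVar x (e.eval s))) :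
    Runs oracle u (.assign x e) s 1 Q := fun hs => by
  have h1 := he.cost_le hu hs
  have h2 := one_le_size hu
  refine ⟨_, 1, 1 + e.cost s, by omega, ?_, fun k t₀ => by simp [run, step], hs.setVar (hle hs), hQ⟩
  unfold timeUnit; omega

theorem Runs.write (hu : 64 ≤ u) {a : ℕ} {i e : Expr} (hi : i.Simple) (he : e.Simple)
    (hle : s.Bounded u → e.eval s ≤ u) (hQ : Q (s.setArr a (i.eval s) (e.eval s))) :
    Runs oracle u (.write a i e) s 1 Q := fun hs => by
  have h1 := he.cost_le hu hs
  have h3 := hi.cost_le hu hs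
  have h2 := one_le_size hu
  refine ⟨_, 1, 1 + i.cost s + e.cost s, by omega, ?_, fun k t₀ => by simp [run, step],
    hs.setArr (hle hs), hQ⟩
  unfold timeUnit; omega

theorem answer_le_one (s : Store) (a : ℕ) : answer oracle s a ≤ 1 := by
  unfold answer; split_ifs <;> omega

theorem Runs.query (hu : 64 ≤ u) (hn : 2 ^ n ≤ u) {x a : ℕ}
    (hQ : Q (s.setVar x (answer oracle s a))) :
    Runs oracle u (.query x a) s 1 Q := fun hs => by
  have h2 := one_le_size hu
  have h3 : n < u.size := Nat.lt_size.2 hn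
  refine ⟨_, 1, 1 + n, by omega, ?_, fun k t₀ => by simp [run, step],
    hs.setVar ((answer_le_one s a).trans (by omega)), hQ⟩
  unfold timeUnit; omega

theorem Runs.seq (hu : 64 ≤ u) {c₁ c₂ : Cmd}
    (h : Runs oracle u c₁ s T₁ fun s' => Runs oracle u c₂ s' T₂ Q) :
    Runs oracle u (.seq c₁ c₂) s (T₁ + T₂ + 1) Q := fun hs => by
  obtain ⟨s₁, m₁, t₁, hm₁, ht₁, hr₁, hs₁, h⟩ := h hs
  obtain ⟨s₂, m₂, t₂, hm₂, ht₂, hr₂, hs₂, hQ⟩ := h hs₁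
  refine ⟨s₂, 1 + (m₁ + m₂), 1 + (t₁ + t₂), by omega, ?_, fun k t₀ => ?_, hs₂, hQ⟩
  · have := one_le_timeUnit hu
    rw [add_mul, add_mul, one_mul]; omega
  · rw [run_add]
    simp only [run, step, PMF.pure_bind, PMF.bind_pure]
    rw [run_add, hr₁, PMF.pure_bind, hr₂]
    congr 2; ring

theorem Runs.ite_true (hu : 64 ≤ u) {e : Expr} {c₁ c₂ : Cmd} (he : e.Simple) (h0 : e.eval s ≠ 0)
    (h : Runs oracle u c₁ s T Q) : Runs oracle u (.ite e c₁ c₂) s (T + 1) Q := fun hs => by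
  obtain ⟨s₁, m₁, t₁, hm₁, ht₁, hr₁, hs₁, hQ⟩ := h hs
  have h1 := he.cost_le hu hs
  have h2 := one_le_size hu
  refine ⟨s₁, 1 + m₁, 1 + e.cost s + t₁, by omega, ?_, fun k t₀ => ?_, hs₁, hQ⟩
  · rw [add_mul, one_mul]; unfold timeUnit at *; omega
  · rw [run_add]
    simp only [run, step, PMF.pure_bind, PMF.bind_pure, if_pos h0]
    rw [hr₁]
    congr 2; ring

theorem Runs.ite_false (hu : 64 ≤ u) {e : Expr} {c₁ c₂ : Cmd} (he : e.Simple) (h0 : e.eval s = 0)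
    (h : Runs oracle u c₂ s T Q) : Runs oracle u (.ite e c₁ c₂) s (T + 1) Q := fun hs => by
  obtain ⟨s₁, m₁, t₁, hm₁, ht₁, hr₁, hs₁, hQ⟩ := h hs
  have h1 := he.cost_le hu hs
  have h2 := one_le_size hu
  refine ⟨s₁, 1 + m₁, 1 + e.cost s + t₁, by omega, ?_, fun k t₀ => ?_, hs₁, hQ⟩
  · rw [add_mul, one_mul]; unfold timeUnit at *; omega
  · rw [run_add]
    simp only [run, step, PMF.pure_bind, PMF.bind_pure, h0, ne_eq, not_true_eq_false, if_false]
    rw [hr₁]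
    congr 2; ring

/-- A loop with an invariant `P` that makes exactly `N` iterations. -/
theorem Runs.loop (hu : 64 ≤ u) {e : Expr} {c : Cmd} (he : e.Simple) (N : ℕ)
    (P : ℕ → Store → Prop) (h0 : P 0 s) (hguard : ∀ i s, i < N → P i s → e.eval s ≠ 0)
    (hend : ∀ s, P N s → e.eval s = 0)
    (hbody : ∀ i s, i < N → P i s → Runs oracle u c s T (P (i + 1)))
    (hQ : ∀ s, P N s → Q s) : Runs oracle u (.loop e c) s (N * (T + 1) + 1) Q := by
  have key : ∀ j i s, i + j = N → P i s → Runs oracle u (.loop e c) s (j * (T + 1) + 1) Q := by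
    intro j
    induction j with
    | zero =>
      intro i s hij hP hs
      obtain rfl : i = N := by omega
      have h1 := he.cost_le hu hs
      have h2 := one_le_size hu
      refine ⟨s, 1, 1 + e.cost s, by omega, ?_, fun k t₀ => ?_, hs, hQ s hP⟩
      · unfold timeUnit; omega
      · simp [run, step, hend s hP]
    | succ j ih =>
      intro i s hij hP hs
      have h1 := he.cost_le hu hs
      have h2 := one_le_size hu
      obtain ⟨s₁, m₁, t₁, hm₁, ht₁, hr₁, hs₁, hP₁⟩ := hbody i s (by omega) hP hs
      obtain ⟨s₂, m₂, t₂, hm₂, ht₂, hr₂, hs₂, hQ₂⟩ := ih (i + 1) s₁ (by omega) hP₁ hs₁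
      refine ⟨s₂, 1 + (m₁ + m₂), 1 + e.cost s + (t₁ + t₂), by omega, ?_, fun k t₀ => ?_, hs₂, hQ₂⟩
      · have : ((j + 1) * (T + 1) + 1) * timeUnit u
            = (j * (T + 1) + 1) * timeUnit u + T * timeUnit u + timeUnit u := by ring
        rw [this]; unfold timeUnit at *; omega
      · rw [run_add]
        simp only [run, step, PMF.pure_bind, PMF.bind_pure, if_pos (hguard i s (by omega) hP)]
        rw [run_add, hr₁, PMF.pure_bind, hr₂]
        congr 2; ring
  exact key N 0 s (zero_add N) h0

/-- Execute the command for the values `0, 1, …` of the variable `x` below the bound. -/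
def Cmd.for (x : ℕ) (bound : Expr) (c : Cmd) : Cmd :=
  .seq (.assign x (.const 0))
    (.loop (.sub bound (.var x)) (.seq c (.assign x (.add (.var x) (.const 1)))))

theorem Runs.for (hu : 64 ≤ u) {x : ℕ} {b : Expr} {c : Cmd} (hb : (b.sub (.var x)).Simple) (N : ℕ)
    (hN : N ≤ u) (P : ℕ → Store → Prop) (h0 : P 0 (s.setVar x 0))
    (hx : ∀ i s, P i s → s.var x = i ∧ b.eval s = N)
    (hbody : ∀ i s, i < N → P i s → Runs oracle u c s T fun s' =>
      s'.var x = i ∧ P (i + 1) (s'.setVar x (i + 1)))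
    (hQ : ∀ s, P N s → Q s) : Runs oracle u (.for x b c) s (N * (T + 3) + 3) Q := by
  have h : Runs oracle u (.for x b c) s (1 + (N * (T + 1 + 1 + 1) + 1) + 1) Q := by
    refine Runs.seq hu (Runs.assign hu (by decide) (fun _ => Nat.zero_le _) ?_)
    refine Runs.loop hu hb N P h0 (fun i s hi hP => ?_) (fun s hP => ?_) (fun i s hi hP => ?_) hQ
    · simp only [Expr.eval, hx i s hP]; omega
    · simp only [Expr.eval, hx N s hP]; omega
    · refine Runs.seq hu ((hbody i s hi hP).imp fun s' hs' => ?_)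
      refine Runs.assign hu ⟨by simp [Expr.nodes], by simp [Expr.maxConst]⟩ (fun _ => ?_) ?_
      · simp only [Expr.eval, hs'.1]; omega
      · simp only [Expr.eval, hs'.1]; exact hs'.2
  exact h.mono (by ring_nf; omega)

end Semantics

end OracleRAM

/-! ### The program that computes the estimate -/

namespace OracleRAM

section Frames

@[simp] theorem Store.var_setVar (s : Store) (x v y : ℕ) :
    (s.setVar x v).var y = if y = x then v else s.var y := by
  simp [Store.setVar, Function.update_apply]

@[simp] theorem Store.arr_setVar (s : Store) (x v : ℕ) : (s.setVar x v).arr = s.arr := rfl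

@[simp] theorem Store.var_setArr (s : Store) (a i v : ℕ) : (s.setArr a i v).var = s.var := rfl

@[simp] theorem Store.arr_setArr (s : Store) (a i v b : ℕ) :
    (s.setArr a i v).arr b = if b = a then Function.update (s.arr a) i v else s.arr b := by
  simp [Store.setArr, Function.update_apply]

/-- The stores `s` and `s'` differ at most in the variables from `X` and the arrays from `A`. -/
def Frame (X A : List ℕ) (s s' : Store) : Prop :=
  (∀ x ∉ X, s'.var x = s.var x) ∧ ∀ a ∉ A, s'.arr a = s.arr a

variable {X A X' A' : List ℕ} {s s' s'' : Store}

theorem Frame.refl : Frame X A s s := ⟨fun _ _ => rfl, fun _ _ => rfl⟩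

theorem Frame.setVar (h : Frame X A s s') {x v : ℕ} (hx : x ∈ X) : Frame X A s (s'.setVar x v) := by
  refine ⟨fun y hy => ?_, h.2⟩
  rw [Store.var_setVar, if_neg (by rintro rfl; exact hy hx), h.1 y hy]

theorem Frame.setArr (h : Frame X A s s') {a i v : ℕ} (ha : a ∈ A) :
    Frame X A s (s'.setArr a i v) := by
  refine ⟨h.1, fun b hb => ?_⟩
  rw [Store.arr_setArr, if_neg (by rintro rfl; exact hb ha), h.2 b hb]

theorem Frame.trans (h : Frame X A s s') (h' : Frame X' A' s' s'') (hX : X' ⊆ X) (hA : A' ⊆ A) :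
    Frame X A s s'' :=
  ⟨fun x hx => (h'.1 x fun hx' => hx (hX hx')).trans (h.1 x hx),
    fun a ha => (h'.2 a fun ha' => ha (hA ha')).trans (h.2 a ha)⟩

end Frames

section Indicator
variable {n : ℕ}

/-- The indicator vector of a set of elements, as the contents of an array. -/
def indicator (B : Finset (Fin n)) (k : ℕ) : ℕ := if ∃ i ∈ B, (i : ℕ) = k then 1 else 0

theorem indicator_apply (B : Finset (Fin n)) (i : Fin n) :
    indicator B i = if i ∈ B then 1 else 0 := by
  simp [indicator, Fin.val_inj]

theorem indicator_ext {B : Finset (Fin n)} {f : ℕ → ℕ} (h1 : ∀ i : Fin n, f i = indicator B i)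
    (h2 : ∀ k, n ≤ k → f k = 0) : f = indicator B := by
  ext k
  rcases lt_or_ge k n with hk | hk
  · exact h1 ⟨k, hk⟩
  · rw [h2 k hk, indicator, if_neg]
    rintro ⟨i, -, rfl⟩
    exact absurd i.2 (not_lt.2 hk)

theorem indicator_of_ge (B : Finset (Fin n)) {k : ℕ} (hk : n ≤ k) : indicator B k = 0 := by
  rw [indicator, if_neg]
  rintro ⟨i, -, rfl⟩
  exact absurd i.2 (not_lt.2 hk)

theorem indicator_empty : indicator (∅ : Finset (Fin n)) = fun _ => 0 := by
  ext k; simp [indicator]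

theorem indicator_insert (B : Finset (Fin n)) (i : Fin n) :
    Function.update (indicator B) i 1 = indicator (insert i B) := by
  refine indicator_ext (fun j => ?_) fun k hk => ?_
  · simp only [Function.update_apply, indicator_apply, mem_insert, Fin.val_inj]
    split_ifs <;> tauto
  · rw [Function.update_of_ne (by have := i.2; omega), indicator_of_ge _ hk]

theorem indicator_insert_undo {B : Finset (Fin n)} {i : Fin n} (hi : i ∉ B) :
    Function.update (indicator (insert i B)) i 0 = indicator B := by
  refine indicator_ext (fun j => ?_) fun k hk => ?_
  · simp only [Function.update_apply, indicator_apply, mem_insert, Fin.val_inj]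
    split_ifs <;> simp_all
  · rw [Function.update_of_ne (by have := i.2; omega), indicator_of_ge _ hk]

/-- Exchanging two cells of the indicator vector. -/
theorem indicator_swapSet (B : Finset (Fin n)) (x y : Fin n) :
    Function.update (Function.update (indicator B) x (indicator B y)) y (indicator B x)
      = indicator (swapSet x y B) := by
  refine indicator_ext (fun j => ?_) fun k hk => ?_
  · simp only [Function.update_apply, indicator_apply, mem_swapSet, Fin.val_inj,
      Equiv.swap_apply_def]
    by_cases h1 : j = y
    · by_cases h2 : j = x
      · subst h1; subst h2; simp
      · simp [h1, show y ≠ x from fun h => h2 (h1.trans h)]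
    · by_cases h2 : j = x
      · subst h2; simp [h1]
      · simp [h1, h2]
  · rw [Function.update_of_ne (by have := y.2; omega),
      Function.update_of_ne (by have := x.2; omega), indicator_of_ge _ hk]

theorem answer_indicator (oracle : Set (Fin n) → Prop) {s : Store} {a : ℕ} {B : Finset (Fin n)}
    (h : s.arr a = indicator B) :
    answer oracle s a = open Classical in if oracle (B : Set (Fin n)) then 1 else 0 := by
  have : {i : Fin n | s.arr a i ≠ 0} = (B : Set (Fin n)) := by
    ext i; simp [h, indicator_apply]
  rw [answer, this]

end Indicator

section Program

/-! The variables of the program: `0` is `n`, `2` and `4` are the positions of the first nonzero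
digits of `ε` and `δ`, `3` is a power of two above `1 / ε`, `5` is the number of samples, `6` the
length of a walk, `7` the number of coins, `8` and `9` serve to toss the coins, `10` is the counter
of the greedy algorithm, `11` the answer of the oracle, `12` the current element, `13` and `14` are
the numerator and the denominator of the output, `15` is the number of successful samples, `16` the
counter of the samples, `17` that of a copying loop, `18` that of the moves of a walk, `19` and `20`
are the elements to be exchanged, and `21` is auxiliary. The arrays: `2` contains the coins, `3` the
greedy base, `4` the current base of the walk, and `5` the elements that the walk does not move. -/

/-- Exchange the cells with the addresses in the variables `19` and `20` of the array `4`. -/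
def swapCmd : Cmd :=
  .seq (.assign 21 (.get 4 (.var 19)))
    (.seq (.write 4 (.var 19) (.get 4 (.var 20))) (.write 4 (.var 20) (.var 21)))

/-- One move of the walk, if the coin for this move shows heads. -/
def moveCmd : Cmd :=
  .seq (.assign 19 (.sub (.div (.var 18) (.var 0))
      (.mul (.var 0) (.div (.div (.var 18) (.var 0)) (.var 0)))))
    (.seq (.assign 20 (.sub (.var 18) (.mul (.var 0) (.div (.var 18) (.var 0)))))
      (.ite (.get 2 (.add (.mul (.add (.mul (.var 12) (.var 5)) (.var 16)) (.var 6)) (.var 18)))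
        (.ite (.add (.get 5 (.var 19)) (.get 5 (.var 20))) .skip
          (.seq swapCmd (.seq (.query 11 4) (.ite (.var 11) .skip swapCmd))))
        .skip))

/-- One sample: a walk from the greedy base, whose last base is tested for the current element. -/
def sampleCmd : Cmd :=
  .seq (.for 17 (.var 0) (.write 4 (.var 17) (.get 3 (.var 17))))
    (.seq (.for 18 (.var 6) moveCmd) (.assign 15 (.add (.var 15) (.get 4 (.var 12)))))

/-- All samples for the current element, and the update of the output. -/
def elementCmd : Cmd :=
  .seq (.assign 15 (.const 0))
    (.seq (.for 16 (.var 5) sampleCmd)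
      (.ite (.get 3 (.var 12))
        (.seq (.assign 13 (.mul (.var 13) (.var 5)))
          (.seq (.assign 14 (.mul (.var 14) (.var 15))) (.write 5 (.var 12) (.const 1))))
        .skip))

/-- The computation of the estimate from the greedy base and the coins. -/
def estimateCmd : Cmd :=
  .seq (.assign 13 (.const 1))
    (.seq (.assign 14 (.const 1))
      (.seq (.for 12 (.var 0) elementCmd)
        (.seq (.assign 0 (.var 13)) (.assign 1 (.var 14)))))

/-- The greedy algorithm for a base. -/
def greedyCmd : Cmd :=
  .for 10 (.var 0)
    (.seq (.write 3 (.var 10) (.const 1))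
      (.seq (.query 11 3) (.ite (.var 11) .skip (.write 3 (.var 10) (.const 0)))))

end Program

section Correctness
variable {n : ℕ} {M : Matroid (Fin n)} {u : ℕ}

theorem runs_greedyCmd (hM : M.E = Set.univ) (hu : 64 ≤ u) (hn : 2 ^ n ≤ u) {s : Store}
    (h0 : s.var 0 = n) (h3 : s.arr 3 = fun _ => 0) :
    Runs M.Indep u greedyCmd s (n * 10 + 3) fun s' => Frame [10, 11] [3] s s' ∧
      ∃ B : Finset (Fin n), M.IsBase (B : Set (Fin n)) ∧ s'.arr 3 = indicator B := by
  have hnu : n ≤ u := Nat.lt_two_pow_self.le.trans hn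
  refine Runs.mono (T₁ := n * (7 + 3) + 3) (Runs.for hu (by decide) n hnu (fun i s' =>
    Frame [10, 11] [3] s s' ∧ s'.var 10 = i ∧ ∃ I : Finset (Fin n),
      s'.arr 3 = indicator I ∧ M.IsBasis (I : Set (Fin n)) {k | (k : ℕ) < i}) ?_ ?_ ?_ ?_) le_rfl
  · refine ⟨Frame.refl.setVar (by simp), by simp, ∅, by simp [h3, indicator_empty], ?_⟩
    simp
  · rintro i s' ⟨hf, h10, -⟩
    exact ⟨h10, (hf.1 0 (by decide)).trans h0⟩
  · rintro i s' hi ⟨hf, h10, I, hI, hb⟩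
    set iF : Fin n := ⟨i, hi⟩ with hiF
    have hset : {k : Fin n | (k : ℕ) < i + 1} = insert iF {k : Fin n | (k : ℕ) < i} := by
      ext k
      simp only [Set.mem_ofPred_eq, Set.mem_insert_iff, hiF, Fin.ext_iff]
      omega
    have hiI : iF ∉ I := fun h => by simpa [hiF] using hb.subset (mem_coe.2 h)
    have h3' : (s'.setArr 3 i 1).arr 3 = indicator (insert iF I) := by
      simp only [Store.arr_setArr, if_true, hI]; exact indicator_insert I iF
    refine Runs.seq hu (T₁ := 1) (T₂ := 5) (Runs.write hu (by decide) (by decide) (fun _ => ?_) ?_)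
    · simp [Expr.eval]; omega
    simp only [Expr.eval, h10]
    refine Runs.mono (Runs.seq hu (Runs.query hu hn ?_)) (T₁ := 1 + 2 + 1) (by norm_num)
    rw [answer_indicator _ h3']
    by_cases hind : M.Indep ((insert iF I : Finset (Fin n)) : Set (Fin n))
    · refine Runs.ite_true hu (by decide)
        (by rw [Expr.eval, Store.var_setVar, if_pos rfl, if_pos hind]; exact one_ne_zero)
        (Runs.skip hu ?_)
      refine ⟨by simp [h10], (((hf.setArr (by simp)).setVar (by simp)).setVar (by simp)), by simp,
        insert iF I, by simpa using h3', ?_⟩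
      rw [hset, coe_insert]
      rw [coe_insert] at hind
      exact hb.insert_isBasis_insert hind
    · refine Runs.ite_false hu (by decide)
        (by rw [Expr.eval, Store.var_setVar, if_pos rfl, if_neg hind])
        (Runs.write hu (by decide) (by decide) (fun _ => Nat.zero_le _) ?_)
      refine ⟨by simp [h10], ((((hf.setArr (by simp)).setVar (by simp)).setArr (by simp)).setVar
        (by simp)), by simp, I, ?_, ?_⟩
      · simp only [Store.arr_setVar, Store.arr_setArr, if_true, Expr.eval, Store.var_setVar,
          Store.var_setArr, h10, hI]
        have := indicator_insert I iF
        rw [show Function.update (indicator I) i 1 = indicator (insert iF I) from this]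
        exact indicator_insert_undo hiI
      · rw [hset]
        refine hb.indep.isBasis_of_subset_of_subset_closure ?_ ?_
        · exact hb.subset.trans (Set.subset_insert _ _)
        · refine Set.insert_subset ?_ hb.subset_closure
          rw [coe_insert] at hind
          have := hb.indep.mem_closure_iff' (x := iF)
          rw [this, hM]
          exact ⟨Set.mem_univ _, fun h => absurd h hind⟩
  · rintro s' ⟨hf, -, I, hI, hb⟩
    refine ⟨hf, I, ?_, hI⟩
    have : {k : Fin n | (k : ℕ) < n} = M.E := by rw [hM]; ext k; simp
    rw [this] at hb
    exact Matroid.isBasis_ground_iff.1 hb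

theorem runs_swapCmd (hu : 64 ≤ u) {oracle : Set (Fin n) → Prop} {s : Store} {x y : Fin n}
    {B : Finset (Fin n)} (h19 : s.var 19 = x) (h20 : s.var 20 = y) (h4 : s.arr 4 = indicator B) :
    Runs oracle u swapCmd s 5 fun s' =>
      Frame [21] [4] s s' ∧ s'.arr 4 = indicator (swapSet x y B) := by
  refine Runs.seq hu (T₁ := 1) (T₂ := 3) (Runs.assign hu (by decide) (fun hs => hs.2 _ _) ?_)
  refine Runs.seq hu (T₁ := 1) (T₂ := 1)
    (Runs.write hu (by decide) (by decide) (fun hs => hs.2 _ _) ?_)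
  refine Runs.write hu (by decide) (by decide) (fun hs => hs.1 _) ⟨?_, ?_⟩
  · exact ((Frame.refl.setVar (by simp)).setArr (by simp)).setArr (by simp)
  · rw [← indicator_swapSet]
    simp [Expr.eval, h19, h20, h4]

/-- The coin for the move `q` of the walk `j` for the element `i` is in the cell
`(i * S + j) * ℓ + q`. If it shows heads, then the two cells are exchanged and,
when the oracle rejects the result, exchanged again. -/
theorem runs_moveCmd (hu : 64 ≤ u) (hn : 2 ^ n ≤ u) (hn0 : 0 < n) {s : Store} {S ℓ i j q : ℕ}
    {ω : ℕ → ℕ} {K B : Finset (Fin n)} (h0 : s.var 0 = n) (h5 : s.var 5 = S) (h6 : s.var 6 = ℓ)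
    (h12 : s.var 12 = i) (h16 : s.var 16 = j) (h18 : s.var 18 = q) (h2 : s.arr 2 = ω)
    (h5' : s.arr 5 = indicator K) (h4 : s.arr 4 = indicator B) :
    Runs M.Indep u moveCmd s 20 fun s' => Frame [11, 19, 20, 21] [4] s s' ∧
      s'.arr 4 = indicator (if ω ((i * S + j) * ℓ + q) ≠ 0 then scanMove hn0 M K q B else B) := by
  have hnu : n ≤ u := Nat.lt_two_pow_self.le.trans hn
  set x : Fin n := ⟨q / n % n, Nat.mod_lt _ hn0⟩ with hx
  set y : Fin n := ⟨q % n, Nat.mod_lt _ hn0⟩ with hy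
  have hex : (Expr.sub (.div (.var 18) (.var 0))
      (.mul (.var 0) (.div (.div (.var 18) (.var 0)) (.var 0)))).eval s = x := by
    simp only [Expr.eval, h0, h18, hx, Nat.mod_def (q / n)]
  refine Runs.seq hu (T₁ := 1) (T₂ := 18) (Runs.assign hu (by decide) (fun _ => ?_) ?_)
  · rw [hex]; have := x.2; omega
  rw [hex]
  have hey : (Expr.sub (.var 18) (.mul (.var 0) (.div (.var 18) (.var 0)))).eval
      (s.setVar 19 x) = y := by
    simp [Expr.eval, h0, h18, hy, Nat.mod_def q]
  refine Runs.seq hu (T₁ := 1) (T₂ := 16) (Runs.assign hu (by decide) (fun _ => ?_) ?_)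
  · rw [hey]; have := y.2; omega
  rw [hey]
  set s₂ := (s.setVar 19 x).setVar 20 y with hs₂
  have hf : Frame [11, 19, 20, 21] [4] s s₂ := (Frame.refl.setVar (by simp)).setVar (by simp)
  have h19 : s₂.var 19 = x := by simp [hs₂]
  have h20 : s₂.var 20 = y := by simp [hs₂]
  have h4₂ : s₂.arr 4 = indicator B := by simp [hs₂, h4]
  have h5₂ : s₂.arr 5 = indicator K := by simp [hs₂, h5']
  have hbit : (Expr.get 2 (.add (.mul (.add (.mul (.var 12) (.var 5)) (.var 16)) (.var 6))
      (.var 18))).eval s₂ = ω ((i * S + j) * ℓ + q) := by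
    simp [Expr.eval, hs₂, h12, h5, h16, h6, h18, h2]
  by_cases hω : ω ((i * S + j) * ℓ + q) = 0
  · refine Runs.mono (Runs.ite_false hu (by decide) (hbit.trans hω) (Runs.skip hu ⟨hf, ?_⟩))
      (by norm_num)
    rw [if_neg (not_not.2 hω), h4₂]
  rw [if_pos hω]
  refine Runs.ite_true hu (by decide) (by rw [hbit]; exact hω) ?_
  have hpin : (Expr.add (.get 5 (.var 19)) (.get 5 (.var 20))).eval s₂
      = (if x ∈ K then 1 else 0) + if y ∈ K then 1 else 0 := by
    simp only [Expr.eval, h19, h20, h5₂, indicator_apply]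
  by_cases hK : x ∈ K ∨ y ∈ K
  · refine Runs.mono (Runs.ite_true hu (by decide) ?_ (Runs.skip hu ⟨hf, ?_⟩)) (by norm_num)
    · rw [hpin]; rcases hK with h | h <;> simp [h]
    · rw [scanMove, exchange, if_pos hK, h4₂]
  refine Runs.ite_false hu (by decide) ?_ ?_
  · rw [hpin]; simp only [not_or] at hK; simp [hK]
  rw [scanMove, exchange, if_neg hK]
  refine Runs.seq hu (T₁ := 5) (T₂ := 8) ((runs_swapCmd hu h19 h20 h4₂).imp fun s₃ hs₃ => ?_)
  refine Runs.seq hu (T₁ := 1) (T₂ := 6) (Runs.query hu hn ?_)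
  rw [answer_indicator _ hs₃.2]
  have hf₃ : Frame [11, 19, 20, 21] [4] s s₃ := hf.trans hs₃.1 (by simp) (by simp)
  by_cases hind : M.Indep (swapSet x y B : Set (Fin n))
  · refine Runs.mono (Runs.ite_true hu (by decide) (by simp [Expr.eval, hind])
      (Runs.skip hu ⟨hf₃.setVar (by simp), ?_⟩)) (by norm_num)
    rw [Store.arr_setVar, hs₃.2, if_pos hind]
  · refine Runs.ite_false hu (by decide) (by simp [Expr.eval, hind]) ?_
    refine Runs.imp (runs_swapCmd (s := s₃.setVar 11 _) hu (x := x) (y := y)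
      (B := swapSet x y B) ?_ ?_ hs₃.2)
      fun s₄ hs₄ => ⟨(hf₃.setVar (by simp)).trans hs₄.1 (by simp) (by simp), ?_⟩
    · simp [hs₃.1.1 19 (by decide), h19]
    · simp [hs₃.1.1 20 (by decide), h20]
    · rw [if_neg hind, hs₄.2, swapSet_swapSet]

theorem runs_sampleCmd (hu : 64 ≤ u) (hn : 2 ^ n ≤ u) {s : Store} {S ℓ j : ℕ} {i : Fin n}
    {ω : ℕ → ℕ} {K B : Finset (Fin n)} (hℓ : ℓ ≤ u) (h0 : s.var 0 = n) (h5 : s.var 5 = S)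
    (h6 : s.var 6 = ℓ) (h12 : s.var 12 = i) (h16 : s.var 16 = j) (h2 : s.arr 2 = ω)
    (h3 : s.arr 3 = indicator B) (h5' : s.arr 5 = indicator K) (h4 : ∀ k, n ≤ k → s.arr 4 k = 0)
    (h15 : s.var 15 + 1 ≤ u) :
    Runs M.Indep u sampleCmd s (4 * n + 23 * ℓ + 9) fun s' =>
      Frame [11, 15, 17, 18, 19, 20, 21] [4] s s' ∧ (∀ k, n ≤ k → s'.arr 4 k = 0) ∧
      s'.var 15 = s.var 15 +
        if i ∈ walkState (scanMove i.pos M K) ω ((i * S + j) * ℓ) B ℓ then 1 else 0 := by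
  have hnu : n ≤ u := Nat.lt_two_pow_self.le.trans hn
  refine Runs.mono (Runs.seq hu (T₁ := n * (1 + 3) + 3) (T₂ := ℓ * (20 + 3) + 3 + 1 + 1) ?_)
    (by omega)
  refine Runs.for hu (by decide) n hnu (fun m s' => Frame [17] [4] s s' ∧ s'.var 17 = m ∧
    ∀ k, k < m ∨ n ≤ k → s'.arr 4 k = indicator B k) ?_ ?_ ?_ ?_
  · refine ⟨Frame.refl.setVar (by simp), by simp, fun k hk => ?_⟩
    have hk' : n ≤ k := by omega
    simp [h4 k hk', indicator_of_ge _ hk']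
  · rintro m s' ⟨hf, h17, -⟩
    exact ⟨h17, (hf.1 0 (by decide)).trans h0⟩
  · rintro m s' hm ⟨hf, h17, hc⟩
    refine Runs.write hu (by decide) (by decide) (fun hs => hs.2 _ _) ⟨h17, ?_, by simp, ?_⟩
    · exact (hf.setArr (by simp)).setVar (by simp)
    · intro k hk
      simp only [Expr.eval, h17, Store.arr_setVar, Store.arr_setArr, if_true,
        Function.update_apply, hf.2 3 (by decide), h3]
      split_ifs with hkm
      · rw [hkm]
      · exact hc k (by omega)
  rintro s₁ ⟨hf₁, -, hc₁⟩
  have h4₁ : s₁.arr 4 = indicator B := by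
    ext k; exact hc₁ k (lt_or_ge k n)
  refine Runs.seq hu (T₁ := ℓ * (20 + 3) + 3) (T₂ := 1) ?_
  refine Runs.for hu (by decide) ℓ hℓ (fun q s' => Frame [11, 17, 18, 19, 20, 21] [4] s s' ∧
    s'.var 18 = q ∧ s'.arr 4
      = indicator (walkState (scanMove i.pos M K) ω ((i * S + j) * ℓ) B q)) ?_ ?_ ?_ ?_
  · exact ⟨(Frame.refl.trans hf₁ (by simp) (by simp)).setVar (by simp), by simp, h4₁⟩
  · rintro q s' ⟨hf, h18, -⟩
    exact ⟨h18, (hf.1 6 (by decide)).trans h6⟩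
  · rintro q s' hq ⟨hf, h18, hc⟩
    refine (runs_moveCmd (j := j) (S := S) (ℓ := ℓ) (i := i) (ω := ω) hu hn i.pos
      ((hf.1 0 (by decide)).trans h0) ((hf.1 5 (by decide)).trans h5)
      ((hf.1 6 (by decide)).trans h6) ((hf.1 12 (by decide)).trans h12)
      ((hf.1 16 (by decide)).trans h16) h18 ((hf.2 2 (by decide)).trans h2)
      ((hf.2 5 (by decide)).trans h5') hc).imp fun s'' hs'' => ⟨?_, ?_, by simp, ?_⟩
    · rw [hs''.1.1 18 (by decide), h18]
    · exact (hf.trans hs''.1 (by simp) (by simp)).setVar (by simp)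
    · rw [Store.arr_setVar, hs''.2]; rfl
  rintro s₂ ⟨hf₂, -, hc₂⟩
  have hev : (Expr.add (.var 15) (.get 4 (.var 12))).eval s₂ = s.var 15 +
        if i ∈ walkState (scanMove i.pos M K) ω ((i * S + j) * ℓ) B ℓ then 1 else 0 := by
    simp only [Expr.eval, hf₂.1 15 (by decide), hf₂.1 12 (by decide), h12, hc₂, indicator_apply]
  refine Runs.assign hu (by decide) (fun _ => ?_) ⟨?_, ?_, ?_⟩
  · rw [hev]; split_ifs <;> omega
  · exact (Frame.refl.trans hf₂ (by simp) (by simp)).setVar (by simp)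
  · intro k hk
    rw [Store.arr_setVar, hc₂, indicator_of_ge _ hk]
  · simp [hev]

/-- The samples are taken for every element `i`, but they enter into the output only if `i` is in
`B`; then `i` is also added to the set of elements that later walks do not move. -/
theorem runs_elementCmd (hu : 64 ≤ u) (hn : 2 ^ n ≤ u) {s : Store} {S ℓ : ℕ} {i : Fin n}
    {ω : ℕ → ℕ} {B : Finset (Fin n)} (hℓ : ℓ ≤ u) (hS : S + 1 ≤ u) (h0 : s.var 0 = n)
    (h5 : s.var 5 = S) (h6 : s.var 6 = ℓ) (h12 : s.var 12 = i) (h2 : s.arr 2 = ω)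
    (h3 : s.arr 3 = indicator B) (h5' : s.arr 5 = indicator (initialPart B i))
    (h4 : ∀ k, n ≤ k → s.arr 4 k = 0) (h13 : s.var 13 * S ≤ u) (h14 : s.var 14 * S ≤ u) :
    Runs M.Indep u elementCmd s (S * (4 * n + 23 * ℓ + 12) + 12) fun s' =>
      Frame [11, 13, 14, 15, 16, 17, 18, 19, 20, 21] [4, 5] s s' ∧ (∀ k, n ≤ k → s'.arr 4 k = 0) ∧
      s'.arr 5 = indicator (initialPart B (i + 1)) ∧
      s'.var 13 = s.var 13 * (if i ∈ B then S else 1) ∧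
      s'.var 14 = s.var 14 * (if i ∈ B then sampleCount M B S ℓ ω i else 1) := by
  have hnu : n ≤ u := Nat.lt_two_pow_self.le.trans hn
  set c : ℕ → ℕ := fun j => ∑ j' ∈ range j,
    if i ∈ walkState (scanMove i.pos M (initialPart B i)) ω ((i * S + j') * ℓ) B ℓ
      then 1 else 0 with hc
  have hcle : ∀ j, c j ≤ j := fun j => by
    refine (sum_le_card_nsmul _ _ 1 fun j' _ => ?_).trans (by simp)
    split_ifs <;> omega
  refine Runs.mono (Runs.seq hu (T₁ := 1) (T₂ := (S * (4 * n + 23 * ℓ + 9 + 3) + 3) + 6 + 1)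
    (Runs.assign hu (by decide) (fun _ => Nat.zero_le _) ?_)) (le_of_eq (by ring))
  refine Runs.seq hu (T₁ := S * (4 * n + 23 * ℓ + 9 + 3) + 3) (T₂ := 6) ?_
  refine Runs.for hu (by decide) S (by omega) (fun j s' =>
    Frame [11, 15, 16, 17, 18, 19, 20, 21] [4] s s' ∧ (∀ k, n ≤ k → s'.arr 4 k = 0) ∧
      s'.var 16 = j ∧ s'.var 15 = c j) ?_ ?_ ?_ ?_
  · exact ⟨(Frame.refl.setVar (by simp)).setVar (by simp), h4, by simp, by simp [hc, Expr.eval]⟩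
  · rintro j s' ⟨hf, -, h16, -⟩
    exact ⟨h16, (hf.1 5 (by decide)).trans h5⟩
  · rintro j s' hj ⟨hf, h4', h16, h15⟩
    refine (runs_sampleCmd (j := j) (S := S) (ℓ := ℓ) (i := i) (ω := ω) (B := B)
      (K := initialPart B i) hu hn hℓ
      ((hf.1 0 (by decide)).trans h0) ((hf.1 5 (by decide)).trans h5)
      ((hf.1 6 (by decide)).trans h6) ((hf.1 12 (by decide)).trans h12)
      h16 ((hf.2 2 (by decide)).trans h2) ((hf.2 3 (by decide)).trans h3)
      ((hf.2 5 (by decide)).trans h5') h4' (by have := hcle j; omega)).imp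
      fun s'' hs'' => ⟨?_, ?_, hs''.2.1, by simp, ?_⟩
    · rw [hs''.1.1 16 (by decide), h16]
    · exact (hf.trans hs''.1 (by simp) (by simp)).setVar (by simp)
    · simp only [Store.var_setVar]
      rw [if_neg (by decide), hs''.2.2, h15]
      simp only [hc, sum_range_succ]
  rintro s₁ ⟨hf₁, h4₁, -, h15₁⟩
  have hcS : c S = sampleCount M B S ℓ ω i := rfl
  have hF : Frame [11, 13, 14, 15, 16, 17, 18, 19, 20, 21] [4, 5] s s₁ :=
    Frame.refl.trans hf₁ (by simp) (by simp)
  have hg : (Expr.get 3 (.var 12)).eval s₁ = if i ∈ B then 1 else 0 := by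
    simp only [Expr.eval, hf₁.1 12 (by decide), h12, hf₁.2 3 (by decide), h3, indicator_apply]
  by_cases hi : i ∈ B
  · refine Runs.ite_true hu (by decide) (by simp [hg, hi]) ?_
    refine Runs.seq hu (T₁ := 1) (T₂ := 3) (Runs.assign hu (by decide) (fun _ => ?_) ?_)
    · simpa only [Expr.eval, hf₁.1 13 (by decide), hf₁.1 5 (by decide), h5] using h13
    refine Runs.seq hu (T₁ := 1) (T₂ := 1) (Runs.assign hu (by decide) (fun _ => ?_) ?_)
    · simp [Expr.eval, hf₁.1 14 (by decide), h15₁]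
      exact (Nat.mul_le_mul_left _ (hcle S)).trans h14
    refine Runs.write hu (by decide) (by decide) (fun _ => ?_) ⟨?_, ?_, ?_, ?_, ?_⟩
    · simp [Expr.eval]; omega
    · exact ((hF.setVar (by simp)).setVar (by simp)).setArr (by simp)
    · exact h4₁
    · rw [initialPart_succ_of_mem hi, ← indicator_insert]
      simp [Expr.eval, hf₁.1 12 (by decide), h12, hf₁.2 5 (by decide), h5']
    · simp [Expr.eval, hf₁.1 13 (by decide), hf₁.1 5 (by decide), h5, hi]
    · simp [Expr.eval, hf₁.1 14 (by decide), h15₁, hi, hcS]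
  · refine Runs.mono (Runs.ite_false hu (by decide) (by simp [hg, hi])
      (Runs.skip hu ⟨hF, h4₁, ?_, ?_, ?_⟩)) (by norm_num)
    · rw [initialPart_succ_of_notMem hi, hf₁.2 5 (by decide), h5']
    · simp [hf₁.1 13 (by decide), hi]
    · simp [hf₁.1 14 (by decide), hi]

theorem prod_initialPart_succ {B : Finset (Fin n)} (i : Fin n) (f : Fin n → ℕ) :
    ∏ b ∈ initialPart B (i + 1), f b
      = (∏ b ∈ initialPart B i, f b) * if i ∈ B then f i else 1 := by
  by_cases hi : i ∈ B
  · rw [initialPart_succ_of_mem hi, prod_insert (notMem_initialPart B i), if_pos hi, mul_comm]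
  · rw [initialPart_succ_of_notMem hi, if_neg hi, mul_one]

theorem sampleCount_le (B : Finset (Fin n)) (S ℓ : ℕ) (ω : ℕ → ℕ) (i : Fin n) :
    sampleCount M B S ℓ ω i ≤ S := by
  refine (sum_le_card_nsmul _ _ 1 fun j _ => ?_).trans (by simp)
  split_ifs <;> omega

theorem runs_estimateCmd (hu : 64 ≤ u) (hn : 2 ^ n ≤ u) {s : Store} {S ℓ : ℕ}
    {ω : ℕ → ℕ} {B : Finset (Fin n)} (hℓ : ℓ ≤ u) (hS : (S + 1) ^ (n + 1) ≤ u) (h0 : s.var 0 = n)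
    (h5 : s.var 5 = S) (h6 : s.var 6 = ℓ) (h2 : s.arr 2 = ω)
    (h3 : s.arr 3 = indicator B) (h5' : s.arr 5 = fun _ => 0) (h4 : s.arr 4 = fun _ => 0) :
    Runs M.Indep u estimateCmd s (n * (S * (4 * n + 23 * ℓ + 12) + 15) + 11) fun s' =>
      (s'.var 0 : ℝ) / (s'.var 1 : ℝ) = estimate M B S ℓ ω := by
  have hnu : n ≤ u := Nat.lt_two_pow_self.le.trans hn
  have hS1 : S + 1 ≤ u := (Nat.le_self_pow (by omega) _).trans hS
  have hprod : ∀ (m : ℕ) (f : Fin n → ℕ), (∀ b, f b ≤ S) →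
      (∏ b ∈ initialPart B m, f b) * S ≤ u := by
    intro m f hf
    have h1 : ∏ b ∈ initialPart B m, f b ≤ (S + 1) ^ n := by
      refine (prod_le_pow_card _ _ (S + 1) fun b _ => (hf b).trans (Nat.le_succ _)).trans ?_
      refine Nat.pow_le_pow_right (Nat.succ_pos _) ?_
      simpa using card_le_univ (initialPart B m)
    refine le_trans ?_ hS
    rw [pow_succ]
    exact Nat.mul_le_mul h1 (Nat.le_succ _)
  refine Runs.mono (Runs.seq hu (T₁ := 1)
    (T₂ := 1 + ((n * (S * (4 * n + 23 * ℓ + 12) + 12 + 3) + 3) + 3 + 1) + 1)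
    (Runs.assign hu (by decide) (fun _ => ?_) ?_)) (le_of_eq (by ring))
  · simp [Expr.eval]; omega
  refine Runs.seq hu (T₁ := 1) (T₂ := (n * (S * (4 * n + 23 * ℓ + 12) + 12 + 3) + 3) + 3 + 1)
    (Runs.assign hu (by decide) (fun _ => ?_) ?_)
  · simp [Expr.eval]; omega
  refine Runs.seq hu (T₁ := n * (S * (4 * n + 23 * ℓ + 12) + 12 + 3) + 3) (T₂ := 3) ?_
  refine Runs.for hu (by decide) n hnu (fun i s' =>
    Frame [11, 12, 13, 14, 15, 16, 17, 18, 19, 20, 21] [4, 5] s s' ∧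
      (∀ k, n ≤ k → s'.arr 4 k = 0) ∧ s'.arr 5 = indicator (initialPart B i) ∧ s'.var 12 = i ∧
      s'.var 13 = ∏ _b ∈ initialPart B i, S ∧
      s'.var 14 = ∏ b ∈ initialPart B i, sampleCount M B S ℓ ω b) ?_ ?_ ?_ ?_
  · refine ⟨((Frame.refl.setVar (by simp)).setVar (by simp)).setVar (by simp), ?_, ?_, by simp,
      ?_, ?_⟩
    · intro k _; simp [h4]
    · simp [h5', initialPart_zero, indicator_empty]
    · simp [initialPart_zero, Expr.eval]
    · simp [initialPart_zero, Expr.eval]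
  · rintro i s' ⟨hf, -, -, h12, -⟩
    exact ⟨h12, (hf.1 0 (by decide)).trans h0⟩
  · rintro i s' hi ⟨hf, h4', h5'', h12, h13, h14⟩
    refine (runs_elementCmd (i := ⟨i, hi⟩) (S := S) (ℓ := ℓ) (ω := ω) (B := B) hu hn hℓ hS1
      ((hf.1 0 (by decide)).trans h0) ((hf.1 5 (by decide)).trans h5)
      ((hf.1 6 (by decide)).trans h6) h12 ((hf.2 2 (by decide)).trans h2)
      ((hf.2 3 (by decide)).trans h3) h5'' h4' ?_ ?_).imp
      fun s'' hs'' => ⟨?_, ?_, hs''.2.1, hs''.2.2.1, by simp, ?_, ?_⟩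
    · rw [h13]; exact hprod i (fun _ => S) fun _ => le_rfl
    · rw [h14]; exact hprod i _ fun b => sampleCount_le B S ℓ ω b
    · rw [hs''.1.1 12 (by decide), h12]
    · exact (hf.trans hs''.1 (by simp) (by simp)).setVar (by simp)
    · simp only [Store.var_setVar]
      rw [if_neg (by decide), hs''.2.2.2.1, h13]
      exact (prod_initialPart_succ (B := B) ⟨i, hi⟩ fun _ => S).symm
    · simp only [Store.var_setVar]
      rw [if_neg (by decide), hs''.2.2.2.2, h14]
      exact (prod_initialPart_succ (B := B) ⟨i, hi⟩ _).symm
  rintro s₁ ⟨-, -, -, -, h13, h14⟩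
  rw [initialPart_card] at h13 h14
  refine Runs.seq hu (T₁ := 1) (T₂ := 1) (Runs.assign hu (by decide) (fun hs => hs.1 _) ?_)
  refine Runs.assign hu (by decide) (fun hs => hs.1 _) ?_
  simp only [Expr.eval, Store.var_setVar]
  norm_num [h13, h14, estimate]

end Correctness

end OracleRAM

/-! ### Coin tosses and the computation of the parameters -/

section CoinDistribution

/-- The distribution of an array of zeros in which the results of `N` fair coin tosses have been
stored. -/
noncomputable def coinPMF : ℕ → PMF (ℕ → ℕ)
  | 0 => PMF.pure fun _ => 0
  | N + 1 => (coinPMF N).bind fun ω =>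
      (PMF.uniformOfFintype Bool).map fun b => Function.update ω N b.toNat

open scoped ENNReal

theorem PMF.tsum_bind_mul {α β : Type*} (p : PMF α) (f : α → PMF β) (g : β → ℝ≥0∞) :
    ∑' b, (p.bind f) b * g b = ∑' a, p a * ∑' b, f a b * g b := by
  simp only [PMF.bind_apply, ← ENNReal.tsum_mul_right, ← ENNReal.tsum_mul_left]
  rw [ENNReal.tsum_comm]
  exact tsum_congr fun a => tsum_congr fun b => mul_assoc _ _ _

theorem PMF.tsum_pure_mul {α : Type*} (a : α) (g : α → ℝ≥0∞) :
    ∑' b, (PMF.pure a) b * g b = g a := by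
  rw [tsum_eq_single a fun b hb => by simp [PMF.pure_apply, hb]]
  simp

theorem PMF.bind_congr_of_support {α β : Type*} (p : PMF α) {f g : α → PMF β}
    (h : ∀ a ∈ p.support, f a = g a) : p.bind f = p.bind g := by
  ext b
  simp only [PMF.bind_apply]
  refine tsum_congr fun a => ?_
  by_cases ha : p a = 0
  · simp [ha]
  · rw [h a ((PMF.mem_support_iff _ _).2 ha)]

/-- Expectations with respect to `coinPMF` are computed by `flipAvg`. -/
theorem tsum_coinPMF_mul (N : ℕ) (F : (ℕ → ℕ) → ℝ) (hF : ∀ ω, 0 ≤ F ω) :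
    ∑' ω, coinPMF N ω * ENNReal.ofReal (F ω) = ENNReal.ofReal (flipAvg N F) := by
  induction N generalizing F with
  | zero => exact PMF.tsum_pure_mul _ fun ω => ENNReal.ofReal (F ω)
  | succ N ih =>
    rw [coinPMF, PMF.tsum_bind_mul, flipAvg, ← ih _ fun ω =>
      div_nonneg (add_nonneg (hF _) (hF _)) zero_le_two]
    refine tsum_congr fun ω => ?_
    congr 1
    rw [← PMF.bind_pure_comp, PMF.tsum_bind_mul, tsum_bool]
    simp only [Function.comp_apply, PMF.tsum_pure_mul (g := fun ω => ENNReal.ofReal (F ω)),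
      PMF.uniformOfFintype_apply, Fintype.card_bool, Bool.toNat_true, Bool.toNat_false]
    rw [← mul_add, ← ENNReal.ofReal_add (hF _) (hF _), div_eq_inv_mul,
      ENNReal.ofReal_mul (by norm_num), ENNReal.ofReal_inv_of_pos (by norm_num)]
    norm_num

theorem toOuterMeasure_coinPMF (N : ℕ) (A : Set (ℕ → ℕ)) :
    (coinPMF N).toOuterMeasure A
      = ENNReal.ofReal (flipAvg N fun ω => open Classical in if ω ∈ A then 1 else 0) := by
  classical
  rw [← tsum_coinPMF_mul N _ fun ω => by split_ifs <;> norm_num, PMF.toOuterMeasure_apply]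
  refine tsum_congr fun ω => ?_
  by_cases h : ω ∈ A <;> simp [h]

end CoinDistribution

namespace OracleRAM

section Digits

theorem binDigit_le_one (x : ℝ) (i : ℕ) : binDigit x i ≤ 1 := by unfold binDigit; omega

/-- The first nonzero binary digit determines a number up to a factor of two. -/
theorem exists_first_binDigit {x : ℝ} (h0 : 0 < x) (h1 : x < 1) :
    ∃ k, binDigit x k = 1 ∧ (∀ i < k, binDigit x i = 0) ∧ 1 ≤ x * 2 ^ (k + 1) ∧ x * 2 ^ k < 1 := by
  have hex : ∃ k : ℕ, 1 ≤ x * 2 ^ (k + 1) := by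
    obtain ⟨m, hm⟩ := pow_unbounded_of_one_lt (1 / x) (one_lt_two (α := ℝ))
    refine ⟨m, ?_⟩
    rw [div_lt_iff₀ h0] at hm
    have : (2 : ℝ) ^ (m + 1) = 2 ^ m * 2 := pow_succ _ _
    nlinarith [pow_pos (two_pos (α := ℝ)) m]
  classical
  have hlt : ∀ i < Nat.find hex, x * 2 ^ (i + 1) < 1 := fun i hi => not_le.1 (Nat.find_min hex hi)
  have hk := Nat.find_spec hex
  set k := Nat.find hex with hkdef
  have hk' : x * 2 ^ k < 1 := by
    rcases Nat.eq_zero_or_pos k with h | h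
    · rw [h]; simpa using h1
    · obtain ⟨j, hj⟩ := Nat.exists_eq_succ_of_ne_zero h.ne'
      rw [hj]; exact hlt j (by omega)
  refine ⟨k, ?_, fun i hi => ?_, hk, hk'⟩
  · have : ⌊x * 2 ^ (k + 1)⌋₊ = 1 := by
      rw [Nat.floor_eq_iff (by positivity)]
      refine ⟨by exact_mod_cast hk, ?_⟩
      rw [pow_succ]; push_cast; linarith
    rw [binDigit, this]
  · have : ⌊x * 2 ^ (i + 1)⌋₊ = 0 := Nat.floor_eq_zero.2 (hlt i hi)
    rw [binDigit, this]

end Digits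

section Parameters
variable {n : ℕ} {M : Matroid (Fin n)} {u : ℕ}

/-- Compute the parameters of the algorithm and a greedy base. -/
def prepareCmd : Cmd :=
  .seq (.assign 3 (.const 2))
    (.seq (.loop (.sub (.const 1) (.get 0 (.var 2)))
      (.seq (.assign 2 (.add (.var 2) (.const 1))) (.assign 3 (.mul (.var 3) (.const 2)))))
    (.seq (.loop (.sub (.const 1) (.get 1 (.var 4))) (.assign 4 (.add (.var 4) (.const 1))))
    (.seq (.assign 5 (.mul (.mul (.mul (.const 64)
        (.mul (.mul (.var 0) (.var 0)) (.mul (.var 0) (.var 0)))) (.mul (.var 3) (.var 3)))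
        (.add (.add (.var 0) (.var 4)) (.const 2))))
    (.seq (.assign 6 (.mul (.mul (.mul (.const 2)
        (.mul (.mul (.var 0) (.var 0)) (.mul (.var 0) (.var 0))))
        (.add (.var 0) (.add (.add (.const 4) (.mul (.const 4) (.var 0)))
          (.mul (.const 2) (.var 3))))) (.mul (.var 0) (.var 0))))
    (.seq (.assign 7 (.mul (.mul (.var 0) (.var 5)) (.var 6))) greedyCmd)))))

theorem runs_prepareCmd (hM : M.E = Set.univ) (hu : 64 ≤ u) (hn : 2 ^ n ≤ u) {s : Store}
    {e d : ℕ} (h0 : s.var 0 = n) (h2 : s.var 2 = 0) (h4 : s.var 4 = 0)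
    (h3 : s.arr 3 = fun _ => 0) (he : s.arr 0 e = 1) (he' : ∀ i < e, s.arr 0 i = 0)
    (hd : s.arr 1 d = 1) (hd' : ∀ i < d, s.arr 1 i = 0) (heu : 2 ^ (e + 1) ≤ u) (hdu : d ≤ u)
    (hSu : numSamples n (2 ^ (e + 1)) d ≤ u) (hℓu : numMoves n (2 ^ (e + 1)) ≤ u)
    (hNu : n * numSamples n (2 ^ (e + 1)) d * numMoves n (2 ^ (e + 1)) ≤ u) :
    Runs M.Indep u prepareCmd s (4 * e + 2 * d + 10 * n + 15) fun s' =>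
      Frame [2, 3, 4, 5, 6, 7, 10, 11] [3] s s' ∧ s'.var 5 = numSamples n (2 ^ (e + 1)) d ∧
      s'.var 6 = numMoves n (2 ^ (e + 1)) ∧
      s'.var 7 = n * numSamples n (2 ^ (e + 1)) d * numMoves n (2 ^ (e + 1)) ∧
      ∃ B : Finset (Fin n), M.IsBase (B : Set (Fin n)) ∧ s'.arr 3 = indicator B := by
  refine Runs.mono (Runs.seq hu (T₁ := 1) (T₂ := (e * (3 + 1) + 1) + ((d * (1 + 1) + 1) +
    (1 + (1 + (1 + (n * 10 + 3) + 1) + 1) + 1) + 1) + 1)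
    (Runs.assign hu (by decide) (fun _ => by simp [Expr.eval]; omega) ?_)) (le_of_eq (by ring))
  refine Runs.seq hu (T₁ := e * (3 + 1) + 1) (T₂ := (d * (1 + 1) + 1) +
    (1 + (1 + (1 + (n * 10 + 3) + 1) + 1) + 1) + 1) ?_
  refine Runs.loop hu (by decide) e (fun i s' => Frame [2, 3] [] s s' ∧ s'.var 2 = i ∧
    s'.var 3 = 2 ^ (i + 1)) ?_ ?_ ?_ ?_ ?_
  · exact ⟨Frame.refl.setVar (by simp), by simp [h2], by simp [Expr.eval]⟩
  · rintro i s' hi ⟨hf, h2', -⟩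
    simp [Expr.eval, h2', hf.2 0 (by decide), he' i hi]
  · rintro s' ⟨hf, h2', -⟩
    simp [Expr.eval, h2', hf.2 0 (by decide), he]
  · rintro i s' hi ⟨hf, h2', h3'⟩
    have hp : 2 ^ (i + 1 + 1) ≤ u :=
      (Nat.pow_le_pow_right (by norm_num) (by omega)).trans heu
    have hi' : i + 1 < 2 ^ (i + 1) := Nat.lt_two_pow_self
    have hp' : 2 ^ (i + 1 + 1) = 2 ^ (i + 1) * 2 := pow_succ _ _
    refine Runs.seq hu (T₁ := 1) (T₂ := 1) (Runs.assign hu (by decide) (fun _ => ?_) ?_)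
    · simp only [Expr.eval, h2']; omega
    refine Runs.assign hu (by decide) (fun _ => ?_)
      ⟨(hf.setVar (by simp)).setVar (by simp), ?_, ?_⟩
    · simp [Expr.eval, h3']; omega
    · simp [Expr.eval, h2']
    · simp [Expr.eval, h3', hp']
  rintro s₁ ⟨hf₁, -, h3₁⟩
  refine Runs.seq hu (T₁ := d * (1 + 1) + 1) (T₂ := 1 + (1 + (1 + (n * 10 + 3) + 1) + 1) + 1) ?_
  refine Runs.loop hu (by decide) d (fun i s' => Frame [2, 3, 4] [] s s' ∧ s'.var 4 = i ∧
    s'.var 3 = 2 ^ (e + 1)) ?_ ?_ ?_ ?_ ?_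
  · refine ⟨Frame.refl.trans hf₁ (by simp) (by simp), ?_, h3₁⟩
    rw [hf₁.1 4 (by decide), h4]
  · rintro i s' hi ⟨hf, h4', -⟩
    simp [Expr.eval, h4', hf.2 1 (by decide), hd' i hi]
  · rintro s' ⟨hf, h4', -⟩
    simp [Expr.eval, h4', hf.2 1 (by decide), hd]
  · rintro i s' hi ⟨hf, h4', h3'⟩
    refine Runs.assign hu (by decide) (fun _ => ?_) ⟨hf.setVar (by simp), ?_, ?_⟩
    · simp only [Expr.eval, h4']; omega
    · simp [Expr.eval, h4']
    · simp [h3']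
  rintro s₂ ⟨hf₂, h4₂, h3₂⟩
  have h0₂ : s₂.var 0 = n := (hf₂.1 0 (by decide)).trans h0
  have hS : (Expr.mul (.mul (.mul (.const 64)
        (.mul (.mul (.var 0) (.var 0)) (.mul (.var 0) (.var 0)))) (.mul (.var 3) (.var 3)))
        (.add (.add (.var 0) (.var 4)) (.const 2))).eval s₂ = numSamples n (2 ^ (e + 1)) d := by
    simp only [Expr.eval, h0₂, h3₂, h4₂, numSamples]; ring
  refine Runs.seq hu (T₁ := 1) (T₂ := 1 + (1 + (n * 10 + 3) + 1) + 1)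
    (Runs.assign hu (by decide) (fun _ => by rwa [hS]) ?_)
  rw [hS]
  have hℓ : (Expr.mul (.mul (.mul (.const 2)
        (.mul (.mul (.var 0) (.var 0)) (.mul (.var 0) (.var 0))))
        (.add (.var 0) (.add (.add (.const 4) (.mul (.const 4) (.var 0)))
          (.mul (.const 2) (.var 3))))) (.mul (.var 0) (.var 0))).eval
        (s₂.setVar 5 (numSamples n (2 ^ (e + 1)) d)) = numMoves n (2 ^ (e + 1)) := by
    have h0' : (s₂.setVar 5 (numSamples n (2 ^ (e + 1)) d)).var 0 = n := by simp [h0₂]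
    have h3' : (s₂.setVar 5 (numSamples n (2 ^ (e + 1)) d)).var 3 = 2 ^ (e + 1) := by simp [h3₂]
    simp only [Expr.eval, h0', h3', numMoves]; ring
  refine Runs.seq hu (T₁ := 1) (T₂ := 1 + (n * 10 + 3) + 1)
    (Runs.assign hu (by decide) (fun _ => by rwa [hℓ]) ?_)
  rw [hℓ]
  refine Runs.seq hu (T₁ := 1) (T₂ := n * 10 + 3) (Runs.assign hu (by decide) (fun _ => ?_) ?_)
  · simpa [Expr.eval, h0₂] using hNu
  refine (runs_greedyCmd hM hu hn ?_ ?_).imp fun s' hs' => ⟨?_, ?_, ?_, ?_, hs'.2⟩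
  · simp [h0₂]
  · simp [hf₂.2 3 (by decide), h3]
  · refine Frame.trans ?_ hs'.1 (by simp) (by simp)
    exact (((Frame.refl.trans hf₂ (by simp) (by simp)).setVar (by simp)).setVar (by simp)).setVar
      (by simp)
  · rw [hs'.1.1 5 (by decide)]; simp
  · rw [hs'.1.1 6 (by decide)]; simp
  · rw [hs'.1.1 7 (by decide)]; simp [Expr.eval, h0₂]

end Parameters

section Flips
variable {n : ℕ} (oracle : Set (Fin n) → Prop) {u : ℕ}

/-- Toss as many coins as the variable `7` says, and store the results in the array `2`. -/
def flipCmd : Cmd :=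
  .loop (.sub (.var 7) (.var 8))
    (.seq (.flip 9) (.seq (.write 2 (.var 8) (.var 9)) (.assign 8 (.add (.var 8) (.const 1)))))

/-- The store after one iteration of the tossing loop with the result `b`. -/
def flipStore (s : Store) (b : Bool) : Store :=
  ((s.setVar 9 b.toNat).setArr 2 (s.var 8) b.toNat).setVar 8 (s.var 8 + 1)

/-- One iteration of the tossing loop takes six steps of the machine, whatever the outcome. -/
theorem run_flipCmd_iteration {s : Store} (hs : s.var 8 < s.var 7) (hu : 64 ≤ u)
    (hb : s.Bounded u) :
    ∃ τ : Bool → ℕ, (∀ b, 6 ≤ τ b ∧ τ b ≤ 6 * timeUnit u) ∧ ∀ k t,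
      run oracle 6 ⟨flipCmd :: k, s, t⟩ = (PMF.uniformOfFintype Bool).map fun b =>
        ⟨flipCmd :: k, flipStore s b, t + τ b⟩ := by
  refine ⟨fun b => (1 + (Expr.sub (.var 7) (.var 8)).cost s) + 1 + 1 + 1
    + (1 + (Expr.var 8).cost (s.setVar 9 b.toNat) + (Expr.var 9).cost (s.setVar 9 b.toNat))
    + (1 + (Expr.add (.var 8) (.const 1)).cost ((s.setVar 9 b.toNat).setArr 2 (s.var 8) b.toNat)),
    fun b => ?_, fun k t => ?_⟩
  · have hb1 : (s.setVar 9 b.toNat).Bounded u := hb.setVar ((Bool.toNat_le b).trans (by omega))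
    have hb2 : ((s.setVar 9 b.toNat).setArr 2 (s.var 8) b.toNat).Bounded u :=
      hb1.setArr ((Bool.toNat_le b).trans (by omega))
    have h1 := Expr.Simple.cost_le hu hb (e := .sub (.var 7) (.var 8)) (by decide)
    have h2 := Expr.Simple.cost_le hu hb1 (e := .var 8) (by decide)
    have h3 := Expr.Simple.cost_le hu hb1 (e := .var 9) (by decide)
    have h4 := Expr.Simple.cost_le hu hb2 (e := .add (.var 8) (.const 1)) (by decide)
    have h5 := one_le_size hu
    unfold timeUnit
    constructor <;> simp only <;> omega
  · have hguard : (Expr.sub (.var 7) (.var 8)).eval s ≠ 0 := by simp only [Expr.eval]; omega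
    have hstep : ∀ m, run oracle (m + 3) ⟨flipCmd :: k, s, t⟩
        = (PMF.uniformOfFintype Bool).bind fun b => run oracle m
          ⟨Cmd.seq (.write 2 (.var 8) (.var 9)) (.assign 8 (.add (.var 8) (.const 1))) ::
            flipCmd :: k, s.setVar 9 b.toNat,
            t + (1 + (Expr.sub (.var 7) (.var 8)).cost s) + 1 + 1⟩ := by
      intro m
      simp only [flipCmd, run, step, PMF.pure_bind, if_pos hguard, PMF.bind_map]
      rfl
    rw [hstep 3, ← PMF.bind_pure_comp]
    congr 1
    ext1 b
    have e8 : (Expr.var 8).eval (s.setVar 9 b.toNat) = s.var 8 := by simp [Expr.eval]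
    have e9 : (Expr.var 9).eval (s.setVar 9 b.toNat) = b.toNat := by simp [Expr.eval]
    have e10 : (Expr.add (.var 8) (.const 1)).eval
        ((s.setVar 9 b.toNat).setArr 2 (s.var 8) b.toNat) = s.var 8 + 1 := by simp [Expr.eval]
    simp only [run, step, PMF.pure_bind, Function.comp_apply, e8, e9, e10, flipStore]
    congr 2
    ring

/-- After `j` iterations of the tossing loop the coins are distributed as `coinPMF j`. The
distribution `D` couples the coins with the store and the time. -/
theorem run_flipCmd_iterate {s : Store} {N : ℕ} (hu : 64 ≤ u) (hb : s.Bounded u) (hN : N ≤ u)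
    (h7 : s.var 7 = N) (h8 : s.var 8 = 0) (h2 : s.arr 2 = fun _ => 0) (k : List Cmd) (t : ℕ)
    (j : ℕ) (hj : j ≤ N) :
    ∃ D : PMF ((ℕ → ℕ) × Store × ℕ), D.map Prod.fst = coinPMF j ∧
      run oracle (6 * j) ⟨flipCmd :: k, s, t⟩
        = D.map (fun p => ⟨flipCmd :: k, p.2.1, t + p.2.2⟩) ∧
      ∀ p ∈ D.support, Frame [8, 9] [2] s p.2.1 ∧ p.2.1.var 8 = j ∧ p.2.1.arr 2 = p.1 ∧
        p.2.1.Bounded u ∧ 6 * j ≤ p.2.2 ∧ p.2.2 ≤ 6 * j * timeUnit u := by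
  induction j with
  | zero =>
    refine ⟨PMF.pure (fun _ => 0, s, 0), ?_, ?_, ?_⟩
    · rw [PMF.pure_map]; rfl
    · rw [PMF.pure_map]; rfl
    · intro p hp
      rw [PMF.support_pure, Set.mem_singleton_iff] at hp
      subst hp
      exact ⟨Frame.refl, h8, h2, hb, by simp, by simp⟩
  | succ j ih =>
    obtain ⟨D, hD1, hD2, hD3⟩ := ih (by omega)
    have hτ : ∀ s' : Store, ∃ τ : Bool → ℕ, s'.var 8 < s'.var 7 → s'.Bounded u →
        (∀ b, 6 ≤ τ b ∧ τ b ≤ 6 * timeUnit u) ∧ ∀ k t,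
          run oracle 6 ⟨flipCmd :: k, s', t⟩ = (PMF.uniformOfFintype Bool).map fun b =>
            ⟨flipCmd :: k, flipStore s' b, t + τ b⟩ := by
      intro s'
      by_cases h : s'.var 8 < s'.var 7 ∧ s'.Bounded u
      · obtain ⟨τ, hτ⟩ := run_flipCmd_iteration oracle h.1 hu h.2
        exact ⟨τ, fun _ _ => hτ⟩
      · exact ⟨fun _ => 0, fun h1 h2 => absurd ⟨h1, h2⟩ h⟩
    choose τ hτ using hτ
    have hτ' : ∀ p ∈ D.support, (∀ b, 6 ≤ τ p.2.1 b ∧ τ p.2.1 b ≤ 6 * timeUnit u) ∧ ∀ k t,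
        run oracle 6 ⟨flipCmd :: k, p.2.1, t⟩ = (PMF.uniformOfFintype Bool).map fun b =>
          ⟨flipCmd :: k, flipStore p.2.1 b, t + τ p.2.1 b⟩ := by
      intro p hp
      obtain ⟨hf, h8', -, hb', -⟩ := hD3 p hp
      refine hτ p.2.1 ?_ hb'
      rw [h8', hf.1 7 (by decide), h7]; omega
    refine ⟨D.bind fun p => (PMF.uniformOfFintype Bool).map fun b =>
      (Function.update p.1 j b.toNat, flipStore p.2.1 b, p.2.2 + τ p.2.1 b), ?_, ?_, ?_⟩
    · rw [coinPMF, ← hD1, PMF.map_bind, PMF.bind_map]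
      congr 1
      ext1 p
      rw [PMF.map_comp]
      rfl
    · rw [Nat.mul_succ, run_add, hD2, PMF.bind_map, PMF.map_bind]
      refine PMF.bind_congr_of_support D fun p hp => ?_
      rw [Function.comp_apply, (hτ' p hp).2, PMF.map_comp]
      congr 1
      ext1 b
      simp only [Function.comp_apply, add_assoc]
    · intro q hq
      rw [PMF.mem_support_bind_iff] at hq
      obtain ⟨p, hp, hq⟩ := hq
      rw [PMF.mem_support_map_iff] at hq
      obtain ⟨b, -, rfl⟩ := hq
      obtain ⟨hf, h8', h2', hb', ht, ht'⟩ := hD3 p hp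
      have hτb := (hτ' p hp).1 b
      have hbu : b.toNat ≤ u := (Bool.toNat_le b).trans (by omega)
      refine ⟨?_, ?_, ?_, ?_, ?_, ?_⟩
      · exact ((hf.setVar (by simp)).setArr (by simp)).setVar (by simp)
      · simp [flipStore, h8']
      · simp [flipStore, h8', h2']
      · exact ((hb'.setVar hbu).setArr hbu).setVar (by rw [h8']; omega)
      · simp only; omega
      · simp only
        rw [Nat.mul_succ, add_mul]
        omega

/-- The whole tossing loop. -/
theorem run_flipCmd {s : Store} {N : ℕ} (hu : 64 ≤ u) (hb : s.Bounded u) (hN : N ≤ u)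
    (h7 : s.var 7 = N) (h8 : s.var 8 = 0) (h2 : s.arr 2 = fun _ => 0) (k : List Cmd) (t : ℕ) :
    ∃ D : PMF ((ℕ → ℕ) × Store × ℕ), D.map Prod.fst = coinPMF N ∧
      run oracle (6 * N + 1) ⟨flipCmd :: k, s, t⟩ = D.map (fun p => ⟨k, p.2.1, t + p.2.2⟩) ∧
      ∀ p ∈ D.support, Frame [8, 9] [2] s p.2.1 ∧ p.2.1.arr 2 = p.1 ∧
        p.2.1.Bounded u ∧ 6 * N + 1 ≤ p.2.2 ∧ p.2.2 ≤ (6 * N + 1) * timeUnit u := by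
  obtain ⟨D, hD1, hD2, hD3⟩ := run_flipCmd_iterate oracle hu hb hN h7 h8 h2 k t N le_rfl
  refine ⟨D.map fun p => (p.1, p.2.1, p.2.2 + (1 + (Expr.sub (.var 7) (.var 8)).cost p.2.1)),
    ?_, ?_, ?_⟩
  · rw [PMF.map_comp, ← hD1]; rfl
  · rw [run_add, hD2, PMF.bind_map, PMF.map_comp, ← PMF.bind_pure_comp]
    refine PMF.bind_congr_of_support D fun p hp => ?_
    obtain ⟨hf, h8', -⟩ := hD3 p hp
    have hguard : (Expr.sub (.var 7) (.var 8)).eval p.2.1 = 0 := by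
      simp only [Expr.eval, h8', hf.1 7 (by decide), h7]; omega
    simp only [Function.comp_apply, flipCmd, run, step, PMF.bind_pure, hguard, ne_eq,
      not_true_eq_false, if_false, add_assoc]
  · intro q hq
    rw [PMF.mem_support_map_iff] at hq
    obtain ⟨p, hp, rfl⟩ := hq
    obtain ⟨hf, -, h2', hb', ht, ht'⟩ := hD3 p hp
    have h1 := Expr.Simple.cost_le hu hb' (e := .sub (.var 7) (.var 8)) (by decide)
    have h5 := one_le_size hu
    refine ⟨hf, h2', hb', ?_, ?_⟩
    · simp only; omega
    · simp only
      rw [add_mul, one_mul]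
      have : 1 + (Expr.sub (.var 7) (.var 8)).cost p.2.1 ≤ timeUnit u := by unfold timeUnit; omega
      omega

end Flips

end OracleRAM

/-! ### Correctness and running time of the whole program -/

namespace OracleRAM

section Final

/-- The algorithm: prepare the parameters and a base, toss the coins, compute the estimate. -/
def countBasesCmd : Cmd := .seq prepareCmd (.seq flipCmd estimateCmd)

theorem run_deterministic {n : ℕ} {oracle : Set (Fin n) → Prop} {c : Cmd} {s s' : Store}
    {m t : ℕ} (h : ∀ k t₀, run oracle m ⟨c :: k, s, t₀⟩ = PMF.pure ⟨k, s', t₀ + t⟩) {R : ℕ}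
    (hR : m ≤ R) (t₀ : ℕ) : run oracle R ⟨[c], s, t₀⟩ = PMF.pure ⟨[], s', t₀ + t⟩ := by
  obtain ⟨R', rfl⟩ := Nat.exists_eq_add_of_le hR
  rw [run_add, h, PMF.pure_bind, run_halted]

/-- If `u` bounds all the numbers that occur, and `T` the time that follows from the lengths of the
loops, then the program halts in time `T` and its output is accurate with the required
probability. -/
theorem countBasesCmd_correct {n r : ℕ} {M : Matroid (Fin n)} (hM : M.E = Set.univ)
    (hr : M.eRank = (r : ℕ∞)) {ε δ : ℝ} (hε0 : 0 < ε) (hε1 : ε < 1) {e d u T : ℕ}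
    (he : binDigit ε e = 1) (he' : ∀ i < e, binDigit ε i = 0) (hE : 1 ≤ ε * 2 ^ (e + 1))
    (hd : binDigit δ d = 1) (hd' : ∀ i < d, binDigit δ i = 0) (hδ : 1 ≤ δ * 2 ^ (d + 1))
    (hu : 64 ≤ u) (hn : 2 ^ n ≤ u) (heu : 2 ^ (e + 1) ≤ u) (hdu : d ≤ u)
    (hSu : (numSamples n (2 ^ (e + 1)) d + 1) ^ (n + 1) ≤ u)
    (hℓu : numMoves n (2 ^ (e + 1)) ≤ u)
    (hNu : n * numSamples n (2 ^ (e + 1)) d * numMoves n (2 ^ (e + 1)) ≤ u)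
    (hT : (4 * e + 2 * d + 10 * n + 30
      + 6 * (n * numSamples n (2 ^ (e + 1)) d * numMoves n (2 ^ (e + 1)))
      + n * (numSamples n (2 ^ (e + 1)) d * (4 * n + 23 * numMoves n (2 ^ (e + 1)) + 12) + 15))
        * timeUnit u ≤ T) :
    HaltsInTime countBasesCmd M.Indep ε δ T ∧
      1 - δ ≤ outputProb countBasesCmd M.Indep ε δ T
        (Set.Icc ((1 - ε) * ({B : Set (Fin n) | M.IsBase B}.ncard : ℝ))
          ((1 + ε) * ({B : Set (Fin n) | M.IsBase B}.ncard : ℝ))) := by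
  classical
  set S := numSamples n (2 ^ (e + 1)) d with hS
  set ℓ := numMoves n (2 ^ (e + 1)) with hℓ
  set N := n * S * ℓ with hN
  have hunit := one_le_timeUnit hu
  set s₀ := (init countBasesCmd n ε δ).store with hs₀
  have hb₀ : s₀.Bounded u := by
    refine ⟨fun x => ?_, fun a i => ?_⟩
    · simp only [hs₀, init]
      split_ifs
      · exact Nat.lt_two_pow_self.le.trans hn
      · exact Nat.zero_le _
    · simp only [hs₀, init]
      split_ifs
      · exact (binDigit_le_one _ _).trans (by omega)
      · exact (binDigit_le_one _ _).trans (by omega)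
      · exact Nat.zero_le _
  have hS1 : S ≤ u := (Nat.le_succ S).trans ((Nat.le_self_pow (by omega) _).trans hSu)
  obtain ⟨s₁, m₁, t₁, hm₁, ht₁, hrun₁, hb₁, hf₁, h5₁, h6₁, h7₁, B, hB, h3₁⟩ :=
    runs_prepareCmd (M := M) (s := s₀) (e := e) (d := d) hM hu hn (by simp [hs₀, init])
      (by simp [hs₀, init]) (by simp [hs₀, init]) (by simp [hs₀, init])
      (by simpa [hs₀, init] using he) (by simpa [hs₀, init] using he')
      (by simpa [hs₀, init] using hd) (by simpa [hs₀, init] using hd') heu hdu hS1 hℓu hNu hb₀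
  obtain ⟨D, hD1, hD2, hD3⟩ := run_flipCmd M.Indep (N := N) hu hb₁ hNu h7₁
    (by rw [hf₁.1 8 (by decide)]; simp [hs₀, init])
    (by rw [hf₁.2 2 (by decide)]; simp [hs₀, init]) [estimateCmd] (1 + t₁ + 1)
  -- the deterministic last part, for every outcome of the coin tosses
  have hest : ∀ p : (ℕ → ℕ) × Store × ℕ, ∃ (s' : Store) (m t : ℕ), p ∈ D.support → m ≤ t ∧
      t ≤ (n * (S * (4 * n + 23 * ℓ + 12) + 15) + 11) * timeUnit u ∧
      (∀ k t₀, run M.Indep m ⟨estimateCmd :: k, p.2.1, t₀⟩ = PMF.pure ⟨k, s', t₀ + t⟩) ∧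
      (s'.var 0 : ℝ) / (s'.var 1 : ℝ) = estimate M B S ℓ p.1 := by
    intro p
    by_cases hp : p ∈ D.support
    · obtain ⟨hf, h2, hb, -⟩ := hD3 p hp
      obtain ⟨s', m, t, h1, h2, h3, -, h4⟩ := runs_estimateCmd (M := M) (B := B) (S := S) (ℓ := ℓ)
        (ω := p.1) hu hn hℓu hSu
        (by rw [hf.1 0 (by decide), hf₁.1 0 (by decide)]; simp [hs₀, init])
        ((hf.1 5 (by decide)).trans h5₁) ((hf.1 6 (by decide)).trans h6₁) h2
        ((hf.2 3 (by decide)).trans h3₁)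
        (by rw [hf.2 5 (by decide), hf₁.2 5 (by decide)]; simp [hs₀, init])
        (by rw [hf.2 4 (by decide), hf₁.2 4 (by decide)]; simp [hs₀, init]) hb
      exact ⟨s', m, t, fun _ => ⟨h1, h2, h3, h4⟩⟩
    · exact ⟨s₀, 0, 0, fun h => absurd h hp⟩
  choose fs fm ft hest using hest
  set fin : (ℕ → ℕ) × Store × ℕ → Config := fun p => ⟨[], fs p, 1 + t₁ + 1 + p.2.2 + ft p⟩ with hfin
  have hsum : (4 * e + 2 * d + 10 * n + 30 + 6 * N + n * (S * (4 * n + 23 * ℓ + 12) + 15))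
      * timeUnit u = (4 * e + 2 * d + 10 * n + 15) * timeUnit u + (6 * N + 1) * timeUnit u
        + (n * (S * (4 * n + 23 * ℓ + 12) + 15) + 11) * timeUnit u + 3 * timeUnit u := by ring
  have htime : ∀ p ∈ D.support, 1 + t₁ + 1 + p.2.2 + ft p ≤ T := by
    intro p hp
    have h1 := (hD3 p hp).2.2.2.2
    have h2 := (hest p hp).2.1
    omega
  have hrun : run M.Indep T (init countBasesCmd n ε δ) = D.map fin := by
    obtain ⟨p₀, hp₀⟩ := D.support_nonempty
    have hle : 1 + (m₁ + (1 + (6 * N + 1))) ≤ T := by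
      have h1 := htime p₀ hp₀
      have h2 := (hD3 p₀ hp₀).2.2.2.1
      omega
    obtain ⟨R, rfl⟩ := Nat.exists_eq_add_of_le hle
    have hinit : init countBasesCmd n ε δ = ⟨[countBasesCmd], s₀, 0⟩ := rfl
    have hfirst : run M.Indep (1 + (m₁ + (1 + (6 * N + 1)))) ⟨[countBasesCmd], s₀, 0⟩
        = D.map fun p => ⟨[estimateCmd], p.2.1, 1 + t₁ + 1 + p.2.2⟩ := by
      have hseq : ∀ c₁ c₂ k s t, run M.Indep 1 ⟨.seq c₁ c₂ :: k, s, t⟩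
          = PMF.pure ⟨c₁ :: c₂ :: k, s, t + 1⟩ := by
        intro c₁ c₂ k s t
        simp only [run, step, PMF.bind_pure]
      rw [countBasesCmd, run_add, hseq, PMF.pure_bind, run_add, hrun₁, PMF.pure_bind, run_add,
        hseq, PMF.pure_bind, zero_add, hD2]
    rw [hinit, run_add, hfirst, PMF.bind_map, ← PMF.bind_pure_comp]
    refine PMF.bind_congr_of_support D fun p hp => ?_
    rw [Function.comp_apply]
    refine run_deterministic (hest p hp).2.2.1 ?_ _
    have h1 := htime p hp
    have h2 := (hD3 p hp).2.2.2.1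
    have h3 := (hest p hp).1
    omega
  refine ⟨fun c hc => ?_, ?_⟩
  · rw [hrun, PMF.mem_support_map_iff] at hc
    obtain ⟨p, hp, rfl⟩ := hc
    exact ⟨rfl, htime p hp⟩
  · rw [ncard_isBase, outputProb, hrun]
    set I := Set.Icc ((1 - ε) * numBases M ∅) ((1 + ε) * numBases M ∅) with hI
    have hE' : 1 / ε ≤ ((2 ^ (e + 1) : ℕ) : ℝ) := by
      rw [div_le_iff₀ hε0, mul_comm]; exact_mod_cast hE
    have hsucc := estimate_success (d := d) hr hB hε0 hε1 hE'
    rw [← hS, ← hℓ, ← hN] at hsucc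
    have hmeas : ENNReal.ofReal (flipAvg N fun ω => if estimate M B S ℓ ω ∈ I then 1 else 0)
        ≤ (D.map fin).toOuterMeasure {c | c.Halted ∧ c.output ∈ I} := by
      have h1 := toOuterMeasure_coinPMF N {ω | estimate M B S ℓ ω ∈ I}
      refine le_trans (b := (coinPMF N).toOuterMeasure {ω | estimate M B S ℓ ω ∈ I})
        (le_of_eq (by convert h1.symm; exact Iff.rfl)) ?_
      rw [← hD1, PMF.toOuterMeasure_map_apply, PMF.toOuterMeasure_map_apply]
      refine PMF.toOuterMeasure_mono D ?_
      rintro p ⟨hp1, hp2⟩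
      refine ⟨rfl, ?_⟩
      have h2 := (hest p hp2).2.2.2
      simp only [Config.output, hfin]
      rw [h2]
      exact hp1
    have htop : (D.map fin).toOuterMeasure {c | c.Halted ∧ c.output ∈ I} ≠ ⊤ := by
      refine ne_top_of_le_ne_top ENNReal.one_ne_top ?_
      rw [PMF.toOuterMeasure_apply]
      calc _ ≤ ∑' c, (D.map fin) c := ENNReal.tsum_le_tsum fun c => Set.indicator_le_self _ _ c
        _ = 1 := PMF.tsum_coe _
    have hlow : flipAvg N (fun ω => if estimate M B S ℓ ω ∈ I then 1 else 0)
        ≤ ((D.map fin).toOuterMeasure {c | c.Halted ∧ c.output ∈ I}).toReal :=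
      (ENNReal.ofReal_le_iff_le_toReal htop).1 hmeas
    have hδ' : (1 / 2 : ℝ) ^ (d + 1) ≤ δ := by
      rw [one_div_pow, div_le_iff₀ (by positivity)]; exact hδ
    linarith

/-- The memory contents and the running time of the algorithm are bounded in terms of a single
parameter `v`: with `u = 2 ^ (9 * v ^ 2)` the time is at most `v ^ 30`. -/
theorem parameter_bounds {n e d v : ℕ} (hv : n + 2 ^ (e + 1) + d + 64 = v) :
    ∃ u, 64 ≤ u ∧ 2 ^ n ≤ u ∧ 2 ^ (e + 1) ≤ u ∧ d ≤ u ∧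
      (numSamples n (2 ^ (e + 1)) d + 1) ^ (n + 1) ≤ u ∧ numMoves n (2 ^ (e + 1)) ≤ u ∧
      n * numSamples n (2 ^ (e + 1)) d * numMoves n (2 ^ (e + 1)) ≤ u ∧
      (4 * e + 2 * d + 10 * n + 30
        + 6 * (n * numSamples n (2 ^ (e + 1)) d * numMoves n (2 ^ (e + 1)))
        + n * (numSamples n (2 ^ (e + 1)) d * (4 * n + 23 * numMoves n (2 ^ (e + 1)) + 12) + 15))
          * timeUnit u ≤ v ^ 30 := by
  have hev : e ≤ v := by
    have : e + 1 < 2 ^ (e + 1) := Nat.lt_two_pow_self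
    omega
  generalize 2 ^ (e + 1) = E at *
  have hv64 : 64 ≤ v := by omega
  have hv1 : 1 ≤ v := by omega
  have hnv : n ≤ v := by omega
  have hEv : E ≤ v := by omega
  have hdv : d ≤ v := by omega
  have hpow : ∀ {a b : ℕ}, a ≤ b → v ^ a ≤ v ^ b := fun h => Nat.pow_le_pow_right hv1 h
  have hvv : ∀ a b, b = a + 1 → 64 * v ^ a ≤ v ^ b := fun a b h => by
    rw [h, pow_succ, mul_comm]; exact Nat.mul_le_mul_left _ hv64
  have hS : numSamples n E d ≤ v ^ 8 := by
    calc numSamples n E d ≤ v * v ^ 4 * v ^ 2 * v := by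
          unfold numSamples; gcongr; omega
      _ = v ^ 8 := by ring
  have hℓ : numMoves n E ≤ v ^ 9 := by
    have h1 : n + (4 + 4 * n + 2 * E) ≤ 64 * v := by omega
    calc numMoves n E ≤ v * v ^ 4 * (64 * v) * (v * v) := by
          unfold numMoves; gcongr; omega
      _ ≤ v * v ^ 4 * (v * v) * (v * v) := by gcongr
      _ = v ^ 9 := by ring
  have hS1 : numSamples n E d + 1 ≤ v ^ 9 := by
    have := hvv 8 9 rfl
    have := Nat.one_le_pow 8 v hv1
    omega
  set S := numSamples n E d
  set ℓ := numMoves n E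
  have hN : n * S * ℓ ≤ v ^ 18 := by
    calc n * S * ℓ ≤ v * v ^ 8 * v ^ 9 := by gcongr
      _ = v ^ 18 := by ring
  have hv2 : v ≤ 2 ^ v := Nat.lt_two_pow_self.le
  have hvsq : 64 * v ≤ v ^ 2 := by have := hvv 1 2 rfl; simpa using this
  have hpow2 : ∀ {a}, a ≤ 9 * v ^ 2 → 2 ^ a ≤ 2 ^ (9 * v ^ 2) :=
    fun h => Nat.pow_le_pow_right (by norm_num) h
  have hsmall : ∀ {x}, x ≤ v → x ≤ 2 ^ (9 * v ^ 2) := fun h =>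
    (h.trans hv2).trans (hpow2 (by omega))
  refine ⟨2 ^ (9 * v ^ 2), hsmall hv64, hpow2 (by omega), hsmall hEv, hsmall hdv, ?_, ?_, ?_, ?_⟩
  · calc (S + 1) ^ (n + 1) ≤ (v ^ 9) ^ v := by
          refine (Nat.pow_le_pow_left hS1 _).trans
            (Nat.pow_le_pow_right (Nat.one_le_pow _ _ hv1) ?_)
          omega
      _ = v ^ (9 * v) := by rw [pow_mul]
      _ ≤ (2 ^ v) ^ (9 * v) := Nat.pow_le_pow_left hv2 _
      _ = 2 ^ (9 * v ^ 2) := by rw [← pow_mul]; congr 1; ring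
  · calc ℓ ≤ v ^ 9 := hℓ
      _ ≤ (2 ^ v) ^ 9 := Nat.pow_le_pow_left hv2 _
      _ = 2 ^ (9 * v) := by rw [← pow_mul]; congr 1; ring
      _ ≤ _ := hpow2 (by nlinarith)
  · calc n * S * ℓ ≤ v ^ 18 := hN
      _ ≤ (2 ^ v) ^ 18 := Nat.pow_le_pow_left hv2 _
      _ = 2 ^ (18 * v) := by rw [← pow_mul]; congr 1; ring
      _ ≤ _ := hpow2 (by nlinarith)
  · have hunit : timeUnit (2 ^ (9 * v ^ 2)) ≤ v ^ 5 := by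
      have h1 : 9 * v ^ 2 + 1 ≤ v * v ^ 2 := by nlinarith
      calc timeUnit (2 ^ (9 * v ^ 2)) = 64 * 64 * (9 * v ^ 2 + 1) := by
            rw [timeUnit, Nat.size_pow]
        _ ≤ v * v * (v * v ^ 2) := by gcongr
        _ = v ^ 5 := by ring
    have h1 : 4 * n + 23 * ℓ + 12 ≤ v ^ 10 := by
      have h2 := hvv 9 10 rfl
      have h3 : v ≤ v ^ 9 := Nat.le_self_pow (by norm_num) v
      omega
    have h2 : n * (S * (4 * n + 23 * ℓ + 12) + 15) ≤ v ^ 20 := by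
      have h3 : S * (4 * n + 23 * ℓ + 12) ≤ v ^ 18 := by
        calc S * (4 * n + 23 * ℓ + 12) ≤ v ^ 8 * v ^ 10 := Nat.mul_le_mul hS h1
          _ = v ^ 18 := by ring
      have h4 : S * (4 * n + 23 * ℓ + 12) + 15 ≤ v ^ 19 := by
        have := hvv 18 19 rfl
        have := Nat.one_le_pow 18 v hv1
        omega
      calc n * (S * (4 * n + 23 * ℓ + 12) + 15) ≤ v * v ^ 19 := Nat.mul_le_mul hnv h4
        _ = v ^ 20 := by ring
    have h3 : 4 * e + 2 * d + 10 * n + 30 + 6 * (n * S * ℓ)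
        + n * (S * (4 * n + 23 * ℓ + 12) + 15) ≤ v ^ 21 := by
      have h4 := hvv 20 21 rfl
      have h5 : v ^ 18 ≤ v ^ 20 := hpow (by norm_num)
      have h6 : v ≤ v ^ 20 := Nat.le_self_pow (by norm_num) v
      omega
    calc _ ≤ v ^ 21 * v ^ 5 := Nat.mul_le_mul h3 hunit
      _ = v ^ 26 := by ring
      _ ≤ v ^ 30 := hpow (by norm_num)

/-- The number `n + 2 ^ (e + 1) + d + 64` is at most linear in the arguments of the polynomial that
bounds the running time. -/
theorem cast_parameter_pow_le {n r e d : ℕ} {ε δ : ℝ} (hε : 0 < ε) (hδ : 0 < δ)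
    (he : ε * 2 ^ e < 1) (hd : δ * 2 ^ d < 1) (k : ℕ) :
    (((n + 2 ^ (e + 1) + d + 64) ^ k : ℕ) : ℝ)
      ≤ MvPolynomial.eval ![(n : ℝ), (r : ℝ), 1 / ε, Real.log (1 / δ)]
        ((MvPolynomial.X 0 + MvPolynomial.C 2 * MvPolynomial.X 2
          + MvPolynomial.C 2 * MvPolynomial.X 3 + MvPolynomial.C 64) ^ k) := by
  have hEb : (2 : ℝ) ^ (e + 1) ≤ 2 * (1 / ε) := by
    rw [mul_one_div, le_div_iff₀ hε, pow_succ]; linarith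
  have hdb : (d : ℝ) ≤ 2 * Real.log (1 / δ) := by
    have hlt : (2 : ℝ) ^ d < 1 / δ := by rw [lt_div_iff₀ hδ]; linarith
    have hlog := Real.log_lt_log (by positivity) hlt
    rw [Real.log_pow] at hlog
    have h2 : (1 / 2 : ℝ) ≤ Real.log 2 := by linarith [Real.log_two_gt_d9]
    have h0 : (0 : ℝ) ≤ d := Nat.cast_nonneg d
    nlinarith
  simp only [map_pow, map_add, map_mul, MvPolynomial.eval_X, MvPolynomial.eval_C, Nat.cast_pow]
  refine pow_le_pow_left₀ (by positivity) ?_ k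
  simp only [Matrix.cons_val_zero, Matrix.cons_val]
  push_cast
  linarith

end Final

end OracleRAM

theorem mainTheorem3 :
    ∃ (c : OracleRAM.Cmd) (p : MvPolynomial (Fin 4) ℝ),
      ∀ (n r : ℕ) (M : Matroid (Fin n)), M.E = Set.univ → M.eRank = (r : ℕ∞) →
        ∀ ε δ : ℝ, 0 < ε → ε < 1 → 0 < δ → δ < 1 →
          ∃ T : ℕ,
            (T : ℝ) ≤ MvPolynomial.eval ![(n : ℝ), (r : ℝ), 1 / ε, Real.log (1 / δ)] p ∧
            OracleRAM.HaltsInTime c M.Indep ε δ T ∧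
            1 - δ ≤ OracleRAM.outputProb c M.Indep ε δ T
              (Set.Icc ((1 - ε) * ({B : Set (Fin n) | M.IsBase B}.ncard : ℝ))
                ((1 + ε) * ({B : Set (Fin n) | M.IsBase B}.ncard : ℝ))) := by
  refine ⟨OracleRAM.countBasesCmd, (MvPolynomial.X 0 + MvPolynomial.C 2 * MvPolynomial.X 2
    + MvPolynomial.C 2 * MvPolynomial.X 3 + MvPolynomial.C 64) ^ 30, ?_⟩
  intro n r M hM hr ε δ hε0 hε1 hδ0 hδ1
  obtain ⟨e, he, he', hE, hE'⟩ := OracleRAM.exists_first_binDigit hε0 hε1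
  obtain ⟨d, hd, hd', hδ, hδ'⟩ := OracleRAM.exists_first_binDigit hδ0 hδ1
  obtain ⟨u, h1, h2, h3, h4, h5, h6, h7, hT⟩ :=
    OracleRAM.parameter_bounds (n := n) (e := e) (d := d) rfl
  exact ⟨(n + 2 ^ (e + 1) + d + 64) ^ 30, OracleRAM.cast_parameter_pow_le hε0 hδ0 hE' hδ' 30,
    OracleRAM.countBasesCmd_correct hM hr hε0 hε1 he he' hE hd hd' hδ h1 h2 h3 h4 h5 h6 h7 hT⟩
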